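/- Let $\mathcal P_2$ be the set of probability measures on $\mathbb R$ with finite second moment, and for $\mu,\nu\in\mathcal P_2$ let $W_2(\mu,\nu)=\big(\inf_m\int_{\mathbb R^2}|x-y|^2\,m(dx,dy)\big)^{1/2}$, the infimum being over all couplings $m$ of $\mu$ and $\nu$. Fix $T>0$, $\sigma>0$, $H\in(0,1)$, $\theta\in\mathbb R^p$, a probability measure $\mu_0$ on $\mathbb R$ and functions $b_1,\dots,b_p:\mathbb R\times\mathcal P_2\to\mathbb R$. Assume: (i) there is $c>0$ such that $|b_m(x,\mu)-b_m(y,\nu)|\le c\,(|x-y|+W_2(\mu,\nu))$ for all $m$, all $x,y\in\mathbb R$ and all $\mu,\nu\in\mathcal P_2$; (ii) $\int_{\mathbb R}|x|^k\,\mu_0(dx)<\infty$ for every $k\ge1$. For each $N\ge1$ let $(X^{1,N},\dots,X^{N,N})$ be a solution, with continuous paths on $[0,T]$, of the interacting particle system $$dX^{i,N}_t=\sum_{m=1}^p\theta_m\,b_m(X^{i,N}_t,\mu^N_t)\,dt+\sigma\,dB^{i}_t,\qquad \mu^N_t=\frac1N\sum_{j=1}^N\delta_{X^{j,N}_t},\qquad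 i=1,\dots,N,$$ where $B^1,\dots,B^N$ are independent fractional Brownian motions with Hurst index $H$ and the initial values are i.i.d. with law $\mu_0$ and independent of $(B^1,\dots,B^N)$; the underlying probability space may depend on $N$. Let $\bar X$ be a solution, with continuous paths on $[0,T]$ and with laws $\bar\mu_t=\mathcal L(\bar X_t)\in\mathcal P_2$, of the McKean–Vlasov equation $$d\bar X_t=\sum_{m=1}^p\theta_m\,b_m(\bar X_t,\bar\mu_t)\,dt+\sigma\,dB_t,$$ where $B$ is a fractional Brownian motion with Hurst index $H$ and $\bar X_0$ has law $\mu_0$ and is independent of $B$. (Both equations are understood in integrated form, the drift being almost surely integrable on $[0,T]$.) Let $g:\mathbb R\times\mathcal P_2\to\mathbb R$ be locally Lipschitz in the sense that for some constant $C$ and some integers $k,l\ge0$, for all $x_1,x_2\in\mathbb R$ and $\mu_1,\mu_2\in\mathcal P_2$, $$|g(x_1,\mu_1)-g(x_2,\mu_2)|\le C\,\big(|x_1-x_2|+W_2(\mu_1,\mu_2)\big)\big(1+|x_1|^k+|x_2|^k+W_2^l(\mu_1,\delta_0)+W_2^l(\mu_2,\delta_0)\big).$$ Then all the integrals in the following display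 are well defined (those on the left almost surely), and $$\frac1N\sum_{i=1}^N\int_0^T g(X^{i,N}_s,\mu^N_s)\,ds\;\longrightarrow\;\int_0^T\mathbb E\big[g(\bar X_s,\bar\mu_s)\big]\,ds\qquad\text{in probability as }N\to\infty .$$ -/

import Mathlib

open MeasureTheory ProbabilityTheory Filter Set
open scoped Topology

noncomputable section

namespace FracMeanField

/-- `𝒫₂(ℝ)`: the probability measures on `ℝ` with a finite second moment. -/
def P2 : Type :=
  {μ : Measure ℝ // IsProbabilityMeasure μ ∧ Integrable (fun x : ℝ => x ^ 2) μ}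

/-- The measure underlying an element of `𝒫₂(ℝ)`. -/
def P2.toMeasure (μ : P2) : Measure ℝ := μ.1

/-- The set `Γ(μ, ν)` of probability measures on `ℝ²` with marginals `μ` and `ν`
(such a measure has total mass one since its marginals have). -/
def couplings (μ ν : P2) : Set (Measure (ℝ × ℝ)) :=
  {m | m.map Prod.fst = μ.toMeasure ∧ m.map Prod.snd = ν.toMeasure}

/-- The Wasserstein distance `W₂` on `𝒫₂(ℝ)`. The infimum is taken in `[0, ∞]`; it is finite,
because the product coupling has a finite cost. -/
def W2 (μ ν : P2) : ℝ :=
  Real.sqrt (⨅ m ∈ couplings μ ν, ∫⁻ z, ENNReal.ofReal (|z.1 - z.2| ^ 2) ∂m).toReal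

lemma integrable_sq_dirac (a : ℝ) : Integrable (fun x : ℝ => x ^ 2) (Measure.dirac a) :=
  integrable_dirac (by simp)

/-- The Dirac mass at `0`, as an element of `𝒫₂(ℝ)`. -/
def diracZero : P2 :=
  ⟨Measure.dirac 0, inferInstance, integrable_sq_dirac 0⟩

/-- The measure `(1/n) ∑ᵢ δ_{xᵢ}`. -/
def empiricalMeasure {n : ℕ} (x : Fin n → ℝ) : Measure ℝ :=
  (n : ENNReal)⁻¹ • ∑ i, Measure.dirac (x i)

lemma isProbabilityMeasure_empiricalMeasure {n : ℕ} (x : Fin (n + 1) → ℝ) :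
    IsProbabilityMeasure (empiricalMeasure x) := by
  constructor
  simp only [empiricalMeasure, Measure.smul_apply, Measure.finsetSum_apply, measure_univ,
    Finset.sum_const, Finset.card_univ, Fintype.card_fin, smul_eq_mul, nsmul_eq_mul, mul_one]
  exact ENNReal.inv_mul_cancel (by simp) (ENNReal.natCast_ne_top _)

lemma integrable_sq_empiricalMeasure {n : ℕ} (x : Fin (n + 1) → ℝ) :
    Integrable (fun y : ℝ => y ^ 2) (empiricalMeasure x) := by
  refine Integrable.smul_measure ?_ (by simp)
  exact integrable_finsetSum_measure.2 fun i _ => integrable_sq_dirac (x i)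

/-- The empirical measure of `n + 1` points, as an element of `𝒫₂(ℝ)`. -/
def empirical {n : ℕ} (x : Fin (n + 1) → ℝ) : P2 :=
  ⟨empiricalMeasure x, isProbabilityMeasure_empiricalMeasure x, integrable_sq_empiricalMeasure x⟩

/-- Lipschitz continuity of the drift functions `b₁, …, b_p`, with a common constant. -/
def LipschitzDrift {p : ℕ} (b : Fin p → ℝ → P2 → ℝ) : Prop :=
  ∃ c > 0, ∀ (m : Fin p) (x y : ℝ) (μ ν : P2),
    |b m x μ - b m y ν| ≤ c * (|x - y| + W2 μ ν)

/-- Local Lipschitz continuity of `g` on `ℝ × 𝒫₂(ℝ)` with a polynomially growing constant. -/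
def LocLipschitz (g : ℝ → P2 → ℝ) : Prop :=
  ∃ (C : ℝ) (k l : ℕ), ∀ (x₁ x₂ : ℝ) (μ₁ μ₂ : P2),
    |g x₁ μ₁ - g x₂ μ₂| ≤ C * (|x₁ - x₂| + W2 μ₁ μ₂) *
      (1 + |x₁| ^ k + |x₂| ^ k + W2 μ₁ diracZero ^ l + W2 μ₂ diracZero ^ l)

/-- The total drift `∑ₘ θₘ bₘ(x, μ)`. -/
def drift {p : ℕ} (θ : Fin p → ℝ) (b : Fin p → ℝ → P2 → ℝ) (x : ℝ) (μ : P2) : ℝ :=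
  ∑ m, θ m * b m x μ

/-- `(B_t)_{t ∈ [0, T]}` is a fractional Brownian motion of Hurst index `H`: a centred Gaussian
process with covariance `(t^{2H} + s^{2H} - |t - s|^{2H}) / 2` and almost surely continuous
paths. Only the times in `[0, T]` matter. -/
structure IsFBM {Ω : Type*} [MeasurableSpace Ω] (P : Measure Ω) (H T : ℝ)
    (B : ℝ → Ω → ℝ) : Prop where
  measurable : ∀ t ∈ Icc 0 T, Measurable (B t)
  gaussian : IsGaussianProcess (fun t : Icc (0 : ℝ) T => B t) P
  mean : ∀ t ∈ Icc 0 T, ∫ ω, B t ω ∂P = 0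
  cov : ∀ s ∈ Icc 0 T, ∀ t ∈ Icc 0 T,
    ∫ ω, B t ω * B s ω ∂P = (t ^ (2 * H) + s ^ (2 * H) - |t - s| ^ (2 * H)) / 2
  continuous : ∀ᵐ ω ∂P, ContinuousOn (fun t => B t ω) (Icc 0 T)

/-- The path `x` solves `dx_t = f_t dt + σ dw_t` on `[0, T]`, in integrated form. -/
structure SolvesOn (T σ : ℝ) (f w x : ℝ → ℝ) : Prop where
  continuousOn : ContinuousOn x (Icc 0 T)
  integrable : IntervalIntegrable f volume 0 T
  eq : ∀ t ∈ Icc 0 T, x t = x 0 + (∫ s in (0 : ℝ)..t, f s) + σ * w t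

/-- The system of `n + 1` interacting particles
`dX^i_t = ∑ₘ θₘ bₘ(X^i_t, μ_t) dt + σ dB^i_t` on `[0, T]`, where `μ_t` is the empirical measure
of the particles at time `t`, the `B^i` are independent fractional Brownian motions, and the
initial positions are i.i.d. with law `μ₀` and independent of the noise. -/
structure IsParticleSystem {Ω : Type*} [MeasurableSpace Ω] (P : Measure Ω) {p : ℕ}
    (θ : Fin p → ℝ) (b : Fin p → ℝ → P2 → ℝ) (H T σ : ℝ) (μ₀ : Measure ℝ) (n : ℕ)
    (B X : Fin (n + 1) → ℝ → Ω → ℝ) : Prop where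
  fbm : ∀ i, IsFBM P H T (B i)
  indep_noise : iIndepFun (fun i ω (t : Icc (0 : ℝ) T) => B i t ω) P
  measurable : ∀ i, ∀ t ∈ Icc 0 T, Measurable (X i t)
  law_init : P.map (fun ω i => X i 0 ω) = Measure.pi (fun _ => μ₀)
  indep_init : IndepFun (fun ω i => X i 0 ω) (fun ω i (t : Icc (0 : ℝ) T) => B i t ω) P
  eq : ∀ᵐ ω ∂P, ∀ i, SolvesOn T σ
    (fun s => drift θ b (X i s ω) (empirical fun j => X j s ω))
    (fun t => B i t ω) (fun t => X i t ω)

/-- The process `X` with marginal laws `μ_t ∈ 𝒫₂(ℝ)` solves the McKean-Vlasov equation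
`dX_t = ∑ₘ θₘ bₘ(X_t, μ_t) dt + σ dB_t` on `[0, T]`, where `B` is a fractional Brownian motion,
independent of the initial value, whose law is `μ₀`. -/
structure IsMcKeanVlasov {Ω : Type*} [MeasurableSpace Ω] (P : Measure Ω) {p : ℕ}
    (θ : Fin p → ℝ) (b : Fin p → ℝ → P2 → ℝ) (H T σ : ℝ) (μ₀ : Measure ℝ)
    (B X : ℝ → Ω → ℝ) (μ : ℝ → P2) : Prop where
  fbm : IsFBM P H T B
  measurable : ∀ t ∈ Icc 0 T, Measurable (X t)
  law_init : P.map (X 0) = μ₀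
  indep_init : IndepFun (X 0) (fun ω (t : Icc (0 : ℝ) T) => B t ω) P
  law : ∀ t ∈ Icc 0 T, P.map (X t) = (μ t).toMeasure
  eq : ∀ᵐ ω ∂P, SolvesOn T σ (fun s => drift θ b (X s ω) (μ s))
    (fun t => B t ω) (fun t => X t ω)

/-- Convergence in probability to a constant, where the `n`-th random variable may live on a
probability space of its own. -/
def TendstoInProb {Ω : ℕ → Type*} [∀ n, MeasurableSpace (Ω n)] (P : ∀ n, Measure (Ω n))
    (Y : ∀ n, Ω n → ℝ) (a : ℝ) : Prop :=
  ∀ ε > 0, Tendsto (fun n => P n {ω | ε ≤ |Y n ω - a|}) atTop (𝓝 0)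

end FracMeanField

end

noncomputable section

namespace FracMeanField

/-! The proof is a synchronous coupling argument. Put $F(\mu)=\int g(x,\mu)\,\mu(dx)$. The average
of $g$ over the particles is $F(\mu^N_s)$ and the limit integrand is $F(\bar\mu_s)$, so the claim is
the convergence of $\int_0^T F(\mu^N_s)\,ds$ to $\int_0^T F(\bar\mu_s)\,ds$.

Once the flow $\bar\mu$ is known and frozen in the drift, the McKean–Vlasov equation is a Lipschitz
equation with additive noise. Its solution is one measurable functional of the initial value and the
driving path (`solutionMap`, a limit of Euler schemes). Feeding it the data of the particles gives
processes $Y^1,\dots,Y^N$ on the space of the particles. Their time-$t$ values are i.i.d. with law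
$\bar\mu_t$, because the data are i.i.d. with the law of $(\bar X_0,B)$
(`IsParticleSystem.exists_coupling`). The noise cancels in $X^i-Y^i$, and Grönwall's inequality
yields the deterministic bound $\max_i|X^i_t-Y^i_t|\le\kappa\int_0^T W_2(\mu^N_s[Y],\bar\mu_s)\,ds$
(`norm_sub_le_of_coupled`), where $\mu^N_s[Y]$ is the empirical measure of the copies.

The right side is small by a law of large numbers in $W_2$ that is uniform over laws with bounded
fourth moment (`eventually_lintegral_W2_empirical_le`): round to a finite grid, then control the
cell frequencies by their variances. The moments of $\bar X$ are bounded
(`IsMcKeanVlasov.exists_moment_le`) and its flow of laws is continuous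
(`IsMcKeanVlasov.continuousOn_law`).

Finally, `exists_mean_sub_le` bounds $|F(\mu)-F(\nu)|$ by $W_2^2/\lambda$ plus $\lambda$ times
moments, for every $\lambda>0$. Markov's inequality controls $\int W_2^2$ and the moments of the
copies. The particles themselves need no moment estimate, since they stay close to the copies on the
good event (`exists_pathwise_bound`). -/

/-! ### The Wasserstein distance -/

instance (μ : P2) : IsProbabilityMeasure μ.toMeasure := μ.2.1

lemma P2.integrable_sq (μ : P2) : Integrable (fun x : ℝ => x ^ 2) μ.toMeasure := μ.2.2

lemma P2.memLp_id (μ : P2) : MemLp (fun x : ℝ => x) 2 μ.toMeasure :=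
  (memLp_two_iff_integrable_sq (by fun_prop)).2 μ.integrable_sq

lemma isProbabilityMeasure_of_mem_couplings {μ ν : P2} {m : Measure (ℝ × ℝ)}
    (hm : m ∈ couplings μ ν) : IsProbabilityMeasure m := by
  have h : IsProbabilityMeasure (m.map Prod.fst) := by rw [hm.1]; infer_instance
  exact Measure.isProbabilityMeasure_of_map (Prod.fst : ℝ × ℝ → ℝ)

/-- The quadratic transport cost as an `L²` norm. -/
lemma lintegral_cost_eq (m : Measure (ℝ × ℝ)) :
    ∫⁻ z, ENNReal.ofReal (|z.1 - z.2| ^ 2) ∂m = eLpNorm (fun z : ℝ × ℝ => z.1 - z.2) 2 m ^ 2 := by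
  have h := eLpNorm_nnreal_pow_eq_lintegral (μ := m) (f := fun z : ℝ × ℝ => z.1 - z.2)
    (p := 2) two_ne_zero
  norm_num at h
  rw [h]
  refine lintegral_congr fun z => ?_
  rw [← Real.norm_eq_abs, ENNReal.ofReal_pow (norm_nonneg _), ofReal_norm]

lemma memLp_fst {μ ν : P2} {m : Measure (ℝ × ℝ)} (hm : m ∈ couplings μ ν) :
    MemLp (fun z : ℝ × ℝ => z.1) 2 m := by
  have h := μ.memLp_id
  rw [← hm.1] at h
  exact h.comp_of_map measurable_fst.aemeasurable

lemma memLp_snd {μ ν : P2} {m : Measure (ℝ × ℝ)} (hm : m ∈ couplings μ ν) :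
    MemLp (fun z : ℝ × ℝ => z.2) 2 m := by
  have h := ν.memLp_id
  rw [← hm.2] at h
  exact h.comp_of_map measurable_snd.aemeasurable

lemma memLp_sub {μ ν : P2} {m : Measure (ℝ × ℝ)} (hm : m ∈ couplings μ ν) :
    MemLp (fun z : ℝ × ℝ => z.1 - z.2) 2 m :=
  (memLp_fst hm).sub (memLp_snd hm)

lemma prod_mem_couplings (μ ν : P2) : μ.toMeasure.prod ν.toMeasure ∈ couplings μ ν :=
  ⟨by rw [← Measure.fst, Measure.fst_prod], by rw [← Measure.snd, Measure.snd_prod]⟩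

lemma W2_nonneg (μ ν : P2) : 0 ≤ W2 μ ν := Real.sqrt_nonneg _

lemma W2_sq (μ ν : P2) :
    W2 μ ν ^ 2 = (⨅ m ∈ couplings μ ν, ∫⁻ z, ENNReal.ofReal (|z.1 - z.2| ^ 2) ∂m).toReal :=
  Real.sq_sqrt ENNReal.toReal_nonneg

lemma ofReal_W2_sq_le {μ ν : P2} {m : Measure (ℝ × ℝ)} (hm : m ∈ couplings μ ν) :
    ENNReal.ofReal (W2 μ ν ^ 2) ≤ ∫⁻ z, ENNReal.ofReal (|z.1 - z.2| ^ 2) ∂m := by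
  rw [W2_sq]
  exact ENNReal.ofReal_toReal_le.trans (iInf₂_le m hm)

lemma ofReal_W2_le {μ ν : P2} {m : Measure (ℝ × ℝ)} (hm : m ∈ couplings μ ν) :
    ENNReal.ofReal (W2 μ ν) ≤ eLpNorm (fun z : ℝ × ℝ => z.1 - z.2) 2 m := by
  have h := ofReal_W2_sq_le hm
  rw [lintegral_cost_eq, ENNReal.ofReal_pow (W2_nonneg _ _)] at h
  exact (ENNReal.pow_le_pow_left_iff two_ne_zero).1 h

lemma exists_coupling_lintegral_lt (μ ν : P2) {r : ℝ} (hr : W2 μ ν ^ 2 < r) :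
    ∃ m ∈ couplings μ ν, ∫⁻ z, ENNReal.ofReal (|z.1 - z.2| ^ 2) ∂m < ENNReal.ofReal r := by
  -- Finiteness is essential here: `toReal` would send an infinite infimum to `0`.
  have hfin : (⨅ m ∈ couplings μ ν, ∫⁻ z, ENNReal.ofReal (|z.1 - z.2| ^ 2) ∂m) ≠ ⊤ := by
    refine ne_top_of_le_ne_top ?_ (iInf₂_le _ (prod_mem_couplings μ ν))
    rw [lintegral_cost_eq]
    exact ENNReal.pow_ne_top (memLp_sub (prod_mem_couplings μ ν)).2.ne
  rw [W2_sq] at hr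
  have := (ENNReal.lt_ofReal_iff_toReal_lt hfin).2 hr
  simpa [iInf_lt_iff] using this

lemma exists_coupling_eLpNorm_lt (μ ν : P2) {r : ℝ} (hr : W2 μ ν < r) :
    ∃ m ∈ couplings μ ν, eLpNorm (fun z : ℝ × ℝ => z.1 - z.2) 2 m < ENNReal.ofReal r := by
  have h0 := W2_nonneg μ ν
  obtain ⟨m, hm, h⟩ := exists_coupling_lintegral_lt μ ν (r := r ^ 2) (by gcongr)
  refine ⟨m, hm, ?_⟩
  rw [lintegral_cost_eq, ENNReal.ofReal_pow (by linarith)] at h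
  exact (ENNReal.pow_lt_pow_left_iff two_ne_zero).1 h

/-- Gluing of two couplings along their common marginal. -/
lemma exists_glue {μ ν ρ : P2} {m₁ m₂ : Measure (ℝ × ℝ)} (h₁ : m₁ ∈ couplings μ ν)
    (h₂ : m₂ ∈ couplings ν ρ) :
    ∃ π : Measure ((ℝ × ℝ) × ℝ), π.map Prod.fst = m₁ ∧ π.map (fun z => (z.1.2, z.2)) = m₂ := by
  have := isProbabilityMeasure_of_mem_couplings h₁
  have := isProbabilityMeasure_of_mem_couplings h₂
  -- Given the pair drawn from `m₁`, the third coordinate is drawn from the disintegration of `m₂`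
  -- at the second coordinate.
  refine ⟨m₁ ⊗ₘ (m₂.condKernel.comap Prod.snd measurable_snd), ?_, ?_⟩
  · rw [← Measure.fst, Measure.fst_compProd]
  · have hm₂ : m₁.map Prod.snd ⊗ₘ m₂.condKernel = m₂ := by
      rw [h₁.2, ← h₂.1]
      exact m₂.disintegrate m₂.condKernel
    refine Measure.ext_of_lintegral _ fun f hf => ?_
    conv_rhs => rw [← hm₂]
    have hc : Measurable fun a => ∫⁻ b, f (a, b) ∂(m₂.condKernel a) := hf.lintegral_kernel_prod_right'
    rw [lintegral_map hf (by fun_prop), Measure.lintegral_compProd (by fun_prop),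
      Measure.lintegral_compProd hf, lintegral_map hc measurable_snd]
    rfl

/-- Minkowski's inequality in `L²` of a gluing of two near-optimal plans; the outer coordinates of
the gluing couple `μ` and `ρ`. Near-optimality suffices, so no optimal plan has to exist. -/
lemma W2_triangle (μ ν ρ : P2) : W2 μ ρ ≤ W2 μ ν + W2 ν ρ := by
  refine le_of_forall_pos_lt_add fun ε hε => ?_
  obtain ⟨m₁, h₁, c₁⟩ := exists_coupling_eLpNorm_lt μ ν (r := W2 μ ν + ε / 2) (by linarith)
  obtain ⟨m₂, h₂, c₂⟩ := exists_coupling_eLpNorm_lt ν ρ (r := W2 ν ρ + ε / 2) (by linarith)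
  obtain ⟨π, hπ₁, hπ₂⟩ := exists_glue h₁ h₂
  have hg : Measurable fun z : (ℝ × ℝ) × ℝ => (z.1.1, z.2) := by fun_prop
  have hg₂ : Measurable fun z : (ℝ × ℝ) × ℝ => (z.1.2, z.2) := by fun_prop
  have h₃ : π.map (fun z => (z.1.1, z.2)) ∈ couplings μ ρ := by
    constructor
    · rw [Measure.map_map measurable_fst hg, ← h₁.1, ← hπ₁,
        Measure.map_map measurable_fst measurable_fst]
      rfl
    · rw [Measure.map_map measurable_snd hg, ← h₂.2, ← hπ₂,
        Measure.map_map measurable_snd hg₂]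
      rfl
  have hs : ∀ κ : Measure (ℝ × ℝ), AEStronglyMeasurable (fun z : ℝ × ℝ => z.1 - z.2) κ :=
    fun κ => by fun_prop
  have h := ofReal_W2_le h₃
  rw [eLpNorm_map_measure (hs _) hg.aemeasurable] at h
  rw [← hπ₁, eLpNorm_map_measure (hs _) measurable_fst.aemeasurable] at c₁
  rw [← hπ₂, eLpNorm_map_measure (hs _) hg₂.aemeasurable] at c₂
  have hsum : ((fun z : ℝ × ℝ => z.1 - z.2) ∘ fun z : (ℝ × ℝ) × ℝ => (z.1.1, z.2)) =
      ((fun z : ℝ × ℝ => z.1 - z.2) ∘ Prod.fst) +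
      ((fun z : ℝ × ℝ => z.1 - z.2) ∘ fun z : (ℝ × ℝ) × ℝ => (z.1.2, z.2)) := by
    ext z; simp
  rw [hsum] at h
  have h' := (h.trans (eLpNorm_add_le (by fun_prop) (by fun_prop) (by norm_num))).trans_lt
    (ENNReal.add_lt_add c₁ c₂)
  rw [← ENNReal.ofReal_add (by have := W2_nonneg μ ν; linarith)
    (by have := W2_nonneg ν ρ; linarith)] at h'
  have := (ENNReal.ofReal_lt_ofReal_iff_of_nonneg (W2_nonneg _ _)).1 h'
  linarith

lemma W2_comm_le (μ ν : P2) : W2 μ ν ≤ W2 ν μ := by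
  refine le_of_forall_pos_lt_add fun ε hε => ?_
  obtain ⟨m, h, c⟩ := exists_coupling_eLpNorm_lt ν μ (r := W2 ν μ + ε) (by linarith)
  have h' : m.map Prod.swap ∈ couplings μ ν := by
    constructor
    · rw [Measure.map_map measurable_fst measurable_swap, ← h.2]; rfl
    · rw [Measure.map_map measurable_snd measurable_swap, ← h.1]; rfl
  have h2 := ofReal_W2_le h'
  rw [eLpNorm_map_measure (by fun_prop) (by fun_prop), ← eLpNorm_neg] at h2
  have hsw : -((fun z : ℝ × ℝ => z.1 - z.2) ∘ Prod.swap) = fun z : ℝ × ℝ => z.1 - z.2 := by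
    ext z; simp
  rw [hsw] at h2
  exact (ENNReal.ofReal_lt_ofReal_iff_of_nonneg (W2_nonneg _ _)).1 (h2.trans_lt c)

lemma W2_comm (μ ν : P2) : W2 μ ν = W2 ν μ := le_antisymm (W2_comm_le _ _) (W2_comm_le _ _)

/-- The distance of the laws of two random variables is at most their `L²` distance. -/
lemma ofReal_W2_sq_le_of_law {Ω : Type*} [MeasurableSpace Ω] {P : Measure Ω} {X Y : Ω → ℝ}
    (hX : AEMeasurable X P) (hY : AEMeasurable Y P) {μ ν : P2} (hμ : P.map X = μ.toMeasure)
    (hν : P.map Y = ν.toMeasure) :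
    ENNReal.ofReal (W2 μ ν ^ 2) ≤ ∫⁻ ω, ENNReal.ofReal (|X ω - Y ω| ^ 2) ∂P := by
  have hm : P.map (fun ω => (X ω, Y ω)) ∈ couplings μ ν := by
    constructor
    · rw [AEMeasurable.map_map_of_aemeasurable (by fun_prop) (by fun_prop), ← hμ]; rfl
    · rw [AEMeasurable.map_map_of_aemeasurable (by fun_prop) (by fun_prop), ← hν]; rfl
  refine (ofReal_W2_sq_le hm).trans_eq ?_
  rw [lintegral_map' (by fun_prop) (by fun_prop)]

lemma W2_self (μ : P2) : W2 μ μ = 0 := by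
  have h := ofReal_W2_sq_le_of_law (P := μ.toMeasure) (X := id) (Y := id) (by fun_prop)
    (by fun_prop) (by simp) (by simp) (μ := μ) (ν := μ)
  have h2 : W2 μ μ ^ 2 ≤ 0 := by simpa using h
  nlinarith [W2_nonneg μ μ]

lemma W2_diracZero_sq_le (μ : P2) : W2 μ diracZero ^ 2 ≤ ∫ x, x ^ 2 ∂μ.toMeasure := by
  have h := ofReal_W2_sq_le_of_law (P := μ.toMeasure) (X := id) (Y := fun _ => 0) (by fun_prop)
    (by fun_prop) (by simp) (by rw [Measure.map_const]; simp; rfl) (μ := μ) (ν := diracZero)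
  simp only [id, sub_zero, sq_abs] at h
  rw [← ofReal_integral_eq_lintegral_ofReal μ.integrable_sq (ae_of_all _ fun x => sq_nonneg x)] at h
  exact (ENNReal.ofReal_le_ofReal_iff (integral_nonneg fun x => sq_nonneg x)).1 h

/-! ### Empirical measures and the pseudometric on $\mathcal P_2$ -/

lemma integral_empirical {n : ℕ} (x : Fin (n + 1) → ℝ) (f : ℝ → ℝ) :
    ∫ y, f y ∂(empirical x).toMeasure = (1 / ((n : ℝ) + 1)) * ∑ i, f (x i) := by
  change ∫ y, f y ∂(empiricalMeasure x) = _
  rw [empiricalMeasure, integral_smul_measure, integral_finsetSum_measure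
    (fun i _ => integrable_dirac (by simp))]
  norm_num [ENNReal.toReal_add]

lemma integrable_empirical {n : ℕ} (x : Fin (n + 1) → ℝ) (f : ℝ → ℝ) :
    Integrable f (empirical x).toMeasure := by
  refine Integrable.smul_measure ?_ (by simp)
  exact integrable_finsetSum_measure.2 fun i _ => integrable_dirac (by simp)

/-- The empirical measure is the law of the coordinate at a uniformly chosen index. -/
lemma empirical_eq_map {n : ℕ} (x : Fin (n + 1) → ℝ) :
    (((n + 1 : ℕ) : ENNReal)⁻¹ • Measure.count : Measure (Fin (n + 1))).map x =
      (empirical x).toMeasure := by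
  change _ = empiricalMeasure x
  rw [empiricalMeasure, Measure.map_smul, Measure.count, Measure.map_sum (by fun_prop),
    Measure.sum_fintype]
  congr 2
  ext1 i
  exact Measure.map_dirac' (by fun_prop) i

/-- Atoms with the same index are coupled: both measures are images of the uniform law on the
indices. -/
lemma W2_empirical_sq_le {n : ℕ} (x y : Fin (n + 1) → ℝ) :
    W2 (empirical x) (empirical y) ^ 2 ≤ (1 / ((n : ℝ) + 1)) * ∑ i, |x i - y i| ^ 2 := by
  have h := ofReal_W2_sq_le_of_law (by fun_prop) (by fun_prop) (empirical_eq_map x)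
    (empirical_eq_map y)
  rw [lintegral_smul_measure, lintegral_count, tsum_fintype,
    ← ENNReal.ofReal_sum_of_nonneg (fun i _ => sq_nonneg _)] at h
  have h3 : (((n + 1 : ℕ) : ENNReal))⁻¹ = ENNReal.ofReal (1 / ((n : ℝ) + 1)) := by
    rw [one_div, ENNReal.ofReal_inv_of_pos (by positivity)]
    congr 1
    rw [← Nat.cast_succ, ENNReal.ofReal_natCast]
  rw [h3, smul_eq_mul, ← ENNReal.ofReal_mul (by positivity)] at h
  exact (ENNReal.ofReal_le_ofReal_iff (by positivity)).1 h

lemma W2_empirical_le {n : ℕ} (x y : Fin (n + 1) → ℝ) :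
    W2 (empirical x) (empirical y) ≤ ‖x - y‖ := by
  refine le_of_sq_le_sq ?_ (norm_nonneg _)
  refine (W2_empirical_sq_le x y).trans ?_
  calc (1 / ((n : ℝ) + 1)) * ∑ i, |x i - y i| ^ 2
      ≤ (1 / ((n : ℝ) + 1)) * ∑ _i : Fin (n + 1), ‖x - y‖ ^ 2 := by
        gcongr with i
        exact norm_le_pi_norm (x - y) i
    _ = ‖x - y‖ ^ 2 := by simp; field_simp

/-- This gives access to continuity on `P2`. That distance zero forces equality is never used, so a
pseudometric is enough. -/
instance : PseudoMetricSpace P2 where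
  dist := W2
  dist_self := W2_self
  dist_comm := W2_comm
  dist_triangle := W2_triangle

lemma dist_P2 (μ ν : P2) : dist μ ν = W2 μ ν := rfl

lemma continuous_empirical {n : ℕ} :
    Continuous (empirical : (Fin (n + 1) → ℝ) → P2) := by
  refine (LipschitzWith.of_dist_le_mul (K := 1) fun x y => ?_).continuous
  rw [dist_P2, NNReal.coe_one, one_mul, dist_eq_norm]
  exact W2_empirical_le x y

/-! ### Continuity of the coefficients and of the mean functional -/

lemma LocLipschitz.continuous {g : ℝ → P2 → ℝ} (hg : LocLipschitz g) :
    Continuous fun z : ℝ × P2 => g z.1 z.2 := by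
  obtain ⟨C, k, l, h⟩ := hg
  rw [continuous_iff_continuousAt]
  intro z
  rw [ContinuousAt, tendsto_iff_dist_tendsto_zero]
  refine squeeze_zero (fun _ => dist_nonneg) (fun y => h y.1 z.1 y.2 z.2) ?_
  have hc : Continuous fun y : ℝ × P2 => C * (|y.1 - z.1| + dist y.2 z.2) *
      (1 + |y.1| ^ k + |z.1| ^ k + dist y.2 diracZero ^ l + dist z.2 diracZero ^ l) := by
    fun_prop
  have := hc.tendsto z
  simpa [dist_P2] using this

lemma LipschitzDrift.exists_drift {p : ℕ} {b : Fin p → ℝ → P2 → ℝ} (hb : LipschitzDrift b)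
    (θ : Fin p → ℝ) : ∃ L > 0, ∀ (x y : ℝ) (μ ν : P2),
      |drift θ b x μ - drift θ b y ν| ≤ L * (|x - y| + W2 μ ν) := by
  obtain ⟨c, hc, h⟩ := hb
  -- The added `1` keeps the constant positive when all `θ m` vanish or `p = 0`.
  refine ⟨(∑ m, |θ m|) * c + 1, by positivity, fun x y μ ν => ?_⟩
  have hW := W2_nonneg μ ν
  calc |drift θ b x μ - drift θ b y ν| = |∑ m, θ m * (b m x μ - b m y ν)| := by
        simp [drift, mul_sub]
    _ ≤ ∑ m, |θ m * (b m x μ - b m y ν)| := Finset.abs_sum_le_sum_abs _ _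
    _ ≤ ∑ m, |θ m| * (c * (|x - y| + W2 μ ν)) := by
        gcongr with m
        rw [abs_mul]
        gcongr
        exact h m x y μ ν
    _ = (∑ m, |θ m|) * c * (|x - y| + W2 μ ν) := by rw [← Finset.sum_mul]; ring
    _ ≤ _ := by gcongr; linarith

lemma continuous_drift {p : ℕ} {b : Fin p → ℝ → P2 → ℝ} (hb : LipschitzDrift b)
    (θ : Fin p → ℝ) : Continuous fun z : ℝ × P2 => drift θ b z.1 z.2 := by
  obtain ⟨L, -, hL⟩ := hb.exists_drift θ
  rw [continuous_iff_continuousAt]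
  intro z
  rw [ContinuousAt, tendsto_iff_dist_tendsto_zero]
  refine squeeze_zero (fun _ => dist_nonneg) (fun y => hL y.1 z.1 y.2 z.2) ?_
  have hc : Continuous fun y : ℝ × P2 => L * (|y.1 - z.1| + dist y.2 z.2) := by fun_prop
  have := hc.tendsto z
  simpa [dist_P2] using this

lemma pow_le_one_add_pow {a : ℝ} (ha : 0 ≤ a) {i j : ℕ} (hij : i ≤ j) : a ^ i ≤ 1 + a ^ j := by
  rcases le_total a 1 with h | h
  · have := pow_le_one₀ ha h (n := i)
    have := pow_nonneg ha j
    linarith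
  · have := pow_le_pow_right₀ h hij
    linarith

/-- Jensen's inequality for $u\mapsto u^q$ on $[0,\infty)$. -/
lemma integral_sq_pow_le {μ : P2} {q : ℕ}
    (hμ : Integrable (fun x : ℝ => |x| ^ (2 * q)) μ.toMeasure) :
    (∫ x, x ^ 2 ∂μ.toMeasure) ^ q ≤ ∫ x, |x| ^ (2 * q) ∂μ.toMeasure := by
  have h := (convexOn_pow q).map_integral_le (μ := μ.toMeasure) (f := fun x : ℝ => x ^ 2)
    (by fun_prop) isClosed_Ici (ae_of_all _ fun x => sq_nonneg x) μ.integrable_sq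
    (by simpa [Function.comp_def, pow_mul] using hμ)
  simpa [pow_mul] using h

/-- Turns the Wasserstein weights of the local Lipschitz condition into moments, which can be
averaged over particles. -/
lemma W2_diracZero_pow_le {μ : P2} {l q : ℕ} (hlq : l ≤ q)
    (hμ : Integrable (fun x : ℝ => |x| ^ (2 * q)) μ.toMeasure) :
    (W2 μ diracZero ^ l) ^ 2 ≤ 1 + ∫ x, |x| ^ (2 * q) ∂μ.toMeasure := by
  rw [← pow_mul, mul_comm, pow_mul]
  refine (pow_le_one_add_pow (sq_nonneg _) hlq).trans ?_
  have := pow_le_pow_left₀ (sq_nonneg _) (W2_diracZero_sq_le μ) q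
  have := integral_sq_pow_le hμ
  linarith

/-- A weighted form of the local Lipschitz bound, with the product split by Young's inequality. -/
lemma LocLipschitz.exists_young {g : ℝ → P2 → ℝ} (hg : LocLipschitz g) :
    ∃ C ≥ 0, ∃ q : ℕ, ∀ (μ ν : P2), Integrable (fun x : ℝ => |x| ^ (2 * q)) μ.toMeasure →
      Integrable (fun x : ℝ => |x| ^ (2 * q)) ν.toMeasure → ∀ lam > 0, ∀ x y : ℝ,
      |g x μ - g y ν| ≤ C * ((|x - y| ^ 2 + W2 μ ν ^ 2) / lam +
        lam * (1 + |x| ^ (2 * q) + |y| ^ (2 * q) + ∫ z, |z| ^ (2 * q) ∂μ.toMeasure +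
          ∫ z, |z| ^ (2 * q) ∂ν.toMeasure)) := by
  obtain ⟨C, k, l, h⟩ := hg
  -- The exponent `k + l` dominates both `k` and `l`. The factor 25 is 5 · 5: one 5 from squaring a
  -- sum of five terms, another because each of the four squared weights costs an extra `1`. The
  -- absolute value is there since no sign of `C` is assumed.
  refine ⟨25 * |C|, by positivity, k + l, fun μ ν hμ hν lam hlam x y => ?_⟩
  have e1 := W2_diracZero_pow_le (Nat.le_add_left l k) hμ
  have e2 := W2_diracZero_pow_le (Nat.le_add_left l k) hν
  have e3 : (|x| ^ k) ^ 2 ≤ 1 + |x| ^ (2 * (k + l)) := by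
    rw [← pow_mul, mul_comm]; exact pow_le_one_add_pow (abs_nonneg x) (by omega)
  have e4 : (|y| ^ k) ^ 2 ≤ 1 + |y| ^ (2 * (k + l)) := by
    rw [← pow_mul, mul_comm]; exact pow_le_one_add_pow (abs_nonneg y) (by omega)
  set Mμ := ∫ z, |z| ^ (2 * (k + l)) ∂μ.toMeasure
  set Mν := ∫ z, |z| ^ (2 * (k + l)) ∂ν.toMeasure
  set a := |x| ^ k
  set a' := |y| ^ k
  set d := W2 μ diracZero ^ l
  set d' := W2 ν diracZero ^ l
  set A := |x| ^ (2 * (k + l))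
  set A' := |y| ^ (2 * (k + l))
  have hA : 0 ≤ A := by positivity
  have hA' : 0 ≤ A' := by positivity
  have hW := W2_nonneg μ ν
  have hw : (1 + a + a' + d + d') ^ 2 ≤ 25 * (1 + A + A' + Mμ + Mν) := by
    have h5 : (1 + a + a' + d + d') ^ 2 + ((1 - a) ^ 2 + (1 - a') ^ 2 + (1 - d) ^ 2 + (1 - d') ^ 2
        + (a - a') ^ 2 + (a - d) ^ 2 + (a - d') ^ 2 + (a' - d) ^ 2 + (a' - d') ^ 2 + (d - d') ^ 2) =
        5 * (1 + a ^ 2 + a' ^ 2 + d ^ 2 + d' ^ 2) := by ring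
    have h6 : 0 ≤ (1 - a) ^ 2 + (1 - a') ^ 2 + (1 - d) ^ 2 + (1 - d') ^ 2
        + (a - a') ^ 2 + (a - d) ^ 2 + (a - d') ^ 2 + (a' - d) ^ 2 + (a' - d') ^ 2 + (d - d') ^ 2 := by
      positivity
    have hMμ : 0 ≤ Mμ := integral_nonneg fun z => by positivity
    have hMν : 0 ≤ Mν := integral_nonneg fun z => by positivity
    linarith
  have hyoung : ∀ u v : ℝ, u * v ≤ u ^ 2 / (2 * lam) + lam * v ^ 2 := by
    intro u v
    have h1 : u ^ 2 / (2 * lam) + lam * v ^ 2 - u * v =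
        ((u - lam * v) ^ 2 + lam ^ 2 * v ^ 2) / (2 * lam) := by field_simp; ring
    have : 0 ≤ ((u - lam * v) ^ 2 + lam ^ 2 * v ^ 2) / (2 * lam) := by positivity
    linarith
  have hd0 : 0 ≤ d := pow_nonneg (W2_nonneg _ _) _
  have hd0' : 0 ≤ d' := pow_nonneg (W2_nonneg _ _) _
  have hd : (|x - y| + W2 μ ν) ^ 2 ≤ 2 * (|x - y| ^ 2 + W2 μ ν ^ 2) := by
    nlinarith [sq_nonneg (|x - y| - W2 μ ν)]
  calc |g x μ - g y ν| ≤ C * (|x - y| + W2 μ ν) * (1 + a + a' + d + d') := h x y μ ν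
    _ ≤ |C| * ((|x - y| + W2 μ ν) * (1 + a + a' + d + d')) := by
        rw [mul_assoc]
        gcongr
        exact le_abs_self C
    _ ≤ |C| * ((|x - y| + W2 μ ν) ^ 2 / (2 * lam) + lam * (1 + a + a' + d + d') ^ 2) := by
        gcongr; exact hyoung _ _
    _ ≤ |C| * (2 * (|x - y| ^ 2 + W2 μ ν ^ 2) / (2 * lam) +
          lam * (25 * (1 + A + A' + Mμ + Mν))) := by gcongr
    _ ≤ _ := by
        have h1 : 2 * (|x - y| ^ 2 + W2 μ ν ^ 2) / (2 * lam) =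
          (|x - y| ^ 2 + W2 μ ν ^ 2) / lam := by field_simp
        have h2 : 0 ≤ |C| * ((|x - y| ^ 2 + W2 μ ν ^ 2) / lam) := by positivity
        rw [h1]
        nlinarith

/-- The mean of `g(·, μ)` under `μ` is controlled by the Wasserstein distance. -/
lemma exists_mean_sub_le {g : ℝ → P2 → ℝ} (hg : LocLipschitz g) :
    ∃ C ≥ 0, ∃ q : ℕ,
      (∀ μ : P2, Integrable (fun x : ℝ => |x| ^ (2 * q)) μ.toMeasure → 
        Integrable (fun x => g x μ) μ.toMeasure) ∧
      ∀ (μ ν : P2), Integrable (fun x : ℝ => |x| ^ (2 * q)) μ.toMeasure →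
      Integrable (fun x : ℝ => |x| ^ (2 * q)) ν.toMeasure → ∀ lam > 0,
      |∫ x, g x μ ∂μ.toMeasure - ∫ x, g x ν ∂ν.toMeasure| ≤ C * (W2 μ ν ^ 2 / lam +
        lam * (1 + ∫ z, |z| ^ (2 * q) ∂μ.toMeasure + ∫ z, |z| ^ (2 * q) ∂ν.toMeasure)) := by
  have hcont := hg.continuous
  obtain ⟨C, hC, q, h⟩ := hg.exists_young
  have hint : ∀ μ : P2, Integrable (fun x : ℝ => |x| ^ (2 * q)) μ.toMeasure → 
        Integrable (fun x => g x μ) μ.toMeasure := by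
    intro μ hμ
    have hgc : Continuous fun x => g x μ := hcont.comp (by fun_prop : Continuous fun x => (x, μ))
    -- The dominating function is the Young bound at `y = 0`, `lam = 1`, with both measures equal to
    -- `μ`.
    have hb : Integrable (fun x : ℝ => |g 0 μ| + C * ((x ^ 2 + W2 μ μ ^ 2) / 1 +
        1 * (1 + |x| ^ (2 * q) + |0| ^ (2 * q) + ∫ z, |z| ^ (2 * q) ∂μ.toMeasure +
          ∫ z, |z| ^ (2 * q) ∂μ.toMeasure))) μ.toMeasure := by
      have := μ.integrable_sq
      fun_prop
    refine hb.mono' hgc.aestronglyMeasurable (ae_of_all _ fun x => ?_)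
    have h1 := h μ μ hμ hμ 1 one_pos x 0
    rw [sub_zero, sq_abs] at h1
    rw [Real.norm_eq_abs]
    have := abs_sub_abs_le_abs_sub (g x μ) (g 0 μ)
    linarith
  refine ⟨4 * C, by positivity, q, hint, fun μ ν hμ hν lam hlam => ?_⟩
  set Mμ := ∫ z, |z| ^ (2 * q) ∂μ.toMeasure
  set Mν := ∫ z, |z| ^ (2 * q) ∂ν.toMeasure
  have hMμ : 0 ≤ Mμ := integral_nonneg fun z => by positivity
  have hMν : 0 ≤ Mν := integral_nonneg fun z => by positivity
  refine le_of_forall_pos_le_add fun ε hε => ?_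
  -- The excess cost allowed to the plan: multiplied by `C / lam` it stays below `ε`, and `C + 1`
  -- avoids dividing by zero.
  have hε' : 0 < ε * lam / (C + 1) := by positivity
  obtain ⟨m, hm, hcost⟩ := exists_coupling_lintegral_lt μ ν (r := W2 μ ν ^ 2 + ε * lam / (C + 1))
    (by linarith)
  have := isProbabilityMeasure_of_mem_couplings hm
  have hcost' : ∫ z, |z.1 - z.2| ^ 2 ∂m ≤ W2 μ ν ^ 2 + ε * lam / (C + 1) := by
    rw [integral_eq_lintegral_of_nonneg_ae (ae_of_all _ fun z => by positivity) (by fun_prop)]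
    exact ENNReal.toReal_le_of_le_ofReal (by positivity) hcost.le
  have hsq : Integrable (fun z : ℝ × ℝ => |z.1 - z.2| ^ 2) m := by
    have := (memLp_two_iff_integrable_sq (by fun_prop)).1 (memLp_sub hm)
    simpa using this
  have hfst : ∀ f : ℝ → ℝ, Integrable f μ.toMeasure → Integrable (fun z : ℝ × ℝ => f z.1) m ∧
      ∫ z, f z.1 ∂m = ∫ x, f x ∂μ.toMeasure := by
    intro f hf
    rw [← hm.1] at hf ⊢
    exact ⟨hf.comp_measurable measurable_fst,
      (integral_map measurable_fst.aemeasurable hf.1).symm⟩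
  have hsnd : ∀ f : ℝ → ℝ, Integrable f ν.toMeasure → Integrable (fun z : ℝ × ℝ => f z.2) m ∧
      ∫ z, f z.2 ∂m = ∫ x, f x ∂ν.toMeasure := by
    intro f hf
    rw [← hm.2] at hf ⊢
    exact ⟨hf.comp_measurable measurable_snd,
      (integral_map measurable_snd.aemeasurable hf.1).symm⟩
  obtain ⟨i1, j1⟩ := hfst _ (hint μ hμ)
  obtain ⟨i2, j2⟩ := hsnd _ (hint ν hν)
  obtain ⟨i3, j3⟩ := hfst _ hμ
  obtain ⟨i4, j4⟩ := hsnd _ hν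
  have hbound : Integrable (fun z : ℝ × ℝ => C * ((|z.1 - z.2| ^ 2 + W2 μ ν ^ 2) / lam +
      lam * (1 + |z.1| ^ (2 * q) + |z.2| ^ (2 * q) + Mμ + Mν))) m := by fun_prop
  calc |∫ x, g x μ ∂μ.toMeasure - ∫ x, g x ν ∂ν.toMeasure|
      = |∫ z, (g z.1 μ - g z.2 ν) ∂m| := by rw [integral_sub i1 i2, j1, j2]
    _ ≤ ∫ z, |g z.1 μ - g z.2 ν| ∂m := abs_integral_le_integral_abs
    _ ≤ ∫ z, C * ((|z.1 - z.2| ^ 2 + W2 μ ν ^ 2) / lam +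
          lam * (1 + |z.1| ^ (2 * q) + |z.2| ^ (2 * q) + Mμ + Mν)) ∂m :=
        integral_mono (i1.sub i2).abs hbound fun z => h μ ν hμ hν lam hlam z.1 z.2
    _ = C * ((∫ z, |z.1 - z.2| ^ 2 ∂m + W2 μ ν ^ 2) / lam + lam * (1 + Mμ + Mν + Mμ + Mν)) := by
        rw [integral_const_mul, integral_add (by fun_prop) (by fun_prop), integral_div,
          integral_add hsq (by fun_prop), integral_const_mul, integral_add (by fun_prop)
          (by fun_prop), integral_add (by fun_prop) (by fun_prop), integral_add (by fun_prop) i4,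
          integral_add (by fun_prop) i3, j3, j4]
        simp [Mμ, Mν]
    _ ≤ C * ((W2 μ ν ^ 2 + ε * lam / (C + 1) + W2 μ ν ^ 2) / lam +
          lam * (1 + Mμ + Mν + Mμ + Mν)) := by gcongr
    _ = C * (2 * (W2 μ ν ^ 2 / lam) + lam * (1 + 2 * Mμ + 2 * Mν)) + C / (C + 1) * ε := by
        field_simp; ring
    _ ≤ 4 * C * (W2 μ ν ^ 2 / lam + lam * (1 + Mμ + Mν)) + 1 * ε := by
        have h1 : 0 ≤ C * (W2 μ ν ^ 2 / lam) := by positivity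
        have h2 : 0 ≤ C * lam := by positivity
        have h3 : C / (C + 1) ≤ 1 := by rw [div_le_one (by positivity)]; linarith
        have h4 : 0 ≤ C * lam * Mμ := by positivity
        have h5 : 0 ≤ C * lam * Mν := by positivity
        gcongr ?_ + ?_ * _
        · nlinarith
    _ = _ := by ring

/-! ### Transport between measures on finitely many points -/

section Discrete

variable {ι : Type*} [Fintype ι]

/-- A transport plan between two weight families of the same finite mass that leaves the common
mass in place. -/
lemma exists_transportPlan (p q : ι → ENNReal) (hp : ∑ j, p j ≠ ⊤) (hpq : ∑ j, p j = ∑ j, q j) :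
    ∃ W : ι → ι → ENNReal, (∀ j, ∑ k, W j k = p j) ∧ (∀ k, ∑ j, W j k = q k) ∧
      ∀ f : ι → ENNReal, ∀ c : ι → ι → ENNReal, (∀ j, c j j = 0) → (∀ j k, c j k ≤ f j + f k) →
        ∑ j, ∑ k, W j k * c j k ≤ ∑ j, f j * ((p j - q j) + (q j - p j)) := by
  classical
  set D := ∑ j, (p j - q j) with hD
  have hmin : ∀ j, min (p j) (q j) + (p j - q j) = p j := fun j => by
    rcases le_total (p j) (q j) with h | h
    · simp [h, tsub_eq_zero_of_le h]
    · simp [h]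
  have hmin' : ∀ j, min (p j) (q j) + (q j - p j) = q j := fun j => by
    rcases le_total (p j) (q j) with h | h
    · simp [h]
    · simp [h, tsub_eq_zero_of_le h]
  have hD' : ∑ j, (q j - p j) = D := by
    have h1 : ∑ j, min (p j) (q j) + ∑ j, (q j - p j) = ∑ j, min (p j) (q j) + D := by
      rw [hD, ← Finset.sum_add_distrib, ← Finset.sum_add_distrib]
      simp_rw [hmin, hmin', hpq]
    refine (ENNReal.add_right_inj (ne_top_of_le_ne_top hp ?_)).1 h1
    exact Finset.sum_le_sum fun j _ => min_le_left _ _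
  have hDtop : D ≠ ⊤ := ne_top_of_le_ne_top hp (Finset.sum_le_sum fun j _ => tsub_le_self)
  -- If `D = 0` then `x = 0` as well, so the division is harmless when there is nothing to move.
  have hdiv : ∀ x, x ≤ D → x * D / D = x := by
    intro x hx
    rcases eq_or_ne D 0 with h | h
    · rw [h, nonpos_iff_eq_zero] at hx; simp [hx]
    · exact ENNReal.mul_div_cancel_right h hDtop
  have hP : ∀ j, p j - q j ≤ D := fun j =>
    Finset.single_le_sum (f := fun j => p j - q j) (fun _ _ => zero_le) (Finset.mem_univ j)
  have hQ : ∀ j, q j - p j ≤ D := fun j => by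
    rw [← hD']
    exact Finset.single_le_sum (f := fun j => q j - p j) (fun _ _ => zero_le) (Finset.mem_univ j)
  -- The common mass `min (p j) (q j)` stays at `j`; the surplus of `p` is spread over the deficits
  -- in proportion to their size. Only the moved mass pays, and its cost splits as `f j + f k`.
  refine ⟨fun j k => (if j = k then min (p j) (q j) else 0) + (p j - q j) * (q k - p k) / D,
    fun j => ?_, fun k => ?_, fun f c hc hcf => ?_⟩
  · simp_rw [Finset.sum_add_distrib, div_eq_mul_inv, ← Finset.sum_mul, ← Finset.mul_sum, hD',
      ← div_eq_mul_inv, hdiv _ (hP j)]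
    simp [hmin]
  · simp_rw [Finset.sum_add_distrib, div_eq_mul_inv, ← Finset.sum_mul, ← hD,
      mul_comm D, ← div_eq_mul_inv, hdiv _ (hQ k)]
    simp [hmin']
  · have h1 : ∀ j k, ((if j = k then min (p j) (q j) else 0) + (p j - q j) * (q k - p k) / D) * c j k
        ≤ f j * ((p j - q j) * (q k - p k) / D) + f k * ((p j - q j) * (q k - p k) / D) := by
      intro j k
      have h2 : (if j = k then min (p j) (q j) else 0) * c j k = 0 := by
        split_ifs with h
        · subst h; simp [hc]
        · simp
      rw [add_mul, h2, zero_add, ← add_mul, mul_comm]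
      gcongr
      exact hcf j k
    refine (Finset.sum_le_sum fun j _ => Finset.sum_le_sum fun k _ => h1 j k).trans_eq ?_
    simp_rw [Finset.sum_add_distrib, mul_add]
    rw [Finset.sum_add_distrib]
    congr 1
    · refine Finset.sum_congr rfl fun j _ => ?_
      rw [← Finset.mul_sum]
      simp_rw [div_eq_mul_inv, ← Finset.sum_mul, ← Finset.mul_sum, hD', ← div_eq_mul_inv,
        hdiv _ (hP j)]
    · rw [Finset.sum_comm]
      refine Finset.sum_congr rfl fun k _ => ?_
      rw [← Finset.mul_sum]
      simp_rw [div_eq_mul_inv, ← Finset.sum_mul, ← hD,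
        mul_comm D, ← div_eq_mul_inv, hdiv _ (hQ k)]

variable [MeasurableSpace ι] [MeasurableSingletonClass ι]

lemma map_eq_sum_dirac (p : Measure ι) (a : ι → ℝ) :
    p.map a = ∑ j, p {j} • Measure.dirac (a j) := by
  conv_lhs => rw [← Measure.sum_smul_dirac p]
  rw [Measure.map_sum (by fun_prop), Measure.sum_fintype]
  refine Finset.sum_congr rfl fun j _ => ?_
  rw [Measure.map_smul, Measure.map_dirac' (by fun_prop)]

/-- The Wasserstein distance of two measures carried by the same finitely many points. -/
lemma W2_sq_le_of_finite (p q : Measure ι) [IsProbabilityMeasure p] [IsProbabilityMeasure q]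
    (a : ι → ℝ) {μ ν : P2} (hμ : p.map a = μ.toMeasure) (hν : q.map a = ν.toMeasure) :
    W2 μ ν ^ 2 ≤ ∑ j, 2 * a j ^ 2 * |p.real {j} - q.real {j}| := by
  have hsum : ∀ p : Measure ι, ∀ [IsProbabilityMeasure p], ∑ j, p {j} = 1 := fun p _ => by
    rw [sum_measure_singleton]; simp
  obtain ⟨W, h1, h2, h3⟩ := exists_transportPlan (fun j => p {j}) (fun j => q {j})
    (by rw [hsum p]; simp) (by rw [hsum p, hsum q])
  have hm : (∑ j, ∑ k, W j k • Measure.dirac (a j, a k) : Measure (ℝ × ℝ)) ∈ couplings μ ν := by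
    constructor
    · rw [← hμ, map_eq_sum_dirac _ a, Measure.map_finset_sum (Measurable.aemeasurable (by fun_prop))]
      refine Finset.sum_congr rfl fun j _ => ?_
      rw [Measure.map_finset_sum (Measurable.aemeasurable (by fun_prop)), ← h1 j, Finset.sum_smul]
      refine Finset.sum_congr rfl fun k _ => ?_
      rw [Measure.map_smul, Measure.map_dirac' measurable_fst]
    · rw [← hν, map_eq_sum_dirac _ a, Finset.sum_comm, Measure.map_finset_sum (Measurable.aemeasurable (by fun_prop))]
      refine Finset.sum_congr rfl fun k _ => ?_
      rw [Measure.map_finset_sum (Measurable.aemeasurable (by fun_prop)), ← h2 k, Finset.sum_smul]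
      refine Finset.sum_congr rfl fun j _ => ?_
      rw [Measure.map_smul, Measure.map_dirac' measurable_snd]
  have h := ofReal_W2_sq_le hm
  simp only [lintegral_finsetSum_measure, lintegral_smul_measure, lintegral_dirac, smul_eq_mul] at h
  -- The squared distance has the split form required of the cost, since $(a_j-a_k)^2\le
  -- 2a_j^2+2a_k^2$.
  replace h := h.trans (h3 (fun j => ENNReal.ofReal (2 * a j ^ 2)) _ (by simp) (fun j k => by
    rw [← ENNReal.ofReal_add (by positivity) (by positivity), sq_abs]
    exact ENNReal.ofReal_le_ofReal (by nlinarith [sq_nonneg (a j + a k)])))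
  have h4 : ∀ j, (p {j} - q {j}) + (q {j} - p {j}) =
      ENNReal.ofReal |p.real {j} - q.real {j}| := by
    intro j
    rw [← ENNReal.ofReal_toReal (measure_ne_top p {j}), ← ENNReal.ofReal_toReal (measure_ne_top q {j}),
      ← ENNReal.ofReal_sub _ (by positivity), ← ENNReal.ofReal_sub _ (by positivity)]
    change ENNReal.ofReal (p.real {j} - q.real {j}) + ENNReal.ofReal (q.real {j} - p.real {j}) = _
    rcases le_total (p.real {j}) (q.real {j}) with h | h
    · rw [ENNReal.ofReal_of_nonpos (sub_nonpos.2 h), abs_sub_comm, abs_of_nonneg (sub_nonneg.2 h),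
        zero_add]
    · rw [ENNReal.ofReal_of_nonpos (sub_nonpos.2 h), abs_of_nonneg (sub_nonneg.2 h), add_zero]
  simp_rw [h4, ← ENNReal.ofReal_mul (show (0:ℝ) ≤ 2 * a _ ^ 2 by positivity)] at h
  rw [← ENNReal.ofReal_sum_of_nonneg (fun i _ => by positivity)] at h
  exact (ENNReal.ofReal_le_ofReal_iff (Finset.sum_nonneg fun i _ => by positivity)).1 h

end Discrete

/-! ### A uniform law of large numbers in the Wasserstein distance -/

/-- The indices of the grid points `j / M` in `[-M, M]`. -/
abbrev GridIndex (M : ℕ) : Type := Finset.Icc (-(M ^ 2 : ℕ) : ℤ) (M ^ 2 : ℕ)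

/-- The index of the grid point to which an integer is sent; integers off the grid go to `0`. -/
def toGridIndex (M : ℕ) (z : ℤ) : GridIndex M :=
  if h : z ∈ Finset.Icc (-(M ^ 2 : ℕ) : ℤ) (M ^ 2 : ℕ) then ⟨z, h⟩ else ⟨0, by simp⟩

/-- The grid index of a real number. -/
def gridIndex (M : ℕ) (x : ℝ) : GridIndex M := toGridIndex M ⌊M * x⌋

/-- The grid point with a given index. -/
def gridPoint (M : ℕ) (j : GridIndex M) : ℝ := (j : ℤ) / M

lemma measurable_gridIndex (M : ℕ) : Measurable (gridIndex M) :=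
  (measurable_of_countable (toGridIndex M)).comp (by fun_prop)

lemma abs_gridPoint_le {M : ℕ} (hM : 0 < M) (j : GridIndex M) : |gridPoint M j| ≤ M := by
  have hM' : (0 : ℝ) < M := by exact_mod_cast hM
  obtain ⟨z, hz⟩ := j
  rw [Finset.mem_Icc, ← abs_le] at hz
  have h2 : |(z : ℝ)| ≤ (M : ℝ) ^ 2 := by exact_mod_cast hz
  rw [gridPoint, abs_div, Nat.abs_cast, div_le_iff₀ hM', ← sq]
  exact h2

/-- On the grid the rounding error is below $1/M$. Off the grid $|x|\ge M$ and $x$ is sent to $0$,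
so the error $x^2$ is at most $x^4/M^2$. This is where fourth moments enter. -/
lemma sq_sub_gridPoint_le {M : ℕ} (hM : 0 < M) (x : ℝ) :
    |x - gridPoint M (gridIndex M x)| ^ 2 ≤ (1 + x ^ 4) / M ^ 2 := by
  have hM' : (0 : ℝ) < M := by exact_mod_cast hM
  rw [le_div_iff₀ (by positivity), sq_abs, ← mul_pow]
  by_cases h : ⌊M * x⌋ ∈ Finset.Icc (-(M ^ 2 : ℕ) : ℤ) (M ^ 2 : ℕ)
  · have h1 : (x - gridPoint M (gridIndex M x)) * M = Int.fract (M * x) := by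
      rw [gridIndex, toGridIndex, dif_pos h, gridPoint, Int.fract]
      field_simp
    rw [h1]
    have h2 := Int.fract_nonneg (M * x)
    have h3 := Int.fract_lt_one (M * x)
    nlinarith [sq_nonneg (x ^ 2)]
  · have h1 : gridPoint M (gridIndex M x) = 0 := by
      rw [gridIndex, toGridIndex, dif_neg h, gridPoint]; simp
    rw [h1, sub_zero]
    have h2 : (M : ℝ) ^ 2 ≤ |M * x| := by
      by_contra! hlt
      rw [abs_lt] at hlt
      apply h
      rw [Finset.mem_Icc]
      constructor
      · rw [Int.le_floor]; push_cast; linarith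
      · exact Int.floor_le_iff.2 (by push_cast; linarith)
    rw [abs_mul, abs_of_pos hM', sq, mul_le_mul_iff_right₀ hM'] at h2
    have h3 : (M : ℝ) ^ 2 ≤ x ^ 2 := by rw [← sq_abs x]; gcongr
    nlinarith [sq_nonneg x]

lemma empirical_comp {n : ℕ} (y : Fin (n + 1) → ℝ) {r : ℝ → ℝ} (hr : Measurable r) :
    (empirical (r ∘ y)).toMeasure = (empirical y).toMeasure.map r := by
  rw [← empirical_eq_map, ← empirical_eq_map, Measure.map_map hr (by fun_prop)]

/-- The frequency with which the points `y` fall into the cell `j`. -/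
def cellFreq (M : ℕ) {n : ℕ} (j : GridIndex M) (y : Fin (n + 1) → ℝ) : ℝ :=
  (1 / ((n : ℝ) + 1)) * ∑ i, (gridIndex M ⁻¹' {j}).indicator 1 (y i)

/-- Both measures are rounded to the grid. The two rounding errors form the outer terms. The rounded
measures live on the same points of modulus at most $M$, so the discrete transport bound applies;
its factor $2M^2$ becomes $6M^2$ after squaring a three-term triangle inequality. -/
lemma W2_empirical_sq_le_grid {M : ℕ} (hM : 0 < M) {μ : P2}
    (hμ : Integrable (fun x : ℝ => x ^ 4) μ.toMeasure) {n : ℕ} (y : Fin (n + 1) → ℝ) :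
    W2 (empirical y) μ ^ 2 ≤ 3 * ((1 / ((n : ℝ) + 1)) * ∑ i, (1 + y i ^ 4) / M ^ 2) +
      6 * M ^ 2 * ∑ j : GridIndex M, |cellFreq M j y - μ.toMeasure.real (gridIndex M ⁻¹' {j})| +
      3 * ((1 + ∫ x, x ^ 4 ∂μ.toMeasure) / M ^ 2) := by
  set r : ℝ → ℝ := gridPoint M ∘ gridIndex M with hrdef
  have hπ := measurable_gridIndex M
  have ha : Measurable (gridPoint M) := measurable_of_countable _
  have hr : Measurable r := ha.comp hπ
  obtain ⟨ν, hν⟩ : ∃ ν : P2, ν.toMeasure = μ.toMeasure.map r := by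
    refine ⟨⟨μ.toMeasure.map r, Measure.isProbabilityMeasure_map hr.aemeasurable, ?_⟩, rfl⟩
    rw [integrable_map_measure (by fun_prop) hr.aemeasurable]
    refine Integrable.of_bound (C := (M : ℝ) ^ 2) (by fun_prop) (ae_of_all _ fun x => ?_)
    simp only [Function.comp_apply, Real.norm_eq_abs, abs_pow, r]
    gcongr
    exact abs_gridPoint_le hM _
  have h1 : W2 (empirical y) (empirical (r ∘ y)) ^ 2 ≤
      (1 / ((n : ℝ) + 1)) * ∑ i, (1 + y i ^ 4) / M ^ 2 := by
    refine (W2_empirical_sq_le _ _).trans ?_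
    gcongr with i
    exact sq_sub_gridPoint_le hM _
  have h3 : W2 ν μ ^ 2 ≤ (1 + ∫ x, x ^ 4 ∂μ.toMeasure) / M ^ 2 := by
    rw [W2_comm]
    have hi : Integrable (fun x : ℝ => (1 + x ^ 4) / M ^ 2) μ.toMeasure := by fun_prop
    have h := ofReal_W2_sq_le_of_law (P := μ.toMeasure) (X := id) (Y := r) (by fun_prop)
      (by fun_prop) (by simp) hν.symm (μ := μ)
    replace h := h.trans (lintegral_mono fun x =>
      ENNReal.ofReal_le_ofReal (sq_sub_gridPoint_le hM x))
    rw [← ofReal_integral_eq_lintegral_ofReal hi (ae_of_all _ fun x => by positivity),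
      integral_div, integral_add (by fun_prop) hμ] at h
    have h0 : 0 ≤ ∫ x, x ^ 4 ∂μ.toMeasure := integral_nonneg fun x => by positivity
    rw [ENNReal.ofReal_le_ofReal_iff (by simp; positivity)] at h
    simpa using h
  have h2 : W2 (empirical (r ∘ y)) ν ^ 2 ≤ 2 * M ^ 2 *
      ∑ j : GridIndex M, |cellFreq M j y - μ.toMeasure.real (gridIndex M ⁻¹' {j})| := by
    have := Measure.isProbabilityMeasure_map (μ := (empirical y).toMeasure) hπ.aemeasurable
    have := Measure.isProbabilityMeasure_map (μ := μ.toMeasure) hπ.aemeasurable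
    have h := W2_sq_le_of_finite ((empirical y).toMeasure.map (gridIndex M))
      (μ.toMeasure.map (gridIndex M)) (gridPoint M) (μ := empirical (r ∘ y)) (ν := ν)
      (by rw [empirical_comp y hr, Measure.map_map ha hπ])
      (by rw [hν, Measure.map_map ha hπ])
    refine h.trans ?_
    rw [Finset.mul_sum]
    refine Finset.sum_le_sum fun j _ => ?_
    have hfreq : (empirical y).toMeasure.real (gridIndex M ⁻¹' {j}) = cellFreq M j y := by
      rw [← integral_indicator_one (hπ (measurableSet_singleton j)), integral_empirical]
      rfl
    have hj : gridPoint M j ^ 2 ≤ (M : ℝ) ^ 2 := by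
      rw [← sq_abs]
      gcongr
      exact abs_gridPoint_le hM _
    rw [map_measureReal_apply hπ (measurableSet_singleton j),
      map_measureReal_apply hπ (measurableSet_singleton j), hfreq]
    exact mul_le_mul_of_nonneg_right (by linarith) (abs_nonneg _)
  have ht := W2_triangle (empirical y) (empirical (r ∘ y)) μ
  have ht2 := W2_triangle (empirical (r ∘ y)) ν μ
  have e0 := W2_nonneg (empirical y) μ
  set A := W2 (empirical y) (empirical (r ∘ y))
  set B := W2 (empirical (r ∘ y)) ν
  set D := W2 ν μ
  have h4 : W2 (empirical y) μ ^ 2 ≤ (A + B + D) ^ 2 := by gcongr; linarith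
  have h5 : (A + B + D) ^ 2 ≤ 3 * A ^ 2 + 3 * B ^ 2 + 3 * D ^ 2 := by
    nlinarith [sq_nonneg (A - B), sq_nonneg (A - D), sq_nonneg (B - D)]
  linarith

lemma memLp_indicator_cell (M : ℕ) (j : GridIndex M) (μ : P2) :
    MemLp ((gridIndex M ⁻¹' {j}).indicator (1 : ℝ → ℝ)) 2 μ.toMeasure :=
  (memLp_const (1 : ℝ)).indicator (measurable_gridIndex M (measurableSet_singleton j))

/-- A sum of $N$ independent indicators has variance at most $N$, so its mean deviates by at most
$1/\sqrt N$ in $L^2$, hence in $L^1$. -/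
lemma integral_abs_cellFreq_sub_le (M : ℕ) (j : GridIndex M) (μ : P2) (n : ℕ) :
    Integrable (fun y : Fin (n + 1) → ℝ => |cellFreq M j y -
      μ.toMeasure.real (gridIndex M ⁻¹' {j})|) (Measure.pi fun _ => μ.toMeasure) ∧
    ∫ y : Fin (n + 1) → ℝ, |cellFreq M j y - μ.toMeasure.real (gridIndex M ⁻¹' {j})|
      ∂(Measure.pi fun _ => μ.toMeasure) ≤ 1 / √((n : ℝ) + 1) := by
  set f : ℝ → ℝ := (gridIndex M ⁻¹' {j}).indicator 1
  set p := μ.toMeasure.real (gridIndex M ⁻¹' {j})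
  set Q : Measure (Fin (n + 1) → ℝ) := Measure.pi fun _ => μ.toMeasure
  have hf : MemLp f 2 μ.toMeasure := memLp_indicator_cell M j μ
  have hfp : ∫ x, f x ∂μ.toMeasure = p :=
    integral_indicator_one (measurable_gridIndex M (measurableSet_singleton j))
  have hN : (0 : ℝ) < (n : ℝ) + 1 := by positivity
  have hmp : ∀ i, MemLp (fun y : Fin (n + 1) → ℝ => f (y i)) 2 Q := fun i =>
    hf.comp_measurePreserving (measurePreserving_eval (fun _ => μ.toMeasure) i)
  have hS : MemLp (∑ i, fun y : Fin (n + 1) → ℝ => f (y i)) 2 Q :=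
    memLp_finsetSum' _ fun i _ => hmp i
  have hES : ∫ y, (∑ i, fun y : Fin (n + 1) → ℝ => f (y i)) y ∂Q = (n + 1) * p := by
    simp_rw [Finset.sum_apply]
    rw [integral_finsetSum _ fun i _ => (hmp i).integrable (by norm_num)]
    have : ∀ i : Fin (n + 1), ∫ y, f (y i) ∂Q = p := fun i => by
      rw [← hfp]
      exact integral_comp_eval (μ := fun _ => μ.toMeasure) hf.1
    simp [this]
  have hvar : variance (∑ i, fun y : Fin (n + 1) → ℝ => f (y i)) Q ≤ n + 1 := by
    rw [variance_sum_pi (fun _ => hf)]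
    have : variance f μ.toMeasure ≤ 1 := by
      refine (variance_le_expectation_sq hf.1).trans ?_
      have : ∫ x, (f ^ 2) x ∂μ.toMeasure ≤ ∫ _x, (1 : ℝ) ∂μ.toMeasure := by
        refine integral_mono hf.integrable_sq (integrable_const _) fun x => ?_
        by_cases hx : x ∈ gridIndex M ⁻¹' {j} <;> simp [f, hx]
      simpa using this
    calc _ ≤ ∑ _i : Fin (n + 1), (1 : ℝ) := Finset.sum_le_sum fun _ _ => this
      _ = _ := by simp
  rw [variance_eq_integral hS.1.aemeasurable, hES] at hvar
  have hcell : ∀ y : Fin (n + 1) → ℝ, cellFreq M j y - p =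
      ((∑ i, fun y : Fin (n + 1) → ℝ => f (y i)) y - (n + 1) * p) / (n + 1) := by
    intro y
    rw [Finset.sum_apply, cellFreq]
    field_simp
    rfl
  have hmem : MemLp (fun y : Fin (n + 1) → ℝ => cellFreq M j y - p) 2 Q := by
    simp_rw [hcell, div_eq_mul_inv]
    exact (hS.sub (memLp_const _)).mul_const _
  have hint : Integrable (fun y : Fin (n + 1) → ℝ => |cellFreq M j y - p|) Q :=
    (hmem.integrable (by norm_num)).abs
  refine ⟨hint, ?_⟩
  have hsq : ∫ y, (cellFreq M j y - p) ^ 2 ∂Q ≤ 1 / (n + 1) := by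
    simp_rw [hcell, div_pow]
    rw [integral_div, div_le_div_iff₀ (by positivity) hN]
    nlinarith
  have hs : 0 < √((n : ℝ) + 1) := Real.sqrt_pos.2 hN
  have hs2 : √((n : ℝ) + 1) ^ 2 = n + 1 := Real.sq_sqrt hN.le
  -- In place of Cauchy–Schwarz: $|u|\le \frac{1}{2\sqrt N}+\frac{\sqrt N}{2}u^2$ pointwise.
  calc ∫ y, |cellFreq M j y - p| ∂Q
      ≤ ∫ y, (1 / √((n : ℝ) + 1) / 2 + √((n : ℝ) + 1) / 2 * (cellFreq M j y - p) ^ 2) ∂Q := by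
        refine integral_mono hint ((integrable_const _).add (hmem.integrable_sq.const_mul _))
          fun y => ?_
        have h := sq_nonneg (√((n : ℝ) + 1) * |cellFreq M j y - p| - 1)
        rw [sub_sq, mul_pow, sq_abs] at h
        have h2 : 1 / √((n : ℝ) + 1) / 2 + √((n : ℝ) + 1) / 2 * (cellFreq M j y - p) ^ 2 -
          |cellFreq M j y - p| = (√((n : ℝ) + 1) ^ 2 * (cellFreq M j y - p) ^ 2 -
            2 * (√((n : ℝ) + 1) * |cellFreq M j y - p|) * 1 + 1 ^ 2) / (2 * √((n : ℝ) + 1)) := by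
          field_simp
          ring
        have : 0 ≤ (√((n : ℝ) + 1) ^ 2 * (cellFreq M j y - p) ^ 2 -
            2 * (√((n : ℝ) + 1) * |cellFreq M j y - p|) * 1 + 1 ^ 2) / (2 * √((n : ℝ) + 1)) := by
          positivity
        simp only
        linarith
    _ = 1 / √((n : ℝ) + 1) / 2 + √((n : ℝ) + 1) / 2 * ∫ y, (cellFreq M j y - p) ^ 2 ∂Q := by
        rw [integral_add (integrable_const _) (hmem.integrable_sq.const_mul _), integral_const_mul]
        simp
    _ ≤ 1 / √((n : ℝ) + 1) / 2 + √((n : ℝ) + 1) / 2 * (1 / (n + 1)) := by gcongr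
    _ = 1 / √((n : ℝ) + 1) := by
        have h1 : 1 / ((n : ℝ) + 1) = 1 / √((n : ℝ) + 1) ^ 2 := by rw [hs2]
        rw [h1]
        field_simp
        ring

/-- The bound sees `μ` only through `K`, which gives the uniformity needed to integrate over time.
-/
lemma lintegral_W2_empirical_le {M : ℕ} (hM : 0 < M) {K : ℝ} {μ : P2}
    (hμ : Integrable (fun x : ℝ => x ^ 4) μ.toMeasure) (hK : ∫ x, x ^ 4 ∂μ.toMeasure ≤ K) (n : ℕ) :
    ∫⁻ y : Fin (n + 1) → ℝ, ENNReal.ofReal (W2 (empirical y) μ ^ 2)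
      ∂(Measure.pi fun _ => μ.toMeasure) ≤
    ENNReal.ofReal (6 * ((1 + K) / M ^ 2) +
      6 * M ^ 2 * Fintype.card (GridIndex M) * (1 / √((n : ℝ) + 1))) := by
  set Q : Measure (Fin (n + 1) → ℝ) := Measure.pi fun _ => μ.toMeasure
  have hcell := fun j => integral_abs_cellFreq_sub_le M j μ n
  have hf : Integrable (fun x : ℝ => (1 + x ^ 4) / M ^ 2) μ.toMeasure := by fun_prop
  have hi : ∀ i, Integrable (fun y : Fin (n + 1) → ℝ => (1 + y i ^ 4) / M ^ 2) Q := fun i =>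
    (measurePreserving_eval (fun _ => μ.toMeasure) i).integrable_comp_of_integrable hf
  have hE : ∀ i, ∫ y : Fin (n + 1) → ℝ, (1 + y i ^ 4) / M ^ 2 ∂Q ≤ (1 + K) / M ^ 2 := fun i => by
    rw [integral_comp_eval (μ := fun _ : Fin (n + 1) => μ.toMeasure) (i := i)
      (f := fun x : ℝ => (1 + x ^ 4) / (M : ℝ) ^ 2) hf.1, integral_div,
      integral_add (by fun_prop) hμ]
    simp only [integral_const, probReal_univ, smul_eq_mul, mul_one]
    gcongr
  have hi1 : Integrable (fun y : Fin (n + 1) → ℝ =>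
      3 * ((1 / ((n : ℝ) + 1)) * ∑ i, (1 + y i ^ 4) / M ^ 2)) Q :=
    ((integrable_finsetSum _ fun i _ => hi i).const_mul _).const_mul _
  have hi2 : Integrable (fun y : Fin (n + 1) → ℝ => 6 * (M : ℝ) ^ 2 * ∑ j : GridIndex M,
      |cellFreq M j y - μ.toMeasure.real (gridIndex M ⁻¹' {j})|) Q :=
    (integrable_finsetSum _ fun j _ => (hcell j).1).const_mul _
  refine (lintegral_mono fun y =>
    ENNReal.ofReal_le_ofReal (W2_empirical_sq_le_grid hM hμ y)).trans ?_
  have hμ0 : 0 ≤ ∫ x, x ^ 4 ∂μ.toMeasure := integral_nonneg fun x => by positivity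
  have hi12 := hi1.fun_add hi2
  have hi3 := hi12.fun_add (integrable_const (3 * ((1 + ∫ x, x ^ 4 ∂μ.toMeasure) / (M : ℝ) ^ 2)))
  rw [← ofReal_integral_eq_lintegral_ofReal hi3
    (ae_of_all _ fun y => by positivity)]
  refine ENNReal.ofReal_le_ofReal ?_
  rw [integral_add hi12 (integrable_const _), integral_add hi1 hi2, integral_const_mul,
    integral_const_mul, integral_const_mul, integral_finsetSum _ fun i _ => hi i,
    integral_finsetSum _ fun j _ => (hcell j).1]
  have e1 : (1 / ((n : ℝ) + 1)) * ∑ i, ∫ y : Fin (n + 1) → ℝ, (1 + y i ^ 4) / M ^ 2 ∂Q ≤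
      (1 + K) / M ^ 2 := by
    calc _ ≤ (1 / ((n : ℝ) + 1)) * ∑ _i : Fin (n + 1), (1 + K) / M ^ 2 := by
          gcongr with i; exact hE i
      _ = _ := by simp; field_simp
  have e2 : ∑ j : GridIndex M, ∫ y : Fin (n + 1) → ℝ,
      |cellFreq M j y - μ.toMeasure.real (gridIndex M ⁻¹' {j})| ∂Q ≤
      Fintype.card (GridIndex M) * (1 / √((n : ℝ) + 1)) := by
    refine (Finset.sum_le_sum fun j _ => (hcell j).2).trans_eq ?_
    simp
  have e3 : (1 + ∫ x, x ^ 4 ∂μ.toMeasure) / (M : ℝ) ^ 2 ≤ (1 + K) / M ^ 2 := by gcongr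
  have e4 : 6 * (M : ℝ) ^ 2 * ∑ j : GridIndex M, ∫ y : Fin (n + 1) → ℝ,
      |cellFreq M j y - μ.toMeasure.real (gridIndex M ⁻¹' {j})| ∂Q ≤
      6 * M ^ 2 * (Fintype.card (GridIndex M) * (1 / √((n : ℝ) + 1))) := by gcongr
  simp only [integral_const, probReal_univ, smul_eq_mul, one_mul]
  linarith

/-- The empirical measures of independent samples converge in mean to the common law, uniformly
over the laws with a bounded fourth moment. -/
lemma eventually_lintegral_W2_empirical_le (K : ℝ) {ε : ℝ} (hε : 0 < ε) :
    ∀ᶠ n : ℕ in atTop, ∀ μ : P2, Integrable (fun x : ℝ => x ^ 4) μ.toMeasure →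
      ∫ x, x ^ 4 ∂μ.toMeasure ≤ K →
      ∫⁻ y : Fin (n + 1) → ℝ, ENNReal.ofReal (W2 (empirical y) μ ^ 2)
        ∂(Measure.pi fun _ => μ.toMeasure) ≤ ENNReal.ofReal ε := by
  -- The mesh is chosen first, since the rounding error does not depend on `n`; then `n` grows with
  -- `M` fixed.
  have h1 : Tendsto (fun M : ℕ => 6 * ((1 + K) / (M : ℝ) ^ 2)) atTop (𝓝 (6 * 0)) :=
    (tendsto_const_nhds.div_atTop
      ((tendsto_pow_atTop two_ne_zero).comp tendsto_natCast_atTop_atTop)).const_mul 6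
  rw [mul_zero] at h1
  obtain ⟨M, hM, hM0⟩ := ((h1.eventually_lt_const (half_pos hε)).and
    (eventually_gt_atTop 0)).exists
  have h2 : Tendsto (fun n : ℕ => 6 * (M : ℝ) ^ 2 * Fintype.card (GridIndex M) *
      (1 / √((n : ℝ) + 1))) atTop (𝓝 (6 * (M : ℝ) ^ 2 * Fintype.card (GridIndex M) * 0)) := by
    refine Tendsto.const_mul _ (tendsto_const_nhds.div_atTop (Real.tendsto_sqrt_atTop.comp ?_))
    exact tendsto_atTop_add_const_right _ _ tendsto_natCast_atTop_atTop
  rw [mul_zero] at h2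
  filter_upwards [h2.eventually_lt_const (half_pos hε)] with n hn μ hμ hK
  refine (lintegral_W2_empirical_le hM0 hμ hK n).trans (ENNReal.ofReal_le_ofReal ?_)
  linarith

/-! ### Deterministic equations: Grönwall, existence, Euler schemes -/

/-- Grönwall's inequality in integral form, with a continuous inhomogeneity. -/
lemma gronwall_integral {T L : ℝ} (hL : 0 ≤ L) {φ a : ℝ → ℝ} (hφ : Continuous φ)
    (ha : Continuous a) (ha0 : ∀ t, 0 ≤ a t)
    (h : ∀ t ∈ Icc 0 T, φ t ≤ a t + L * ∫ s in (0 : ℝ)..t, φ s) {t : ℝ} (ht : t ∈ Icc 0 T) :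
    φ t ≤ a t + L * Real.exp (L * T) * ∫ s in (0 : ℝ)..T, a s := by
  have hI : ∀ t, HasDerivAt (fun t => ∫ s in (0 : ℝ)..t, φ s) (φ t) t := fun t =>
    (hφ.integral_hasStrictDerivAt 0 t).hasDerivAt
  have hA : ∀ t, HasDerivAt (fun t => ∫ s in (0 : ℝ)..t, a s) (a t) t := fun t =>
    (ha.integral_hasStrictDerivAt 0 t).hasDerivAt
  have hE : ∀ t, HasDerivAt (fun t => Real.exp (-(L * t))) (Real.exp (-(L * t)) * (-L)) t :=
    fun t => by simpa using (((hasDerivAt_id t).const_mul L).neg).exp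
  have hD := fun t => (hA t).sub ((hE t).mul (hI t))
  -- The derivative is $a-e^{-Lt}\big(\varphi-L\int_0^t\varphi\big)\ge a\,(1-e^{-Lt})\ge0$.
  have hmono : MonotoneOn ((fun t => ∫ s in (0 : ℝ)..t, a s) -
      (fun t => Real.exp (-(L * t))) * fun t => ∫ s in (0 : ℝ)..t, φ s) (Icc 0 T) := by
    refine monotoneOn_of_deriv_nonneg (convex_Icc 0 T)
      (fun t _ => (hD t).continuousAt.continuousWithinAt)
      (fun t _ => (hD t).differentiableAt.differentiableWithinAt) fun t ht => ?_
    rw [interior_Icc] at ht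
    rw [(hD t).deriv]
    have h1 := h t (Ioo_subset_Icc_self ht)
    have h2 : Real.exp (-(L * t)) ≤ 1 := Real.exp_le_one_iff.2 (by nlinarith [ht.1])
    have h3 := Real.exp_pos (-(L * t))
    have h4 := ha0 t
    nlinarith
  have h0 : 0 ≤ (∫ s in (0 : ℝ)..t, a s) - Real.exp (-(L * t)) * ∫ s in (0 : ℝ)..t, φ s := by
    simpa using hmono (left_mem_Icc.2 (ht.1.trans ht.2)) ht ht.1
  have hle : ∫ s in (0 : ℝ)..t, φ s ≤ Real.exp (L * t) * ∫ s in (0 : ℝ)..t, a s := by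
    rw [Real.exp_neg] at h0
    have := Real.exp_pos (L * t)
    rwa [sub_nonneg, inv_mul_le_iff₀ this] at h0
  have hAmono : ∫ s in (0 : ℝ)..t, a s ≤ ∫ s in (0 : ℝ)..T, a s :=
    intervalIntegral.integral_mono_interval le_rfl ht.1 ht.2 (ae_of_all _ ha0)
      (ha.intervalIntegrable _ _)
  have hA0 : 0 ≤ ∫ s in (0 : ℝ)..t, a s :=
    intervalIntegral.integral_nonneg ht.1 fun s _ => ha0 s
  have hexp : Real.exp (L * t) ≤ Real.exp (L * T) := by gcongr; exact ht.2
  calc φ t ≤ a t + L * ∫ s in (0 : ℝ)..t, φ s := h t ht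
    _ ≤ a t + L * (Real.exp (L * T) * ∫ s in (0 : ℝ)..T, a s) := by
        gcongr
        exact hle.trans (by gcongr)
    _ = _ := by ring

/-- Global existence for a Lipschitz equation driven by an additive continuous path. -/
lemma exists_solution {T L : ℝ} (hT : 0 < T) (hL : 0 ≤ L) {f : ℝ → ℝ → ℝ}
    (hf : Continuous fun z : ℝ × ℝ => f z.1 z.2)
    (hLip : ∀ t x y, |f t x - f t y| ≤ L * |x - y|) (x₀ : ℝ) {w : ℝ → ℝ} (hw : Continuous w) :
    ∃ z : ℝ → ℝ, Continuous z ∧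
      ∀ t ∈ Icc 0 T, z t = x₀ + (∫ s in (0 : ℝ)..t, f s (z s)) + w t := by
  obtain ⟨C, hC⟩ := (isCompact_Icc (a := (0 : ℝ)) (b := T)).exists_bound_of_continuousOn
    (f := fun t => f t (w t)) (hf.comp (by fun_prop : Continuous fun t => (t, w t))).continuousOn
  have hC0 : 0 ≤ C := (norm_nonneg _).trans (hC 0 (left_mem_Icc.2 hT.le))
  -- The unknown is shifted by `w` to obtain an ordinary differential equation, whose state is then
  -- clipped to `[-R, R]`. The clipped field is bounded, so Picard–Lindelöf reaches all of `[0, T]`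
  -- at once; as `R` is an a priori bound, the clipping is never active.
  set R := gronwallBound |x₀| L C T
  have hR : 0 ≤ R := by
    have := gronwallBound_mono (abs_nonneg x₀) hC0 hL hT.le
    rw [gronwallBound_x0] at this
    exact (abs_nonneg _).trans this
  set cl : ℝ → ℝ := fun u => max (min u R) (-R)
  have hcl : ∀ u v, |cl u - cl v| ≤ |u - v| := fun u v =>
    (abs_max_sub_max_le_abs _ _ _).trans (abs_inf_sub_inf_le_abs u v R)
  have hclR : ∀ u, |cl u| ≤ R := fun u => abs_le.2
    ⟨le_max_right _ _, max_le (min_le_right _ _) (by linarith)⟩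
  have hclu : ∀ u, |cl u| ≤ |u| := fun u => by simpa [cl, hR] using hcl u 0
  have hcl_eq : ∀ u, |u| ≤ R → cl u = u := fun u hu => by
    rw [abs_le] at hu
    simp [cl, hu.1, hu.2]
  have hclc : Continuous cl := by fun_prop
  set F : ℝ → ℝ → ℝ := fun t u => f t (cl u + w t)
  have hFC : ∀ t ∈ Icc 0 T, ∀ u, |F t u| ≤ C + L * |cl u| := fun t ht u => by
    have h1 := hLip t (cl u + w t) (w t)
    have h2 := hC t ht
    rw [add_sub_cancel_right] at h1
    rw [Real.norm_eq_abs] at h2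
    have h3 := abs_sub_abs_le_abs_sub (f t (cl u + w t)) (f t (w t))
    change |f t (cl u + w t)| ≤ _
    linarith
  have hM : 0 ≤ C + L * R := by positivity
  have hPL : IsPicardLindelof F (tmin := 0) (tmax := T) ⟨0, left_mem_Icc.2 hT.le⟩ x₀
      ⟨(C + L * R) * T, by positivity⟩ 0 ⟨C + L * R, hM⟩ ⟨L, hL⟩ := by
    refine ⟨fun t _ => LipschitzOnWith.of_dist_le_mul fun u _ v _ => ?_, fun u _ => ?_,
      fun t ht u _ => ?_, ?_⟩
    · rw [Real.dist_eq, Real.dist_eq]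
      refine (hLip t _ _).trans ?_
      change L * _ ≤ L * _
      refine mul_le_mul_of_nonneg_left ?_ hL
      rw [add_sub_add_right_eq_sub]
      exact hcl u v
    · exact (hf.comp (by fun_prop : Continuous fun t => (t, cl u + w t))).continuousOn
    · refine (hFC t ht u).trans ?_
      change _ ≤ C + L * R
      gcongr
      exact hclR u
    · change (C + L * R) * max (T - 0) (0 - 0) ≤ (C + L * R) * T - 0
      simp [hT.le]
  obtain ⟨α, hα0, hα⟩ := hPL.exists_eq_forall_mem_Icc_hasDerivWithinAt₀
  change α 0 = x₀ at hα0
  have hαc : ContinuousOn α (Icc 0 T) := fun t ht => (hα t ht).continuousWithinAt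
  have hbound : ∀ t ∈ Icc 0 T, |α t| ≤ R := by
    intro t ht
    have h1 := norm_le_gronwallBound_of_norm_deriv_right_le (f := α) (f' := fun t => F t (α t))
      (δ := |x₀|) (K := L) (ε := C) hαc (fun s hs => (hα s (Ico_subset_Icc_self hs)).mono_of_mem_nhdsWithin
        (Icc_mem_nhdsGE_of_mem hs)) (by rw [hα0]; rfl) (fun s hs => by
        have h1 := hFC s (Ico_subset_Icc_self hs) (α s)
        have h2 := mul_le_mul_of_nonneg_left (hclu (α s)) hL
        rw [Real.norm_eq_abs, Real.norm_eq_abs]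
        linarith) t ht
    rw [sub_zero] at h1
    exact h1.trans (gronwallBound_mono (abs_nonneg x₀) hC0 hL ht.2)
  set z : ℝ → ℝ := IccExtend hT.le ((Icc 0 T).domRestrict (fun t => α t + w t))
  have hz : ∀ t ∈ Icc 0 T, z t = α t + w t := fun t ht => by
    simp [z, IccExtend_of_mem hT.le _ ht]
  have hzc : Continuous z :=
    (continuousOn_iff_continuous_domRestrict.1 (hαc.add hw.continuousOn)).Icc_extend'
  refine ⟨z, hzc, fun t ht => ?_⟩
  have hsub : Icc 0 t ⊆ Icc 0 T := Icc_subset_Icc_right ht.2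
  have hFz : ∀ s ∈ Icc 0 t, f s (z s) = F s (α s) := fun s hs => by
    rw [hz s (hsub hs)]
    simp only [F, hcl_eq _ (hbound s (hsub hs))]
  have hfz : Continuous fun s => f s (z s) := hf.comp (by fun_prop : Continuous fun s => (s, z s))
  have hint := intervalIntegral.integral_eq_sub_of_hasDerivAt_of_le ht.1 (hαc.mono hsub)
    (f' := fun s => f s (z s)) (fun s hs => by
      rw [hFz s (Ioo_subset_Icc_self hs)]
      exact (hα s (hsub (Ioo_subset_Icc_self hs))).hasDerivAt
        (Icc_mem_nhds hs.1 (hs.2.trans_le ht.2))) (hfz.intervalIntegrable _ _)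
  rw [hint, hz t ht, hα0]
  ring

/-- The Euler scheme with step `h` for `dz = f(t, z) dt + dw`. -/
def euler (f : ℝ → ℝ → ℝ) (h x : ℝ) (w : ℝ → ℝ) : ℕ → ℝ
  | 0 => x + w 0
  | j + 1 => euler f h x w j + h * f (j * h) (euler f h x w j) + (w ((j + 1) * h) - w (j * h))

/-- The noise is additive and enters the scheme exactly, so a step of length `h` errs by at most `h`
times the oscillation of $u\mapsto f(u,z_u)$. The Lipschitz bound propagates these errors with an
exponential factor. The step `s / (m + 1)` makes `s` a grid point of every scheme. -/
lemma tendsto_euler {s L : ℝ} (hs : 0 ≤ s) (hL : 0 ≤ L) {f : ℝ → ℝ → ℝ}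
    (hf : Continuous fun z : ℝ × ℝ => f z.1 z.2)
    (hLip : ∀ t x y, |f t x - f t y| ≤ L * |x - y|) {x : ℝ} {w z : ℝ → ℝ} (hz : Continuous z)
    (heq : ∀ t ∈ Icc 0 s, z t = x + (∫ u in (0 : ℝ)..t, f u (z u)) + w t) :
    Tendsto (fun m : ℕ => euler f (s / (m + 1)) x w (m + 1)) atTop (𝓝 (z s)) := by
  have hfz : Continuous fun u => f u (z u) := hf.comp (by fun_prop : Continuous fun u => (u, z u))
  have key : ∀ ε > 0, ∀ᶠ m : ℕ in atTop,
      |z s - euler f (s / (m + 1)) x w (m + 1)| ≤ ε * (s * Real.exp (L * s)) := by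
    intro ε hε
    obtain ⟨δ, hδ, hmod⟩ := Metric.uniformContinuousOn_iff_le.1
      ((isCompact_Icc (a := (0 : ℝ)) (b := s)).uniformContinuousOn_of_continuous
        hfz.continuousOn) ε hε
    have hlim : Tendsto (fun m : ℕ => s / ((m : ℝ) + 1)) atTop (𝓝 0) :=
      tendsto_const_nhds.div_atTop
        (tendsto_atTop_add_const_right _ _ tendsto_natCast_atTop_atTop)
    filter_upwards [hlim.eventually_le_const hδ] with m hm
    set h := s / ((m : ℝ) + 1) with hh
    have hh0 : 0 ≤ h := by positivity
    have hmh : ((m : ℝ) + 1) * h = s := by rw [hh]; field_simp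
    have hgrid : ∀ j : ℕ, j ≤ m + 1 → (j : ℝ) * h ∈ Icc 0 s := fun j hj => by
      refine ⟨by positivity, ?_⟩
      rw [← hmh]
      gcongr
      exact_mod_cast hj
    have herr : ∀ j : ℕ, j ≤ m + 1 →
        |z (j * h) - euler f h x w j| ≤ j * h * ε * Real.exp (L * (j * h)) := by
      intro j
      induction j with
      | zero => 
        intro _
        have := heq 0 (left_mem_Icc.2 hs)
        simp [euler, this]
      | succ j ih =>
        intro hj
        have h0 := hgrid j (by omega)
        have h1 := hgrid (j + 1) hj
        have ih := ih (by omega)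
        push_cast at h1 ⊢
        set e := euler f h x w j
        have hstep : z ((j + 1) * h) - euler f h x w (j + 1) = (z (j * h) - e) +
            h * (f (j * h) (z (j * h)) - f (j * h) e) +
            ∫ u in (j * h)..((j + 1) * h), (f u (z u) - f (j * h) (z (j * h))) := by
          rw [intervalIntegral.integral_sub (hfz.intervalIntegrable _ _) (by simp),
            ← intervalIntegral.integral_interval_sub_left (hfz.intervalIntegrable 0 _)
            (hfz.intervalIntegrable 0 _), heq _ h1, euler]
          have := heq _ h0
          simp only [intervalIntegral.integral_const, smul_eq_mul]
          linear_combination -this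
        have hle : (j : ℝ) * h ≤ (j + 1) * h := by nlinarith
        have hI : |∫ u in (j * h)..((j + 1) * h), (f u (z u) - f (j * h) (z (j * h)))| ≤ ε * h := by
          have := intervalIntegral.norm_integral_le_of_norm_le_const (C := ε)
            (f := fun u => f u (z u) - f (j * h) (z (j * h))) (a := j * h) (b := (j + 1) * h) ?_
          · rw [abs_of_nonneg (by linarith)] at this
            rw [Real.norm_eq_abs] at this
            linarith
          · intro u hu
            rw [uIoc_of_le hle] at hu
            refine hmod u ⟨h0.1.trans hu.1.le, hu.2.trans h1.2⟩ _ h0 ?_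
            rw [Real.dist_eq, abs_of_nonneg (by linarith [hu.1])]
            linarith [hu.2]
        have hexp : 1 + L * h ≤ Real.exp (L * h) := by linarith [Real.add_one_le_exp (L * h)]
        have hexp1 : 1 ≤ Real.exp (L * ((j + 1) * h)) := Real.one_le_exp (by positivity)
        have hexpadd : Real.exp (L * ((j + 1) * h)) = Real.exp (L * h) * Real.exp (L * (j * h)) := by
          rw [← Real.exp_add]; ring_nf
        calc |z ((j + 1) * h) - euler f h x w (j + 1)|
            ≤ |z (j * h) - e| + h * (L * |z (j * h) - e|) + ε * h := by
              rw [hstep]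
              refine (abs_add_le _ _).trans (add_le_add ((abs_add_le _ _).trans ?_) hI)
              rw [abs_mul, abs_of_nonneg hh0]
              gcongr
              exact hLip _ _ _
          _ = (1 + L * h) * |z (j * h) - e| + ε * h := by ring
          _ ≤ Real.exp (L * h) * (j * h * ε * Real.exp (L * (j * h))) + ε * h * 1 := by
              rw [mul_one]; gcongr
          _ ≤ Real.exp (L * h) * (j * h * ε * Real.exp (L * (j * h))) +
                ε * h * Real.exp (L * ((j + 1) * h)) := by gcongr
          _ = _ := by rw [hexpadd]; ring
    have := herr (m + 1) le_rfl
    push_cast at this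
    rw [hmh] at this
    linarith
  rw [Metric.tendsto_nhds]
  intro ε hε
  -- The `+ 1` covers `s = 0`.
  filter_upwards [key (ε / 2 / (s * Real.exp (L * s) + 1)) (by positivity)] with m hm
  rw [dist_comm, Real.dist_eq]
  refine hm.trans_lt ?_
  rw [div_mul_eq_mul_div, div_lt_iff₀ (by positivity)]
  nlinarith [mul_nonneg hs (Real.exp_pos (L * s)).le]

/-- The solution map of `dz = f(t, z) dt + σ dw` on `[0, T]`, as a limit of Euler schemes. -/
def solutionMap {T : ℝ} (hT : 0 ≤ T) (σ : ℝ) (f : ℝ → ℝ → ℝ) (s : ℝ)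
    (p : ℝ × (Icc (0 : ℝ) T → ℝ)) : ℝ :=
  limsup (fun m : ℕ => euler f (s / (m + 1)) p.1 (fun t => σ * p.2 (projIcc 0 T hT t)) (m + 1)) atTop

/-- An Euler scheme reads the path at finitely many times, hence is measurable for the product
σ-algebra, and a limsup of a sequence remains so whether or not the schemes converge. -/
lemma measurable_solutionMap {T : ℝ} (hT : 0 ≤ T) (σ : ℝ) {f : ℝ → ℝ → ℝ}
    (hf : Continuous fun z : ℝ × ℝ => f z.1 z.2) (s : ℝ) :
    Measurable (solutionMap hT σ f s) := by
  refine Measurable.limsup fun m => ?_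
  have : ∀ (h : ℝ) (j : ℕ), Measurable fun p : ℝ × (Icc (0 : ℝ) T → ℝ) =>
      euler f h p.1 (fun t => σ * p.2 (projIcc 0 T hT t)) j := by
    intro h j
    have hw : ∀ t, Measurable fun p : ℝ × (Icc (0 : ℝ) T → ℝ) => σ * p.2 (projIcc 0 T hT t) :=
      fun t => by
        have : Measurable fun p : ℝ × (Icc (0 : ℝ) T → ℝ) => p.2 (projIcc 0 T hT t) :=
          (measurable_pi_apply (projIcc 0 T hT t)).comp measurable_snd
        exact this.const_mul σ
    induction j with
    | zero => exact measurable_fst.add (hw 0)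
    | succ j ih =>
      simp only [euler]
      refine (ih.add ((hf.measurable.comp (measurable_const.prodMk ih)).const_mul h)).add ?_
      exact (hw _).sub (hw _)
  exact this _ _

/-- Contains uniqueness, and identifies solutions on different probability spaces as the same
functional of their data. -/
lemma eq_solutionMap {T L σ : ℝ} (hT : 0 ≤ T) (hL : 0 ≤ L) {f : ℝ → ℝ → ℝ}
    (hf : Continuous fun z : ℝ × ℝ => f z.1 z.2)
    (hLip : ∀ t x y, |f t x - f t y| ≤ L * |x - y|) {x : ℝ} {w z : ℝ → ℝ} (hz : Continuous z)
    (heq : ∀ t ∈ Icc 0 T, z t = x + (∫ u in (0 : ℝ)..t, f u (z u)) + σ * w t)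
    {s : ℝ} (hs : s ∈ Icc 0 T) : z s = solutionMap hT σ f s (x, fun t => w t) := by
  refine (tendsto_euler hs.1 hL hf hLip hz fun t ht => ?_).limsup_eq.symm
  have ht' : t ∈ Icc 0 T := ⟨ht.1, ht.2.trans hs.2⟩
  rw [heq t ht', projIcc_of_mem hT ht']

/-! ### The law and the moments of fractional Brownian motion -/

section GaussianLaw

variable {Ω Ω' : Type*} [MeasurableSpace Ω] [MeasurableSpace Ω'] {P : Measure Ω} {P' : Measure Ω'}

/-- Gaussian vectors with the same means and covariances have the same law. -/
lemma map_eq_of_gaussian {ι : Type*} [Fintype ι] {X : ι → Ω → ℝ} {Y : ι → Ω' → ℝ}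
    (hX : HasGaussianLaw (fun ω i => X i ω) P) (hY : HasGaussianLaw (fun ω i => Y i ω) P')
    (hmean : ∀ i, ∫ ω, X i ω ∂P = ∫ ω, Y i ω ∂P')
    (hcov : ∀ i j, cov[X i, X j; P] = cov[Y i, Y j; P']) :
    P.map (fun ω i => X i ω) = P'.map (fun ω i => Y i ω) := by
  have := hX.isProbabilityMeasure
  have := hY.isProbabilityMeasure
  have hXi := fun i => hX.eval i
  have hYi := fun i => hY.eval i
  have hXm := fun i => (hXi i).aemeasurable
  have hYm := fun i => (hYi i).aemeasurable
  have hXg := hX.isGaussian_map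
  have hYg := hY.isGaussian_map
  -- Passing to Euclidean space, where mean and covariance form determine a Gaussian measure.
  apply (MeasurableEquiv.toLp 2 (ι → ℝ)).map_measurableEquiv_injective
  rw [MeasurableEquiv.coe_toLp, ← PiLp.coe_symm_continuousLinearEquiv 2 ℝ]
  apply IsGaussian.ext
  · have hmX : AEMeasurable (fun ω i => X i ω) P := hX.aemeasurable
    have hmY : AEMeasurable (fun ω i => Y i ω) P' := hY.aemeasurable
    rw [integral_map (by fun_prop) (by fun_prop), integral_map (by fun_prop) (by fun_prop),
      integral_map (by fun_prop) (by fun_prop), integral_map (by fun_prop) (by fun_prop)]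
    simp only [id_eq]
    rw [ContinuousLinearEquiv.integral_comp_comm, ContinuousLinearEquiv.integral_comp_comm]
    congr 1
    ext i
    rw [eval_integral (fun i => (hXi i).integrable), eval_integral (fun i => (hYi i).integrable)]
    exact hmean i
  · rw [← ContinuousLinearMap.toBilinForm_inj]
    -- By polarisation it is enough to compare the quadratic forms.
    refine LinearMap.BilinForm.ext_of_isSymm isPosSemidef_covarianceBilin.isSymm
      isPosSemidef_covarianceBilin.isSymm fun x => ?_
    simp only [ContinuousLinearMap.toBilinForm_apply]
    rw [PiLp.coe_symm_continuousLinearEquiv,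
      AEMeasurable.map_map_of_aemeasurable (by fun_prop) hX.aemeasurable,
      AEMeasurable.map_map_of_aemeasurable (by fun_prop) hY.aemeasurable]
    simp only [Function.comp_def]
    rw [covarianceBilin_apply_pi (fun i => (hXi i).memLp_two),
      covarianceBilin_apply_pi (fun i => (hYi i).memLp_two)]
    simp_rw [hcov]

variable {H T : ℝ} {B : ℝ → Ω → ℝ} {B' : ℝ → Ω' → ℝ}

lemma IsFBM.hasGaussianLaw (hB : IsFBM P H T B) {t : ℝ} (ht : t ∈ Icc 0 T) :
    HasGaussianLaw (B t) P :=
  hB.gaussian.hasGaussianLaw_eval ⟨t, ht⟩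

lemma IsFBM.covariance (hB : IsFBM P H T B) {s t : ℝ} (hs : s ∈ Icc 0 T) (ht : t ∈ Icc 0 T) :
    cov[B s, B t; P] = (t ^ (2 * H) + s ^ (2 * H) - |t - s| ^ (2 * H)) / 2 := by
  have := (hB.hasGaussianLaw hs).isProbabilityMeasure
  rw [covariance_eq_sub (hB.hasGaussianLaw hs).memLp_two (hB.hasGaussianLaw ht).memLp_two,
    hB.mean s hs, zero_mul, sub_zero, ← hB.cov s hs t ht]
  exact integral_congr_ae (ae_of_all _ fun ω => mul_comm _ _)

lemma IsFBM.measurable_path (hB : IsFBM P H T B) :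
    Measurable fun ω (t : Icc (0 : ℝ) T) => B t ω :=
  measurable_pi_lambda _ fun t => hB.measurable t t.2

/-- The law of a fractional Brownian motion is determined by its Hurst index. -/
lemma IsFBM.map_eq (hB : IsFBM P H T B) (hB' : IsFBM P' H T B') :
    P.map (fun ω (t : Icc (0 : ℝ) T) => B t ω) = P'.map (fun ω (t : Icc (0 : ℝ) T) => B' t ω) := by
  have := hB.gaussian.isProbabilityMeasure
  have h1 := isProjectiveLimit_map (P := P) (X := fun (t : Icc (0 : ℝ) T) => B t)
    hB.measurable_path.aemeasurable
  have h2 := isProjectiveLimit_map (P := P') (X := fun (t : Icc (0 : ℝ) T) => B' t)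
    hB'.measurable_path.aemeasurable
  have heq : (fun I : Finset (Icc (0 : ℝ) T) => P.map fun ω => I.restrict fun t => B t ω) =
      fun I => P'.map fun ω => I.restrict fun t => B' t ω := by
    funext I
    refine map_eq_of_gaussian (X := fun (i : I) => B i.1) (Y := fun (i : I) => B' i.1)
      (hB.gaussian.hasGaussianLaw I) (hB'.gaussian.hasGaussianLaw I) (fun i => ?_) fun i j => ?_
    · rw [hB.mean _ i.1.2, hB'.mean _ i.1.2]
    · rw [hB.covariance i.1.2 j.1.2, hB'.covariance i.1.2 j.1.2]
  rw [← heq] at h2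
  exact h1.unique h2

lemma IsFBM.integral_sub_sq (hB : IsFBM P H T B) (hH : H ≠ 0) {s t : ℝ} (hs : s ∈ Icc 0 T)
    (ht : t ∈ Icc 0 T) : Integrable (fun ω => |B t ω - B s ω| ^ 2) P ∧
      ∫ ω, |B t ω - B s ω| ^ 2 ∂P = |t - s| ^ (2 * H) := by
  have hs2 := (hB.hasGaussianLaw hs).memLp_two
  have ht2 := (hB.hasGaussianLaw ht).memLp_two
  -- Fails for `H = 0`, where the power would be `1`.
  have h0 : (0 : ℝ) ^ (2 * H) = 0 := Real.zero_rpow (by simpa using hH)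
  have hst : Integrable (fun ω => B t ω * B s ω) P := ht2.integrable_mul hs2
  have e1 := hB.cov t ht t ht
  have e2 := hB.cov s hs s hs
  have e3 := hB.cov s hs t ht
  simp only [sub_self, abs_zero, h0, ← sq] at e1 e2
  have hexp : ∀ ω, |B t ω - B s ω| ^ 2 = B t ω ^ 2 - 2 * (B t ω * B s ω) + B s ω ^ 2 := fun ω => by
    rw [sq_abs]; ring
  simp_rw [hexp]
  have i1 := ht2.integrable_sq
  have i2 := hs2.integrable_sq
  have i3 := hst.const_mul 2
  have i4 : Integrable (fun ω => B t ω ^ 2 - 2 * (B t ω * B s ω)) P := i1.sub i3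
  refine ⟨i4.add i2, ?_⟩
  rw [integral_add i4 i2, integral_sub i1 i3, integral_const_mul, e1, e2, e3]
  ring

/-- The moments of a fractional Brownian motion are bounded on `[0, T]`. -/
lemma IsFBM.exists_moment_le (hB : IsFBM P H T B) (hH : 0 < H) (n : ℕ) :
    ∃ K : ℝ, ∀ t ∈ Icc 0 T, ∫⁻ ω, ENNReal.ofReal (|B t ω| ^ n) ∂P ≤ ENNReal.ofReal K := by
  have hZ : Integrable (fun x : ℝ => |x| ^ n) (gaussianReal 0 1) := by
    have := (memLp_id_gaussianReal' (μ := 0) (v := 1) n (by simp)).integrable_norm_pow'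
    simpa using this
  refine ⟨(T ^ H) ^ n * ∫ x, |x| ^ n ∂(gaussianReal 0 1), fun t ht => ?_⟩
  have hg := hB.hasGaussianLaw ht
  -- Scaling: $B_t$ has the law of $t^H Z$ with $Z$ standard normal.
  have hlaw : P.map (B t) = (gaussianReal 0 1).map (fun x => t ^ H * x) := by
    rw [hg.map_eq_gaussianReal, gaussianReal_map_const_mul, hB.mean t ht]
    congr 1
    · simp
    · have hv : Var[B t; P] = (t ^ H) ^ 2 := by
        rw [← covariance_self hg.aemeasurable, hB.covariance ht ht]
        have h0 : (0 : ℝ) ^ (2 * H) = 0 := Real.zero_rpow (by positivity)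
        rw [sub_self, abs_zero, h0, mul_comm, Real.rpow_mul ht.1, Real.rpow_two]
        ring
      rw [hv]
      ext
      simp [sq_nonneg]
  have h1 : ∫⁻ ω, ENNReal.ofReal (|B t ω| ^ n) ∂P = ∫⁻ x, ENNReal.ofReal (|x| ^ n) ∂(P.map (B t)) := by
    rw [lintegral_map' (by fun_prop) hg.aemeasurable]
  have hT : (t ^ H) ^ n ≤ (T ^ H) ^ n := by
    have := Real.rpow_nonneg ht.1 H
    have := Real.rpow_le_rpow ht.1 ht.2 hH.le
    gcongr
  rw [h1, hlaw, lintegral_map (by fun_prop) (by fun_prop)]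
  simp_rw [abs_mul, mul_pow, abs_of_nonneg (Real.rpow_nonneg ht.1 H)]
  rw [← ofReal_integral_eq_lintegral_ofReal (hZ.const_mul _)
    (ae_of_all _ fun x => by have := Real.rpow_nonneg ht.1 H; positivity), integral_const_mul]
  refine ENNReal.ofReal_le_ofReal (mul_le_mul_of_nonneg_right hT ?_)
  exact integral_nonneg fun x => by positivity

end GaussianLaw

/-! ### Continuous versions and moments of time integrals -/

section ContinuousVersion

variable {Ω : Type*}

/-- A process on `[0, T]`, extended by constants to all times, and set to zero off the event `G`. -/
def continuousVersion {T : ℝ} (hT : 0 ≤ T) (G : Set Ω) (Z : ℝ → Ω → ℝ) (t : ℝ) : Ω → ℝ :=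
  G.indicator (Z (projIcc 0 T hT t))

variable {T : ℝ} {hT : 0 ≤ T} {G : Set Ω} {Z : ℝ → Ω → ℝ}

lemma measurable_continuousVersion [MeasurableSpace Ω] (hG : MeasurableSet G) (hZ : ∀ t ∈ Icc 0 T, Measurable (Z t))
    (t : ℝ) : Measurable (continuousVersion hT G Z t) :=
  (hZ _ (projIcc 0 T hT t).2).indicator hG

lemma continuous_continuousVersion (hZ : ∀ ω ∈ G, ContinuousOn (fun t => Z t ω) (Icc 0 T)) (ω : Ω) :
    Continuous fun t => continuousVersion hT G Z t ω := by
  by_cases hω : ω ∈ G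
  · simp only [continuousVersion, indicator_of_mem hω]
    exact (continuousOn_iff_continuous_domRestrict.1 (hZ ω hω)).comp continuous_projIcc
  · simp only [continuousVersion, indicator_of_notMem hω]
    exact continuous_const

lemma continuousVersion_eq {ω : Ω} (hω : ω ∈ G) {t : ℝ} (ht : t ∈ Icc 0 T) :
    continuousVersion hT G Z t ω = Z t ω := by
  simp only [continuousVersion, indicator_of_mem hω, projIcc_of_mem hT ht]

end ContinuousVersion

/-- Jensen's inequality for the normalised Lebesgue measure on `(s, t]`. -/
lemma pow_intervalIntegral_le {a : ℝ → ℝ} (ha : Continuous a) (ha0 : ∀ t, 0 ≤ a t) {s t : ℝ}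
    (hst : s ≤ t) (n : ℕ) :
    (∫ u in s..t, a u) ^ (n + 1) ≤ (t - s) ^ n * ∫ u in s..t, a u ^ (n + 1) := by
  rcases hst.eq_or_lt with rfl | hst
  · simp
  have hts : 0 < t - s := sub_pos.2 hst
  have h := (convexOn_pow (n + 1)).map_set_average_le (μ := volume) (t := Ioc s t) (f := a)
    (by fun_prop) isClosed_Ici (by simp [hst]) (by simp) (ae_of_all _ fun u => ha0 u)
    (ha.integrableOn_Ioc) ((ha.pow _).integrableOn_Ioc)
  rw [setAverage_eq, setAverage_eq] at h
  simp only [measureReal_def, Real.volume_Ioc, ENNReal.toReal_ofReal hts.le, smul_eq_mul] at h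
  rw [← intervalIntegral.integral_of_le hst.le, ← intervalIntegral.integral_of_le hst.le, mul_pow] at h
  have h2 := mul_le_mul_of_nonneg_left h (pow_nonneg hts.le (n + 1))
  calc (∫ u in s..t, a u) ^ (n + 1)
      = (t - s) ^ (n + 1) * ((t - s)⁻¹ ^ (n + 1) * (∫ u in s..t, a u) ^ (n + 1)) := by
        rw [← mul_assoc, ← mul_pow, mul_inv_cancel₀ hts.ne', one_pow, one_mul]
    _ ≤ (t - s) ^ (n + 1) * ((t - s)⁻¹ * ∫ u in s..t, a u ^ (n + 1)) := h2
    _ = _ := by rw [pow_succ, mul_assoc, mul_inv_cancel_left₀ hts.ne']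

section

variable {Ω : Type*} [MeasurableSpace Ω] {P : Measure Ω} [SFinite P]

/-- Tonelli's theorem for the mean of a time integral. -/
lemma lintegral_intervalIntegral_le {a : ℝ → Ω → ℝ} (hac : ∀ ω, Continuous fun t => a t ω)
    (ham : ∀ t, Measurable (a t)) (ha0 : ∀ t ω, 0 ≤ a t ω) {s t : ℝ} (hst : s ≤ t) {K : ℝ}
    (hK : ∀ u ∈ Icc s t, ∫⁻ ω, ENNReal.ofReal (a u ω) ∂P ≤ ENNReal.ofReal K) :
    ∫⁻ ω, ENNReal.ofReal (∫ u in s..t, a u ω) ∂P ≤ ENNReal.ofReal (K * (t - s)) := by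
  have hm : Measurable (Function.uncurry a) := measurable_uncurry_of_continuous_of_measurable hac ham
  have h1 : ∀ ω, ENNReal.ofReal (∫ u in s..t, a u ω) =
      ∫⁻ u in Ioc s t, ENNReal.ofReal (a u ω) := fun ω => by
    rw [intervalIntegral.integral_of_le hst, ofReal_integral_eq_lintegral_ofReal
      (hac ω).integrableOn_Ioc (ae_of_all _ fun u => ha0 u ω)]
  simp_rw [h1]
  rw [lintegral_lintegral_swap]
  · calc ∫⁻ u in Ioc s t, ∫⁻ ω, ENNReal.ofReal (a u ω) ∂P
        ≤ ∫⁻ _u in Ioc s t, ENNReal.ofReal K :=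
          setLIntegral_mono' measurableSet_Ioc fun u hu => hK u (Ioc_subset_Icc_self hu)
      _ = _ := by
          rw [setLIntegral_const, Real.volume_Ioc, ENNReal.ofReal_mul' (by linarith)]
  · have := (hm.comp measurable_swap).ennreal_ofReal
    exact this.aemeasurable

/-- Moments of a process dominated as in Grönwall's inequality. -/
lemma lintegral_pow_le_of_gronwall {X a : ℝ → Ω → ℝ} {T κ K : ℝ} {n : ℕ} (hT : 0 ≤ T) (hκ : 0 ≤ κ)
    (hac : ∀ ω, Continuous fun t => a t ω) (ham : ∀ t, Measurable (a t)) (ha0 : ∀ t ω, 0 ≤ a t ω)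
    (hK0 : 0 ≤ K)
    (hK : ∀ t ∈ Icc 0 T, ∫⁻ ω, ENNReal.ofReal (a t ω ^ (n + 1)) ∂P ≤ ENNReal.ofReal K)
    (hX : ∀ᵐ ω ∂P, ∀ t ∈ Icc 0 T, |X t ω| ≤ a t ω + κ * ∫ s in (0 : ℝ)..T, a s ω)
    {t : ℝ} (ht : t ∈ Icc 0 T) :
    ∫⁻ ω, ENNReal.ofReal (|X t ω| ^ (n + 1)) ∂P ≤
      ENNReal.ofReal (2 ^ n * (K + κ ^ (n + 1) * T ^ n * (K * T))) := by
  have hpt : ∀ᵐ ω ∂P, ENNReal.ofReal (|X t ω| ^ (n + 1)) ≤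
      ENNReal.ofReal (2 ^ n) * (ENNReal.ofReal (a t ω ^ (n + 1)) +
        ENNReal.ofReal (κ ^ (n + 1) * T ^ n) *
          ENNReal.ofReal (∫ s in (0 : ℝ)..T, a s ω ^ (n + 1))) := by
    filter_upwards [hX] with ω hω
    have hI : 0 ≤ ∫ s in (0 : ℝ)..T, a s ω := intervalIntegral.integral_nonneg hT fun s _ => ha0 s ω
    have hI' : 0 ≤ ∫ s in (0 : ℝ)..T, a s ω ^ (n + 1) :=
      intervalIntegral.integral_nonneg hT fun s _ => pow_nonneg (ha0 s ω) _
    rw [← ENNReal.ofReal_mul (by positivity), ← ENNReal.ofReal_add (pow_nonneg (ha0 t ω) _)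
      (by positivity), ← ENNReal.ofReal_mul (by positivity)]
    refine ENNReal.ofReal_le_ofReal ?_
    calc |X t ω| ^ (n + 1) ≤ (a t ω + κ * ∫ s in (0 : ℝ)..T, a s ω) ^ (n + 1) := by
          gcongr; exact hω t ht
      _ ≤ 2 ^ n * (a t ω ^ (n + 1) + (κ * ∫ s in (0 : ℝ)..T, a s ω) ^ (n + 1)) :=
          add_pow_le (ha0 t ω) (by positivity) (n + 1)
      _ ≤ 2 ^ n * (a t ω ^ (n + 1) + κ ^ (n + 1) * T ^ n * ∫ s in (0 : ℝ)..T, a s ω ^ (n + 1)) := by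
          rw [mul_pow, mul_assoc (κ ^ (n + 1))]
          gcongr
          simpa using pow_intervalIntegral_le (hac ω) (fun s => ha0 s ω) hT n
  refine (lintegral_mono_ae hpt).trans ?_
  have h2 := lintegral_intervalIntegral_le (P := P) (a := fun t ω => a t ω ^ (n + 1))
    (fun ω => (hac ω).pow _) (fun t => (ham t).pow_const _) (fun t ω => pow_nonneg (ha0 t ω) _) hT hK
  rw [lintegral_const_mul' _ _ ENNReal.ofReal_ne_top, lintegral_add_left
    (((ham t).pow_const _).ennreal_ofReal), lintegral_const_mul' _ _ ENNReal.ofReal_ne_top,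
    ENNReal.ofReal_mul (p := 2 ^ n) (by positivity), ENNReal.ofReal_add hK0 (by positivity),
    ENNReal.ofReal_mul (p := κ ^ (n + 1) * T ^ n) (by positivity)]
  rw [sub_zero] at h2
  gcongr
  exact hK t ht

end

/-! ### Moments of the McKean–Vlasov solution -/

section Moments

variable {Ω : Type*} [MeasurableSpace Ω] {P : Measure Ω} {p : ℕ}
  {θ : Fin p → ℝ} {b : Fin p → ℝ → P2 → ℝ} {H T σ : ℝ} {μ₀ : Measure ℝ}
  {B X : ℝ → Ω → ℝ} {μ : ℝ → P2}

/-- A measurable event of full measure is what `continuousVersion` needs to stay measurable in `ω`.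
-/
lemma IsMcKeanVlasov.exists_good_event (h : IsMcKeanVlasov P θ b H T σ μ₀ B X μ) :
    ∃ G : Set Ω, G ∈ ae P ∧ MeasurableSet G ∧ ∀ ω ∈ G,
      SolvesOn T σ (fun s => drift θ b (X s ω) (μ s)) (fun t => B t ω) (fun t => X t ω) ∧
      ContinuousOn (fun t => B t ω) (Icc 0 T) := by
  have := (h.eq.and h.fbm.continuous).exists_measurable_mem
  exact this

/-- The drift has linear growth, with an integrable constant. -/
lemma IsMcKeanVlasov.exists_drift_bound [IsProbabilityMeasure P]
    (h : IsMcKeanVlasov P θ b H T σ μ₀ B X μ) (hT : 0 ≤ T)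
    {L : ℝ} (hL : 0 < L) (hdrift : ∀ (x y : ℝ) (μ ν : P2),
      |drift θ b x μ - drift θ b y ν| ≤ L * (|x - y| + W2 μ ν)) :
    ∃ k : ℝ → ℝ, IntervalIntegrable k volume 0 T ∧ (∀ s, 0 ≤ k s) ∧
      ∀ s x, |drift θ b x (μ s)| ≤ k s + L * |x| := by
  -- A single sample path serves as reference. Its drift is integrable in time, and the Lipschitz
  -- bound transfers this to every `x`, so no regularity of $s\mapsto\mu_s$ is needed at this stage.
  obtain ⟨ω, hω⟩ := h.eq.exists
  refine ⟨fun s => |drift θ b (X s ω) (μ s)| + L * |X s ω|, hω.integrable.abs.add ?_,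
    fun s => by positivity, fun s x => ?_⟩
  · have hc : ContinuousOn (fun s => L * |X s ω|) (uIcc 0 T) := by
      rw [uIcc_of_le hT]
      exact continuousOn_const.mul hω.continuousOn.abs
    exact hc.intervalIntegrable
  · have h1 := hdrift x (X s ω) (μ s) (μ s)
    rw [W2_self, add_zero] at h1
    have h2 := abs_sub_abs_le_abs_sub (drift θ b x (μ s)) (drift θ b (X s ω) (μ s))
    have h3 : L * |x - X s ω| ≤ L * (|x| + |X s ω|) := by gcongr; exact abs_sub _ _
    linarith

/-- An increment of the drift part of a solution. -/
lemma abs_sub_le_of_solvesOn {f w x k y : ℝ → ℝ} {L : ℝ} (hx : SolvesOn T σ f w x)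
    (hk : IntervalIntegrable k volume 0 T) (hy : Continuous y)
    (hf : ∀ s ∈ Icc 0 T, |f s| ≤ k s + L * y s) {s t : ℝ} (hs : s ∈ Icc 0 T)
    (ht : t ∈ Icc 0 T) (hst : s ≤ t) :
    |x t - x s| ≤ (∫ u in s..t, k u) + L * (∫ u in s..t, y u) + |σ| * |w t - w s| := by
  have hT : 0 ≤ T := hs.1.trans hs.2
  have hsub : ∀ {u v}, u ∈ Icc 0 T → v ∈ Icc 0 T → uIcc u v ⊆ uIcc 0 T := fun hu hv => by
    rw [uIcc_of_le hT]; exact uIcc_subset_Icc hu hv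
  have h0 : (0 : ℝ) ∈ Icc 0 T := left_mem_Icc.2 hT
  have hfi : ∀ {u v}, u ∈ Icc 0 T → v ∈ Icc 0 T → IntervalIntegrable f volume u v :=
    fun hu hv => hx.integrable.mono_set (hsub hu hv)
  have hki : IntervalIntegrable k volume s t := hk.mono_set (hsub hs ht)
  have hyi : IntervalIntegrable (fun u => L * y u) volume s t := (hy.const_mul L).intervalIntegrable _ _
  have h1 : x t - x s = (∫ u in s..t, f u) + σ * (w t - w s) := by
    rw [hx.eq t ht, hx.eq s hs,
      ← intervalIntegral.integral_interval_sub_left (hfi h0 ht) (hfi h0 hs)]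
    ring
  rw [h1]
  refine (abs_add_le _ _).trans ?_
  rw [abs_mul]
  gcongr
  calc |∫ u in s..t, f u| ≤ ∫ u in s..t, |f u| := intervalIntegral.abs_integral_le_integral_abs hst
    _ ≤ ∫ u in s..t, (k u + L * y u) :=
        intervalIntegral.integral_mono_on hst (hfi hs ht).abs (hki.add hyi) fun u hu =>
          hf u ⟨hs.1.trans hu.1, hu.2.trans ht.2⟩
    _ = _ := by rw [intervalIntegral.integral_add hki hyi, intervalIntegral.integral_const_mul]

/-- The moments of the McKean-Vlasov solution are bounded on `[0, T]`. -/
lemma IsMcKeanVlasov.exists_moment_le_succ [IsProbabilityMeasure P]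
    (h : IsMcKeanVlasov P θ b H T σ μ₀ B X μ) (hT : 0 < T)
    (hH : 0 < H) (hb : LipschitzDrift b)
    (hμ₀ : ∀ k : ℕ, 1 ≤ k → Integrable (fun x : ℝ => |x| ^ k) μ₀) (n : ℕ) :
    ∃ K, ∀ t ∈ Icc 0 T, ∫⁻ ω, ENNReal.ofReal (|X t ω| ^ (n + 1)) ∂P ≤ ENNReal.ofReal K := by
  obtain ⟨L, hL, hdrift⟩ := hb.exists_drift θ
  obtain ⟨k, hk, hk0, hdk⟩ := h.exists_drift_bound hT.le hL hdrift
  obtain ⟨G, hGae, hGm, hG⟩ := h.exists_good_event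
  have h0 : (0 : ℝ) ∈ Icc 0 T := left_mem_Icc.2 hT.le
  set Y := continuousVersion hT.le G X
  set W := continuousVersion hT.le G B
  have hYc : ∀ ω, Continuous fun t => Y t ω :=
    continuous_continuousVersion fun ω hω => (hG ω hω).1.continuousOn
  have hWc : ∀ ω, Continuous fun t => W t ω :=
    continuous_continuousVersion fun ω hω => (hG ω hω).2
  have hYm : ∀ t, Measurable (Y t) := measurable_continuousVersion hGm h.measurable
  have hWm : ∀ t, Measurable (W t) := measurable_continuousVersion hGm h.fbm.measurable
  set c := ∫ s in (0 : ℝ)..T, k s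
  have hc : 0 ≤ c := intervalIntegral.integral_nonneg hT.le fun s _ => hk0 s
  -- The inhomogeneity in Grönwall's inequality: everything except the linear part of the drift.
  set a : ℝ → Ω → ℝ := fun t ω => |Y 0 ω| + c + |σ| * |W t ω - W 0 ω|
  have ha0 : ∀ t ω, 0 ≤ a t ω := fun t ω => by positivity
  have hac : ∀ ω, Continuous fun t => a t ω := fun ω => by have := hWc ω; fun_prop
  have ham : ∀ t, Measurable (a t) := fun t => by
    have := hYm 0
    have := hWm 0
    have := hWm t
    fun_prop
  have hpath : ∀ᵐ ω ∂P, ∀ t ∈ Icc 0 T,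
      |X t ω| ≤ a t ω + L * Real.exp (L * T) * ∫ s in (0 : ℝ)..T, a s ω := by
    filter_upwards [hGae] with ω hω t ht
    rw [← continuousVersion_eq (hT := hT.le) hω ht (Z := X)]
    refine gronwall_integral hL.le (hYc ω).abs (hac ω) (fun t => ha0 t ω) (fun t ht => ?_) ht
    have h1 := abs_sub_le_of_solvesOn (L := L) (hG ω hω).1 hk (hYc ω).abs (fun s hs => by
      rw [show Y s ω = X s ω from continuousVersion_eq hω hs]
      exact hdk s (X s ω)) h0 ht ht.1
    rw [← continuousVersion_eq (hT := hT.le) hω ht (Z := X),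
      ← continuousVersion_eq (hT := hT.le) hω h0 (Z := X),
      ← continuousVersion_eq (hT := hT.le) hω ht (Z := B),
      ← continuousVersion_eq (hT := hT.le) hω h0 (Z := B)] at h1
    have h2 : ∫ s in (0 : ℝ)..t, k s ≤ c :=
      intervalIntegral.integral_mono_interval le_rfl ht.1 ht.2 (ae_of_all _ hk0) hk
    have h3 := abs_sub_abs_le_abs_sub (Y t ω) (Y 0 ω)
    change |Y t ω| ≤ |Y 0 ω| + c + |σ| * |W t ω - W 0 ω| + _
    change |Y t ω - Y 0 ω| ≤ _ + |σ| * |W t ω - W 0 ω| at h1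
    linarith
  obtain ⟨KB, hKB⟩ := h.fbm.exists_moment_le hH (n + 1)
  have hX0 : ∫⁻ ω, ENNReal.ofReal (|Y 0 ω| ^ (n + 1)) ∂P ≠ ⊤ := by
    have h1 : ∫⁻ ω, ENNReal.ofReal (|Y 0 ω| ^ (n + 1)) ∂P =
        ∫⁻ x, ENNReal.ofReal (|x| ^ (n + 1)) ∂μ₀ := by
      rw [← h.law_init, lintegral_map (by fun_prop) (h.measurable 0 h0)]
      refine lintegral_congr_ae ?_
      filter_upwards [hGae] with ω hω
      rw [show Y 0 ω = X 0 ω from continuousVersion_eq hω h0]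
    rw [h1]
    exact ((hμ₀ (n + 1) (by omega)).lintegral_lt_top).ne
  have hWB : ∀ t ∈ Icc 0 T, ∫⁻ ω, ENNReal.ofReal (|W t ω| ^ (n + 1)) ∂P ≤ ENNReal.ofReal KB := by
    intro t ht
    refine le_trans (le_of_eq ?_) (hKB t ht)
    refine lintegral_congr_ae ?_
    filter_upwards [hGae] with ω hω
    rw [show W t ω = B t ω from continuousVersion_eq hω ht]
  -- Two rounds of $(u+v)^{n+1}\le2^n(u^{n+1}+v^{n+1})$ split the four terms at the price
  -- $4^n\le4^{n+1}$.
  set K₁ : ENNReal := ENNReal.ofReal (4 ^ (n + 1)) * (∫⁻ ω, ENNReal.ofReal (|Y 0 ω| ^ (n + 1)) ∂P +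
    ENNReal.ofReal (c ^ (n + 1)) + ENNReal.ofReal (|σ| ^ (n + 1)) * ENNReal.ofReal KB +
    ENNReal.ofReal (|σ| ^ (n + 1)) * ENNReal.ofReal KB) with hK₁
  have hK₁top : K₁ ≠ ⊤ := by
    refine ENNReal.mul_ne_top ENNReal.ofReal_ne_top ?_
    simp only [ne_eq, ENNReal.add_eq_top, not_or]
    refine ⟨⟨⟨hX0, ENNReal.ofReal_ne_top⟩, ?_⟩, ?_⟩ <;>
    exact ENNReal.mul_ne_top ENNReal.ofReal_ne_top ENNReal.ofReal_ne_top
  have hmom : ∀ t ∈ Icc 0 T, ∫⁻ ω, ENNReal.ofReal (a t ω ^ (n + 1)) ∂P ≤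
      ENNReal.ofReal K₁.toReal := by
    intro t ht
    rw [ENNReal.ofReal_toReal hK₁top]
    have hpt : ∀ ω, ENNReal.ofReal (a t ω ^ (n + 1)) ≤ ENNReal.ofReal (4 ^ (n + 1)) *
        (ENNReal.ofReal (|Y 0 ω| ^ (n + 1)) + ENNReal.ofReal (c ^ (n + 1)) +
        ENNReal.ofReal (|σ| ^ (n + 1)) * ENNReal.ofReal (|W t ω| ^ (n + 1)) +
        ENNReal.ofReal (|σ| ^ (n + 1)) * ENNReal.ofReal (|W 0 ω| ^ (n + 1))) := by
      intro ω
      rw [← ENNReal.ofReal_mul (by positivity), ← ENNReal.ofReal_mul (by positivity),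
        ← ENNReal.ofReal_add (by positivity) (by positivity),
        ← ENNReal.ofReal_add (by positivity) (by positivity),
        ← ENNReal.ofReal_add (by positivity) (by positivity),
        ← ENNReal.ofReal_mul (by positivity)]
      refine ENNReal.ofReal_le_ofReal ?_
      rw [← mul_pow, ← mul_pow]
      have h1 : a t ω ≤ (|Y 0 ω| + c) + (|σ| * |W t ω| + |σ| * |W 0 ω|) := by
        have : |σ| * |W t ω - W 0 ω| ≤ |σ| * (|W t ω| + |W 0 ω|) := by gcongr; exact abs_sub _ _
        change |Y 0 ω| + c + |σ| * |W t ω - W 0 ω| ≤ _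
        linarith
      have h2 := pow_le_pow_left₀ (ha0 t ω) h1 (n + 1)
      have h3 := add_pow_le (show 0 ≤ |Y 0 ω| + c by positivity)
        (show 0 ≤ |σ| * |W t ω| + |σ| * |W 0 ω| by positivity) (n + 1)
      have h4 := add_pow_le (abs_nonneg (Y 0 ω)) hc (n + 1)
      have h5 := add_pow_le (show 0 ≤ |σ| * |W t ω| by positivity)
        (show 0 ≤ |σ| * |W 0 ω| by positivity) (n + 1)
      simp only [Nat.add_sub_cancel] at h3 h4 h5
      calc a t ω ^ (n + 1) ≤ _ := h2.trans h3
        _ ≤ 2 ^ n * (2 ^ n * (|Y 0 ω| ^ (n + 1) + c ^ (n + 1)) +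
            2 ^ n * ((|σ| * |W t ω|) ^ (n + 1) + (|σ| * |W 0 ω|) ^ (n + 1))) := by gcongr
        _ = 4 ^ n * (|Y 0 ω| ^ (n + 1) + c ^ (n + 1) + (|σ| * |W t ω|) ^ (n + 1) +
            (|σ| * |W 0 ω|) ^ (n + 1)) := by
            rw [show (4 : ℝ) ^ n = 2 ^ n * 2 ^ n by rw [← mul_pow]; norm_num]; ring
        _ ≤ _ := by gcongr <;> norm_num
    refine (lintegral_mono hpt).trans ?_
    have m0 : Measurable fun ω => ENNReal.ofReal (|Y 0 ω| ^ (n + 1)) := by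
      have := hYm 0; fun_prop
    have mW : ∀ t, Measurable fun ω => ENNReal.ofReal (|W t ω| ^ (n + 1)) := fun t => by
      have := hWm t; fun_prop
    rw [lintegral_const_mul' _ _ ENNReal.ofReal_ne_top,
      lintegral_add_left (by have := mW t; fun_prop), lintegral_add_left (by fun_prop),
      lintegral_add_left m0, lintegral_const,
      lintegral_const_mul' _ _ ENNReal.ofReal_ne_top,
      lintegral_const_mul' _ _ ENNReal.ofReal_ne_top, measure_univ, mul_one, hK₁]
    gcongr
    · exact hWB t ht
    · exact hWB 0 h0
  exact ⟨_, fun t ht => lintegral_pow_le_of_gronwall hT.le (by positivity) hac ham ha0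
    ENNReal.toReal_nonneg hmom hpath ht⟩

/-- The power `n` is dominated by the power `n + 1`, which also covers `n = 0`. -/
lemma IsMcKeanVlasov.exists_moment_le [IsProbabilityMeasure P]
    (h : IsMcKeanVlasov P θ b H T σ μ₀ B X μ) (hT : 0 < T)
    (hH : 0 < H) (hb : LipschitzDrift b)
    (hμ₀ : ∀ k : ℕ, 1 ≤ k → Integrable (fun x : ℝ => |x| ^ k) μ₀) (n : ℕ) :
    ∃ K, ∀ t ∈ Icc 0 T, Integrable (fun x : ℝ => |x| ^ n) (μ t).toMeasure ∧
      ∫ x, |x| ^ n ∂(μ t).toMeasure ≤ K := by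
  obtain ⟨K, hK⟩ := h.exists_moment_le_succ hT hH hb hμ₀ n
  refine ⟨1 + max K 0, fun t ht => ?_⟩
  have h1 : ∫⁻ x, ENNReal.ofReal (|x| ^ (n + 1)) ∂(μ t).toMeasure ≤ ENNReal.ofReal K := by
    rw [← h.law t ht, lintegral_map (by fun_prop) (h.measurable t ht)]
    exact hK t ht
  have h2 : Integrable (fun x : ℝ => |x| ^ (n + 1)) (μ t).toMeasure := by
    refine ⟨by fun_prop, ?_⟩
    rw [hasFiniteIntegral_iff_ofReal (ae_of_all _ fun x => by positivity)]
    exact h1.trans_lt ENNReal.ofReal_lt_top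
  have h3 : ∫ x, |x| ^ (n + 1) ∂(μ t).toMeasure ≤ max K 0 := by
    rw [← ofReal_integral_eq_lintegral_ofReal h2 (ae_of_all _ fun x => by positivity)] at h1
    refine (ENNReal.ofReal_le_ofReal_iff (le_max_right _ _)).1
      (h1.trans (ENNReal.ofReal_le_ofReal (le_max_left _ _)))
  have hle : ∀ x : ℝ, |x| ^ n ≤ 1 + |x| ^ (n + 1) := fun x =>
    pow_le_one_add_pow (abs_nonneg x) (Nat.le_succ n)
  have hi : Integrable (fun x : ℝ => 1 + |x| ^ (n + 1)) (μ t).toMeasure := by fun_prop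
  have h4 : Integrable (fun x : ℝ => |x| ^ n) (μ t).toMeasure :=
    hi.mono' (by fun_prop) (ae_of_all _ fun x => by
      rw [Real.norm_of_nonneg (by positivity)]; exact hle x)
  refine ⟨h4, (integral_mono h4 hi hle).trans ?_⟩
  rw [integral_add (by fun_prop) h2]
  simpa using h3

end Moments

/-! ### Continuity of the flow of laws -/

section LawContinuity

variable {Ω : Type*} [MeasurableSpace Ω] {P : Measure Ω} [IsProbabilityMeasure P] {p : ℕ}
  {θ : Fin p → ℝ} {b : Fin p → ℝ → P2 → ℝ} {H T σ : ℝ} {μ₀ : Measure ℝ}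
  {B X : ℝ → Ω → ℝ} {μ : ℝ → P2}

/-- The process itself couples its laws at two times. Its increment splits into the integral of `k`,
the linear part of the drift, bounded by Cauchy–Schwarz and second moments, and the noise, of
variance $\sigma^2|t-s|^{2H}$. -/
lemma IsMcKeanVlasov.exists_W2_sq_le (h : IsMcKeanVlasov P θ b H T σ μ₀ B X μ) (hT : 0 < T)
    (hH : 0 < H) (hb : LipschitzDrift b)
    (hμ₀ : ∀ k : ℕ, 1 ≤ k → Integrable (fun x : ℝ => |x| ^ k) μ₀) :
    ∃ (k : ℝ → ℝ) (C : ℝ), IntervalIntegrable k volume 0 T ∧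
      ∀ s ∈ Icc 0 T, ∀ t ∈ Icc 0 T, s ≤ t → W2 (μ s) (μ t) ^ 2 ≤
        3 * (∫ u in s..t, k u) ^ 2 + C * (t - s) ^ 2 + 3 * σ ^ 2 * |t - s| ^ (2 * H) := by
  obtain ⟨L, hL, hdrift⟩ := hb.exists_drift θ
  obtain ⟨k, hk, hk0, hdk⟩ := h.exists_drift_bound hT.le hL hdrift
  obtain ⟨G, hGae, hGm, hG⟩ := h.exists_good_event
  obtain ⟨K, hK⟩ := h.exists_moment_le_succ hT hH hb hμ₀ 1
  set Y := continuousVersion hT.le G X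
  have hYc : ∀ ω, Continuous fun t => Y t ω :=
    continuous_continuousVersion fun ω hω => (hG ω hω).1.continuousOn
  have hYm : ∀ t, Measurable (Y t) := measurable_continuousVersion hGm h.measurable
  refine ⟨k, 3 * L ^ 2 * max K 0, hk, fun s hs t ht hst => ?_⟩
  have hts : 0 ≤ t - s := sub_nonneg.2 hst
  have hYK : ∀ u ∈ Icc s t, ∫⁻ ω, ENNReal.ofReal (|Y u ω| ^ 2) ∂P ≤ ENNReal.ofReal (max K 0) := by
    intro u hu
    have hu' : u ∈ Icc 0 T := ⟨hs.1.trans hu.1, hu.2.trans ht.2⟩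
    refine le_trans (le_of_eq ?_) ((hK u hu').trans (ENNReal.ofReal_le_ofReal (le_max_left _ _)))
    refine lintegral_congr_ae ?_
    filter_upwards [hGae] with ω hω
    rw [show Y u ω = X u ω from continuousVersion_eq hω hu']
  have h1 := lintegral_intervalIntegral_le (P := P) (a := fun u ω => |Y u ω| ^ 2)
    (fun ω => by have := hYc ω; fun_prop) (fun t => by have := hYm t; fun_prop)
    (fun t ω => by positivity) hst hYK
  obtain ⟨hBi, hBs⟩ := h.fbm.integral_sub_sq hH.ne' hs ht
  have hpt : ∀ᵐ ω ∂P, ENNReal.ofReal (|X s ω - X t ω| ^ 2) ≤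
      ENNReal.ofReal (3 * (∫ u in s..t, k u) ^ 2) +
      ENNReal.ofReal (3 * L ^ 2 * (t - s)) * ENNReal.ofReal (∫ u in s..t, |Y u ω| ^ 2) +
      ENNReal.ofReal (3 * σ ^ 2) * ENNReal.ofReal (|B t ω - B s ω| ^ 2) := by
    filter_upwards [hGae] with ω hω
    have hI : 0 ≤ ∫ u in s..t, |Y u ω| ^ 2 :=
      intervalIntegral.integral_nonneg hst fun u _ => by positivity
    rw [← ENNReal.ofReal_mul (by positivity), ← ENNReal.ofReal_mul (by positivity),
      ← ENNReal.ofReal_add (by positivity) (by positivity),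
      ← ENNReal.ofReal_add (by positivity) (by positivity)]
    refine ENNReal.ofReal_le_ofReal ?_
    have e1 := abs_sub_le_of_solvesOn (L := L) (hG ω hω).1 hk (hYc ω).abs (fun s hs => by
      rw [show Y s ω = X s ω from continuousVersion_eq hω hs]
      exact hdk s (X s ω)) hs ht hst
    have e2 := pow_intervalIntegral_le (hYc ω).abs (fun u => abs_nonneg _) hst 1
    rw [abs_sub_comm] at e1
    have e3 := pow_le_pow_left₀ (abs_nonneg _) e1 2
    norm_num only [pow_one] at e2
    have e4 : ∀ x y z : ℝ, (x + y + z) ^ 2 ≤ 3 * x ^ 2 + 3 * y ^ 2 + 3 * z ^ 2 := fun x y z => by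
      nlinarith [sq_nonneg (x - y), sq_nonneg (x - z), sq_nonneg (y - z)]
    refine (e3.trans (e4 _ _ _)).trans ?_
    rw [mul_pow, mul_pow, sq_abs σ]
    have e5 := mul_le_mul_of_nonneg_left e2 (show 0 ≤ 3 * L ^ 2 by positivity)
    linarith
  have hW := (ofReal_W2_sq_le_of_law (h.measurable s hs).aemeasurable
    (h.measurable t ht).aemeasurable (h.law s hs) (h.law t ht)).trans (lintegral_mono_ae hpt)
  have hmeas : AEMeasurable (fun ω => ENNReal.ofReal (|B t ω - B s ω| ^ 2)) P := by
    have := h.fbm.measurable s hs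
    have := h.fbm.measurable t ht
    fun_prop
  rw [lintegral_add_right' _ (hmeas.const_mul _), lintegral_add_left measurable_const,
    lintegral_const, measure_univ, mul_one, lintegral_const_mul' _ _ ENNReal.ofReal_ne_top,
    lintegral_const_mul' _ _ ENNReal.ofReal_ne_top,
    ← ofReal_integral_eq_lintegral_ofReal hBi (ae_of_all _ fun _ => by positivity), hBs] at hW
  replace hW := hW.trans (add_le_add_left (add_le_add_right (mul_le_mul_right h1 _) _) _)
  rw [← ENNReal.ofReal_mul (by positivity), ← ENNReal.ofReal_mul (by positivity),
      ← ENNReal.ofReal_add (by positivity) (by positivity),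
      ← ENNReal.ofReal_add (by positivity) (by positivity),
      ENNReal.ofReal_le_ofReal_iff (by positivity)] at hW
  refine hW.trans_eq ?_
  ring

/-- The flow of marginal laws of the McKean-Vlasov solution is continuous. -/
lemma IsMcKeanVlasov.continuousOn_law (h : IsMcKeanVlasov P θ b H T σ μ₀ B X μ) (hT : 0 < T)
    (hH : 0 < H) (hb : LipschitzDrift b)
    (hμ₀ : ∀ k : ℕ, 1 ≤ k → Integrable (fun x : ℝ => |x| ^ k) μ₀) :
    ContinuousOn μ (Icc 0 T) := by
  obtain ⟨k, C, hk, hW⟩ := h.exists_W2_sq_le hT hH hb hμ₀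
  have h0 : (0 : ℝ) ∈ Icc 0 T := left_mem_Icc.2 hT.le
  -- The function `k` is merely integrable, but its primitive is continuous.
  set F : ℝ → ℝ := fun t => ∫ u in (0 : ℝ)..t, k u
  have hF : ContinuousOn F (Icc 0 T) := by
    have := intervalIntegral.continuousOn_primitive_interval' hk left_mem_uIcc
    rwa [uIcc_of_le hT.le] at this
  have hki : ∀ {u v}, u ∈ Icc 0 T → v ∈ Icc 0 T → IntervalIntegrable k volume u v :=
    fun hu hv => hk.mono_set (by rw [uIcc_of_le hT.le]; exact uIcc_subset_Icc hu hv)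
  have hbound : ∀ s ∈ Icc 0 T, ∀ t ∈ Icc 0 T, W2 (μ s) (μ t) ^ 2 ≤
        3 * (F t - F s) ^ 2 + C * (t - s) ^ 2 + 3 * σ ^ 2 * |t - s| ^ (2 * H) := by
    have hle : ∀ s ∈ Icc 0 T, ∀ t ∈ Icc 0 T, s ≤ t → W2 (μ s) (μ t) ^ 2 ≤
        3 * (F t - F s) ^ 2 + C * (t - s) ^ 2 + 3 * σ ^ 2 * |t - s| ^ (2 * H) := by
      intro s hs t ht hst
      simp only [F]
      rw [intervalIntegral.integral_interval_sub_left (hki h0 ht) (hki h0 hs)]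
      exact hW s hs t ht hst
    intro s hs t ht
    rcases le_total s t with hst | hst
    · exact hle s hs t ht hst
    · have := hle t ht s hs hst
      rw [W2_comm, abs_sub_comm] at this
      linarith [sq_nonneg (F t - F s)]
  intro s hs
  rw [ContinuousWithinAt, tendsto_iff_dist_tendsto_zero]
  have hlim : Tendsto (fun t => 3 * (F t - F s) ^ 2 + C * (t - s) ^ 2 +
      3 * σ ^ 2 * |t - s| ^ (2 * H)) (𝓝[Icc 0 T] s) (𝓝 0) := by
    have hc : ContinuousWithinAt (fun t => 3 * (F t - F s) ^ 2 + C * (t - s) ^ 2 +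
        3 * σ ^ 2 * |t - s| ^ (2 * H)) (Icc 0 T) s := by
      have h1 := hF s hs
      have h2 : Continuous fun t : ℝ => |t - s| ^ (2 * H) :=
        Continuous.rpow_const (by fun_prop) fun _ => Or.inr (by positivity)
      have h3 := h2.continuousWithinAt (s := Icc 0 T) (x := s)
      fun_prop
    have := hc.tendsto
    simpa [Real.zero_rpow (show 2 * H ≠ 0 by positivity)] using this
  have hsq := hlim.sqrt
  rw [Real.sqrt_zero] at hsq
  refine squeeze_zero' (Eventually.of_forall fun _ => dist_nonneg) ?_ hsq
  filter_upwards [self_mem_nhdsWithin] with t ht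
  rw [dist_comm, dist_P2]
  exact Real.le_sqrt_of_sq_le (hbound s hs t ht)

end LawContinuity

/-! ### The frozen equation and the independent copies -/

/-- The drift with the measure argument frozen along a flow on `[0, T]`. -/
def frozenDrift {p : ℕ} (θ : Fin p → ℝ) (b : Fin p → ℝ → P2 → ℝ) {T : ℝ} (hT : 0 ≤ T)
    (μ : ℝ → P2) (t x : ℝ) : ℝ :=
  drift θ b x (μ (projIcc 0 T hT t))

section Frozen

variable {p : ℕ} {θ : Fin p → ℝ} {b : Fin p → ℝ → P2 → ℝ} {T : ℝ} {μ : ℝ → P2}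

lemma continuous_flow_projIcc (hT : 0 ≤ T) (hμ : ContinuousOn μ (Icc 0 T)) :
    Continuous fun t => μ (projIcc 0 T hT t) :=
  (continuousOn_iff_continuous_domRestrict.1 hμ).comp continuous_projIcc

lemma continuous_frozenDrift (hb : LipschitzDrift b) (hT : 0 ≤ T) (hμ : ContinuousOn μ (Icc 0 T)) :
    Continuous fun z : ℝ × ℝ => frozenDrift θ b hT μ z.1 z.2 :=
  (continuous_drift hb θ).comp
    (continuous_snd.prodMk ((continuous_flow_projIcc hT hμ).comp continuous_fst))

lemma abs_frozenDrift_sub_le {L : ℝ} (hdrift : ∀ (x y : ℝ) (μ ν : P2),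
      |drift θ b x μ - drift θ b y ν| ≤ L * (|x - y| + W2 μ ν)) (hT : 0 ≤ T) (t x y : ℝ) :
    |frozenDrift θ b hT μ t x - frozenDrift θ b hT μ t y| ≤ L * |x - y| := by
  have := hdrift x y (μ (projIcc 0 T hT t)) (μ (projIcc 0 T hT t))
  rwa [W2_self, add_zero] at this

end Frozen

section Laws

variable {Ω Ω' : Type*} [MeasurableSpace Ω] [MeasurableSpace Ω'] {P : Measure Ω} {P' : Measure Ω'}
  [IsProbabilityMeasure P] [IsProbabilityMeasure P'] {p : ℕ}
  {θ : Fin p → ℝ} {b : Fin p → ℝ → P2 → ℝ} {H T σ : ℝ} {μ₀ : Measure ℝ}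
  {B' X' : ℝ → Ω' → ℝ} {μ : ℝ → P2}

/-- The marginal laws of the McKean-Vlasov solution, through the solution map. -/
lemma IsMcKeanVlasov.map_solutionMap (h : IsMcKeanVlasov P' θ b H T σ μ₀ B' X' μ) (hT : 0 ≤ T)
    (hb : LipschitzDrift b) (hμ : ContinuousOn μ (Icc 0 T)) {t : ℝ} (ht : t ∈ Icc 0 T) :
    (μ₀.prod (P'.map fun ω (t : Icc (0 : ℝ) T) => B' t ω)).map
      (solutionMap hT σ (frozenDrift θ b hT μ) t) = (μ t).toMeasure := by
  obtain ⟨L, hL, hdrift⟩ := hb.exists_drift θ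
  obtain ⟨G, hGae, hGm, hG⟩ := h.exists_good_event
  have h0 : (0 : ℝ) ∈ Icc 0 T := left_mem_Icc.2 hT
  have hm0 := h.measurable 0 h0
  have hmB := h.fbm.measurable_path
  have hind := (indepFun_iff_map_prod_eq_prod_map_map hm0.aemeasurable hmB.aemeasurable).1 h.indep_init
  rw [h.law_init] at hind
  rw [← hind, Measure.map_map (measurable_solutionMap hT σ (continuous_frozenDrift hb hT hμ) t)
    (hm0.prodMk hmB), ← h.law t ht]
  refine Measure.map_congr ?_
  filter_upwards [hGae] with ω hω
  have hYc : Continuous fun t => continuousVersion hT G X' t ω :=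
    continuous_continuousVersion (fun ω hω => (hG ω hω).1.continuousOn) ω
  -- Along its own flow the McKean–Vlasov path solves the frozen equation.
  have h1 := eq_solutionMap hT hL.le (continuous_frozenDrift (θ := θ) hb hT hμ)
    (abs_frozenDrift_sub_le hdrift hT) (x := X' 0 ω) (w := fun t => B' t ω) (σ := σ) hYc
    (fun s hs => ?_) ht
  · rw [continuousVersion_eq hω ht] at h1
    exact h1.symm
  · rw [continuousVersion_eq hω hs, (hG ω hω).1.eq s hs]
    congr 2
    refine intervalIntegral.integral_congr fun u hu => ?_
    rw [uIcc_of_le hs.1] at hu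
    have hu' : u ∈ Icc 0 T := ⟨hu.1, hu.2.trans hs.2⟩
    simp only [frozenDrift, continuousVersion_eq hω hu', projIcc_of_mem hT hu']

variable {n : ℕ} {B X : Fin (n + 1) → ℝ → Ω → ℝ}

/-- The data of the particles are independent copies of those of the McKean-Vlasov equation. -/
lemma IsParticleSystem.map_data [IsProbabilityMeasure μ₀]
    (h : IsParticleSystem P θ b H T σ μ₀ n B X) (hT : 0 ≤ T)
    (hB' : IsFBM P' H T B') :
    P.map (fun ω i => (X i 0 ω, fun t : Icc (0 : ℝ) T => B i t ω)) =
      Measure.pi fun _ => μ₀.prod (P'.map fun ω (t : Icc (0 : ℝ) T) => B' t ω) := by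
  have h0 : (0 : ℝ) ∈ Icc 0 T := left_mem_Icc.2 hT
  have hm0 : Measurable fun ω i => X i 0 ω := measurable_pi_lambda _ fun i => h.measurable i 0 h0
  have hmB : Measurable fun ω i (t : Icc (0 : ℝ) T) => B i t ω :=
    measurable_pi_lambda _ fun i => (h.fbm i).measurable_path
  have : IsProbabilityMeasure (P'.map fun ω (t : Icc (0 : ℝ) T) => B' t ω) :=
    Measure.isProbabilityMeasure_map hB'.measurable_path.aemeasurable
  have hind := (indepFun_iff_map_prod_eq_prod_map_map hm0.aemeasurable hmB.aemeasurable).1 h.indep_init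
  have hnoise := (iIndepFun_iff_map_fun_eq_pi_map
    fun i => (h.fbm i).measurable_path.aemeasurable).1 h.indep_noise
  simp_rw [fun i => (h.fbm i).map_eq hB'] at hnoise
  rw [h.law_init, hnoise] at hind
  -- Independence of all initial values from all noises yields a pair of families; regrouping it as
  -- a family of pairs preserves the product measure.
  have hmp := measurePreserving_arrowProdEquivProdArrow ℝ (Icc (0 : ℝ) T → ℝ) (Fin (n + 1))
    (fun _ => μ₀) (fun _ => P'.map fun ω (t : Icc (0 : ℝ) T) => B' t ω)
  rw [← hmp.map_eq] at hind
  apply (MeasurableEquiv.arrowProdEquivProdArrow ℝ (Icc (0 : ℝ) T → ℝ)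
    (Fin (n + 1))).map_measurableEquiv_injective
  rw [← hind, Measure.map_map (MeasurableEquiv.measurable _)
    (measurable_pi_lambda _ fun i => (h.measurable i 0 h0).prodMk (h.fbm i).measurable_path)]
  rfl

/-- Independent copies of the McKean-Vlasov solution, driven by the data of the particles; the
particles are replaced by versions with continuous paths. -/
lemma IsParticleSystem.exists_coupling [IsProbabilityMeasure μ₀]
    (h : IsParticleSystem P θ b H T σ μ₀ n B X) (h' : IsMcKeanVlasov P' θ b H T σ μ₀ B' X' μ)
    (hT : 0 < T) (hb : LipschitzDrift b) (hμ : ContinuousOn μ (Icc 0 T)) :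
    ∃ Y : Fin (n + 1) → ℝ → Ω → ℝ, (∀ i ω, Continuous fun t => Y i t ω) ∧
      (∀ i t, Measurable (Y i t)) ∧
      (∀ᵐ ω ∂P, ∀ i, ∀ t ∈ Icc 0 T, Y i t ω = X i 0 ω +
        (∫ s in (0 : ℝ)..t, frozenDrift θ b hT.le μ s (Y i s ω)) + σ * B i t ω) ∧
      ∀ t ∈ Icc 0 T, P.map (fun ω i => Y i t ω) = Measure.pi fun _ => (μ t).toMeasure := by
  obtain ⟨L, hL, hdrift⟩ := hb.exists_drift θ
  have hf := continuous_frozenDrift (θ := θ) hb hT.le hμ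
  have hLip := abs_frozenDrift_sub_le (μ := μ) hdrift hT.le
  have h0 : (0 : ℝ) ∈ Icc 0 T := left_mem_Icc.2 hT.le
  obtain ⟨G, hGae, hGm, hG⟩ :=
    (ae_all_iff.2 fun i => (h.fbm i).continuous).exists_measurable_mem
  set Φ := solutionMap hT.le σ (frozenDrift θ b hT.le μ)
  have hΦm : ∀ t, Measurable (Φ t) := fun t => measurable_solutionMap hT.le σ hf t
  set V : Fin (n + 1) → ℝ → Ω → ℝ := fun i t ω => Φ t (X i 0 ω, fun t => B i t ω)
  have hVm : ∀ i t, Measurable (V i t) := fun i t =>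
    (hΦm t).comp ((h.measurable i 0 h0).prodMk (h.fbm i).measurable_path)
  -- Measurability in `ω` comes from `solutionMap`; continuity in time comes from the solution with
  -- which it agrees.
  have hV : ∀ ω ∈ G, ∀ i, ∃ z : ℝ → ℝ, Continuous z ∧ (∀ t ∈ Icc 0 T, z t = V i t ω) ∧
      ∀ t ∈ Icc 0 T, z t = X i 0 ω + (∫ s in (0 : ℝ)..t, frozenDrift θ b hT.le μ s (z s)) +
        σ * B i t ω := by
    intro ω hω i
    have hw : Continuous fun t => σ * B i (projIcc 0 T hT.le t) ω :=
      continuous_const.mul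
        ((continuousOn_iff_continuous_domRestrict.1 (hG ω hω i)).comp continuous_projIcc)
    obtain ⟨z, hz, hzeq⟩ := exists_solution hT hL.le hf hLip (X i 0 ω) hw
    have hzeq' : ∀ t ∈ Icc 0 T, z t = X i 0 ω +
        (∫ s in (0 : ℝ)..t, frozenDrift θ b hT.le μ s (z s)) + σ * B i t ω := by
      intro t ht
      have := hzeq t ht
      rwa [projIcc_of_mem hT.le ht] at this
    exact ⟨z, hz, fun t ht => eq_solutionMap hT.le hL.le hf hLip hz hzeq' ht, hzeq'⟩
  refine ⟨fun i => continuousVersion hT.le G (V i), fun i => ?_, fun i => ?_, ?_, fun t ht => ?_⟩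
  · refine continuous_continuousVersion fun ω hω => ?_
    obtain ⟨z, hz, hzV, -⟩ := hV ω hω i
    exact hz.continuousOn.congr fun t ht => (hzV t ht).symm
  · exact measurable_continuousVersion hGm fun t _ => hVm i t
  · filter_upwards [hGae] with ω hω i t ht
    obtain ⟨z, hz, hzV, hzeq⟩ := hV ω hω i
    rw [continuousVersion_eq hω ht, ← hzV t ht, hzeq t ht]
    congr 2
    refine intervalIntegral.integral_congr fun u hu => ?_
    rw [uIcc_of_le ht.1] at hu
    have hu' : u ∈ Icc 0 T := ⟨hu.1, hu.2.trans ht.2⟩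
    simp only [continuousVersion_eq hω hu', hzV u hu']
  · have h1 : P.map (fun ω i => continuousVersion hT.le G (V i) t ω) =
        P.map (fun ω i => V i t ω) := by
      refine Measure.map_congr ?_
      filter_upwards [hGae] with ω hω
      ext i
      exact continuousVersion_eq hω ht
    have h2 : (fun ω i => V i t ω) = (fun (q : Fin (n + 1) → ℝ × (Icc (0 : ℝ) T → ℝ)) i => Φ t (q i)) ∘
        fun ω i => (X i 0 ω, fun t : Icc (0 : ℝ) T => B i t ω) := rfl
    have : IsProbabilityMeasure (P'.map fun ω (t : Icc (0 : ℝ) T) => B' t ω) :=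
      Measure.isProbabilityMeasure_map h'.fbm.measurable_path.aemeasurable
    have h3 := h'.map_solutionMap hT.le hb hμ ht
    have : IsProbabilityMeasure ((μ₀.prod (P'.map fun ω (t : Icc (0 : ℝ) T) => B' t ω)).map (Φ t)) :=
      Measure.isProbabilityMeasure_map (hΦm t).aemeasurable
    have hm1 : Measurable fun (q : Fin (n + 1) → ℝ × (Icc (0 : ℝ) T → ℝ)) i => Φ t (q i) :=
      measurable_pi_lambda _ fun i => (hΦm t).comp (measurable_pi_apply i)
    have hm2 : Measurable fun ω i => (X i 0 ω, fun t : Icc (0 : ℝ) T => B i t ω) :=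
      measurable_pi_lambda _ fun i => (h.measurable i 0 h0).prodMk (h.fbm i).measurable_path
    -- Each copy is the same functional `Φ t` of its own data, so a product law is pushed to a
    -- product law.
    rw [h1, h2, ← Measure.map_map hm1 hm2,
      h.map_data hT.le h'.fbm, Measure.pi_map_pi (fun _ => (hΦm t).aemeasurable)]
    simp_rw [Φ, h3]

end Laws

/-! ### Pathwise comparison of particles and copies -/

section Comparison

variable {p : ℕ} {θ : Fin p → ℝ} {b : Fin p → ℝ → P2 → ℝ} {T L : ℝ} {n : ℕ}

lemma continuous_W2_comp {α : Type*} [TopologicalSpace α] {f g : α → P2} (hf : Continuous f)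
    (hg : Continuous g) : Continuous fun a => W2 (f a) (g a) :=
  hf.dist hg

lemma continuous_empirical_comp {α : Type*} [TopologicalSpace α] {x : α → Fin (n + 1) → ℝ}
    (hx : Continuous x) : Continuous fun a => empirical (x a) :=
  continuous_empirical.comp hx

/-- Pathwise comparison of the interacting particles with the independent copies. -/
lemma norm_sub_le_of_coupled (hT : 0 ≤ T) (hL : 0 ≤ L) (hb : LipschitzDrift b)
    (hdrift : ∀ (x y : ℝ) (μ ν : P2),
      |drift θ b x μ - drift θ b y ν| ≤ L * (|x - y| + W2 μ ν))
    {x y : ℝ → Fin (n + 1) → ℝ} {ν : ℝ → P2} (hx : Continuous x) (hy : Continuous y)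
    (hν : Continuous ν) (c : Fin (n + 1) → ℝ) (w : ℝ → Fin (n + 1) → ℝ)
    (hxeq : ∀ t ∈ Icc 0 T, ∀ i, x t i =
      c i + (∫ s in (0 : ℝ)..t, drift θ b (x s i) (empirical (x s))) + w t i)
    (hyeq : ∀ t ∈ Icc 0 T, ∀ i, y t i =
      c i + (∫ s in (0 : ℝ)..t, drift θ b (y s i) (ν s)) + w t i) {t : ℝ} (ht : t ∈ Icc 0 T) :
    ‖x t - y t‖ ≤ (L + 2 * L * Real.exp (2 * L * T) * (T * L)) *
      ∫ s in (0 : ℝ)..T, W2 (empirical (y s)) (ν s) := by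
  have hρ : Continuous fun s => W2 (empirical (y s)) (ν s) :=
    continuous_W2_comp (continuous_empirical_comp hy) hν
  have hφ : Continuous fun s => ‖x s - y s‖ := (hx.sub hy).norm
  have hd := continuous_drift hb θ
  set R := ∫ s in (0 : ℝ)..T, W2 (empirical (y s)) (ν s)
  have hR : 0 ≤ R := intervalIntegral.integral_nonneg hT fun s _ => W2_nonneg _ _
  have key : ∀ t ∈ Icc 0 T, ‖x t - y t‖ ≤ L * R + 2 * L * ∫ s in (0 : ℝ)..t, ‖x s - y s‖ := by
    intro t ht
    have hI : 0 ≤ ∫ s in (0 : ℝ)..t, ‖x s - y s‖ :=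
      intervalIntegral.integral_nonneg ht.1 fun s _ => norm_nonneg _
    refine (pi_norm_le_iff_of_nonneg (by positivity)).2 fun i => ?_
    have hxi : Continuous fun s => drift θ b (x s i) (empirical (x s)) :=
      hd.comp (((continuous_apply i).comp hx).prodMk (continuous_empirical_comp hx))
    have hyi : Continuous fun s => drift θ b (y s i) (ν s) :=
      hd.comp (((continuous_apply i).comp hy).prodMk hν)
    have h1 : x t i - y t i =
        ∫ s in (0 : ℝ)..t, (drift θ b (x s i) (empirical (x s)) - drift θ b (y s i) (ν s)) := by
      rw [intervalIntegral.integral_sub (hxi.intervalIntegrable _ _) (hyi.intervalIntegrable _ _),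
        hxeq t ht i, hyeq t ht i]
      ring
    -- One `L` comes from the positions, the other from the distance of the two empirical measures,
    -- itself at most the sup norm.
    have hpt : ∀ s, |drift θ b (x s i) (empirical (x s)) - drift θ b (y s i) (ν s)| ≤
        2 * L * ‖x s - y s‖ + L * W2 (empirical (y s)) (ν s) := by
      intro s
      have e1 := hdrift (x s i) (y s i) (empirical (x s)) (ν s)
      have e2 := W2_triangle (empirical (x s)) (empirical (y s)) (ν s)
      have e3 := W2_empirical_le (x s) (y s)
      have e4 : |x s i - y s i| ≤ ‖x s - y s‖ := norm_le_pi_norm (x s - y s) i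
      have e5 : L * (|x s i - y s i| + W2 (empirical (x s)) (ν s)) ≤
        L * (‖x s - y s‖ + (‖x s - y s‖ + W2 (empirical (y s)) (ν s))) := by gcongr; linarith
      linarith
    rw [Pi.sub_apply, Real.norm_eq_abs, h1]
    have hρt : ∫ s in (0 : ℝ)..t, W2 (empirical (y s)) (ν s) ≤ R :=
      intervalIntegral.integral_mono_interval le_rfl ht.1 ht.2 (ae_of_all _ fun s => W2_nonneg _ _)
        (hρ.intervalIntegrable _ _)
    calc _ ≤ ∫ s in (0 : ℝ)..t,
          |drift θ b (x s i) (empirical (x s)) - drift θ b (y s i) (ν s)| :=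
          intervalIntegral.abs_integral_le_integral_abs ht.1
      _ ≤ ∫ s in (0 : ℝ)..t, (2 * L * ‖x s - y s‖ + L * W2 (empirical (y s)) (ν s)) :=
          intervalIntegral.integral_mono_on ht.1 ((hxi.sub hyi).abs.intervalIntegrable _ _)
            (((hφ.const_mul _).add (hρ.const_mul _)).intervalIntegrable _ _) fun s _ => hpt s
      _ = 2 * L * (∫ s in (0 : ℝ)..t, ‖x s - y s‖) +
            L * ∫ s in (0 : ℝ)..t, W2 (empirical (y s)) (ν s) := by
          rw [intervalIntegral.integral_add ((hφ.const_mul _).intervalIntegrable _ _)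
            ((hρ.const_mul _).intervalIntegrable _ _), intervalIntegral.integral_const_mul,
            intervalIntegral.integral_const_mul]
      _ ≤ _ := by
          have := mul_le_mul_of_nonneg_left hρt hL
          linarith
  have h := gronwall_integral (T := T) (L := 2 * L) (by positivity) hφ
    (continuous_const (y := L * R)) (fun _ => by positivity) key ht
  refine h.trans_eq ?_
  simp only [intervalIntegral.integral_const, sub_zero, smul_eq_mul]
  ring

/-- Pathwise bound for the time integral of the difference of the means, on the event that the
independent copies have empirical measures close to their law. -/
lemma exists_pathwise_bound (hT : 0 ≤ T) {g : ℝ → P2 → ℝ} (κ : ℝ) {C K : ℝ} (hC : 0 ≤ C) {q : ℕ}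
    (hmean : ∀ (μ ν : P2), Integrable (fun x : ℝ => |x| ^ (2 * q)) μ.toMeasure →
      Integrable (fun x : ℝ => |x| ^ (2 * q)) ν.toMeasure → ∀ lam > 0,
      |∫ x, g x μ ∂μ.toMeasure - ∫ x, g x ν ∂ν.toMeasure| ≤ C * (W2 μ ν ^ 2 / lam +
        lam * (1 + ∫ z, |z| ^ (2 * q) ∂μ.toMeasure + ∫ z, |z| ^ (2 * q) ∂ν.toMeasure)))
    {ν : ℝ → P2} (hν : Continuous ν)
    (hνK : ∀ t, Integrable (fun x : ℝ => |x| ^ (2 * q)) (ν t).toMeasure ∧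
      ∫ x, |x| ^ (2 * q) ∂(ν t).toMeasure ≤ K) :
    ∃ C₁ > 0, ∀ (n : ℕ) (x y : ℝ → Fin (n + 1) → ℝ), Continuous y →
      IntervalIntegrable (fun s => ∫ z, g z (empirical (x s)) ∂(empirical (x s)).toMeasure) volume 0 T →
      IntervalIntegrable (fun s => ∫ z, g z (ν s) ∂(ν s).toMeasure) volume 0 T →
      (∀ t ∈ Icc 0 T, ‖x t - y t‖ ≤ κ * ∫ s in (0 : ℝ)..T, W2 (empirical (y s)) (ν s)) →
      (∫ s in (0 : ℝ)..T, W2 (empirical (y s)) (ν s) ^ 2) ≤ 1 → ∀ lam > 0,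
      |(∫ s in (0 : ℝ)..T, ∫ z, g z (empirical (x s)) ∂(empirical (x s)).toMeasure) -
        ∫ s in (0 : ℝ)..T, ∫ z, g z (ν s) ∂(ν s).toMeasure| ≤
      C₁ * ((∫ s in (0 : ℝ)..T, W2 (empirical (y s)) (ν s) ^ 2) / lam +
        lam * (1 + ∫ s in (0 : ℝ)..T, ∫ z, |z| ^ (2 * q) ∂(empirical (y s)).toMeasure)) := by
  have hK : 0 ≤ K := (integral_nonneg fun x => by positivity).trans (hνK 0).2
  -- The integral over `[0, T]` of the part of the `lam` term that does not involve the copies.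
  set C₂ := T + 2 ^ (2 * q) * (T * (κ ^ 2 * T) ^ q) + T * K
  have hC₂ : 0 ≤ C₂ := by positivity
  refine ⟨C * (2 * κ ^ 2 * T * T + 2 + C₂ + 2 ^ (2 * q)) + 1, by positivity,
    fun n x y hy hxi hνi hxy hS lam hlam => ?_⟩
  have hρ : Continuous fun s => W2 (empirical (y s)) (ν s) :=
    continuous_W2_comp (continuous_empirical_comp hy) hν
  set R := ∫ s in (0 : ℝ)..T, W2 (empirical (y s)) (ν s)
  set S := ∫ s in (0 : ℝ)..T, W2 (empirical (y s)) (ν s) ^ 2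
  set Q := ∫ s in (0 : ℝ)..T, ∫ z, |z| ^ (2 * q) ∂(empirical (y s)).toMeasure
  have hS0 : 0 ≤ S := intervalIntegral.integral_nonneg hT fun s _ => by positivity
  have hQ0 : 0 ≤ Q := intervalIntegral.integral_nonneg hT fun s _ =>
    integral_nonneg fun z => by positivity
  have hR0 : 0 ≤ R := intervalIntegral.integral_nonneg hT fun s _ => W2_nonneg _ _
  have hRS : R ^ 2 ≤ T * S := by
    have := pow_intervalIntegral_le hρ (fun s => W2_nonneg _ _) hT 1
    simpa using this
  have hMc : Continuous fun s => ∫ z, |z| ^ (2 * q) ∂(empirical (y s)).toMeasure := by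
    simp_rw [integral_empirical]
    fun_prop
  set D : ℝ → ℝ := fun s => C * ((2 * (κ ^ 2 * (T * S)) + 2 * W2 (empirical (y s)) (ν s) ^ 2) / lam +
    lam * (1 + 2 ^ (2 * q) * ((∫ z, |z| ^ (2 * q) ∂(empirical (y s)).toMeasure) +
      (κ ^ 2 * T) ^ q) + K))
  have hpt : ∀ s ∈ Icc 0 T, |(∫ z, g z (empirical (x s)) ∂(empirical (x s)).toMeasure) -
      ∫ z, g z (ν s) ∂(ν s).toMeasure| ≤ D s := by
    intro s hs
    refine (hmean _ _ (integrable_empirical _ _) (hνK s).1 lam hlam).trans ?_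
    have hd := hxy s hs
    have hd2 : ‖x s - y s‖ ^ 2 ≤ κ ^ 2 * (T * S) := by
      have := pow_le_pow_left₀ (norm_nonneg _) hd 2
      rw [mul_pow] at this
      exact this.trans (by gcongr)
    have hW : W2 (empirical (x s)) (ν s) ^ 2 ≤
        2 * (κ ^ 2 * (T * S)) + 2 * W2 (empirical (y s)) (ν s) ^ 2 := by
      have e2 := W2_triangle (empirical (x s)) (empirical (y s)) (ν s)
      have e3 := W2_empirical_le (x s) (y s)
      have e4 := pow_le_pow_left₀ (W2_nonneg _ _) (e2.trans (add_le_add_left e3 _)) 2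
      have e5 := add_sq_le (a := ‖x s - y s‖) (b := W2 (empirical (y s)) (ν s))
      linarith
    have hM : ∫ z, |z| ^ (2 * q) ∂(empirical (x s)).toMeasure ≤
        2 ^ (2 * q) * ((∫ z, |z| ^ (2 * q) ∂(empirical (y s)).toMeasure) + (κ ^ 2 * T) ^ q) := by
      have hi : ∀ i, |x s i| ^ (2 * q) ≤ 2 ^ (2 * q) * (|y s i| ^ (2 * q) + (κ ^ 2 * T) ^ q) := by
        intro i
        have e1 : |x s i - y s i| ≤ ‖x s - y s‖ := norm_le_pi_norm (x s - y s) i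
        have e2 : |x s i| ≤ |y s i| + ‖x s - y s‖ := by
          have := abs_sub_abs_le_abs_sub (x s i) (y s i)
          linarith
        -- The hypothesis that `S` is at most `1` is used here: it bounds the displacement, so
        -- moments of `x` reduce to those of `y`.
        have e3 : ‖x s - y s‖ ^ (2 * q) ≤ (κ ^ 2 * T) ^ q := by
          rw [pow_mul]
          refine pow_le_pow_left₀ (by positivity) (hd2.trans ?_) q
          have : T * S ≤ T * 1 := by gcongr
          rw [mul_one] at this
          gcongr
        calc |x s i| ^ (2 * q) ≤ (|y s i| + ‖x s - y s‖) ^ (2 * q) := by gcongr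
          _ ≤ 2 ^ (2 * q - 1) * (|y s i| ^ (2 * q) + ‖x s - y s‖ ^ (2 * q)) :=
              add_pow_le (by positivity) (by positivity) _
          _ ≤ _ := by
              gcongr
              · norm_num
              · omega
      rw [integral_empirical, integral_empirical]
      calc (1 / ((n : ℝ) + 1)) * ∑ i, |x s i| ^ (2 * q)
          ≤ (1 / ((n : ℝ) + 1)) * ∑ i, 2 ^ (2 * q) * (|y s i| ^ (2 * q) + (κ ^ 2 * T) ^ q) := by
            gcongr with i
            exact hi i
        _ = _ := by
            rw [← Finset.mul_sum, Finset.sum_add_distrib]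
            simp
            field_simp
    simp only [D]
    have := (hνK s).2
    gcongr
  have hDc : Continuous D := by
    simp only [D]
    fun_prop
  have hint : ∫ s in (0 : ℝ)..T, D s = C * ((2 * κ ^ 2 * T * T + 2) * (S / lam) +
      lam * (C₂ + 2 ^ (2 * q) * Q)) := by
    have hρ2 : IntervalIntegrable (fun s => W2 (empirical (y s)) (ν s) ^ 2) volume 0 T :=
      (hρ.pow 2).intervalIntegrable 0 T
    have hM2 := hMc.intervalIntegrable (μ := volume) 0 T
    have hD : D = fun s => C * (2 * (κ ^ 2 * (T * S)) / lam +
        lam * (1 + 2 ^ (2 * q) * (κ ^ 2 * T) ^ q + K)) +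
        (C * 2 / lam * W2 (empirical (y s)) (ν s) ^ 2 +
          C * lam * 2 ^ (2 * q) * ∫ z, |z| ^ (2 * q) ∂(empirical (y s)).toMeasure) := by
      ext s
      simp only [D]
      ring
    rw [hD, intervalIntegral.integral_add (by simp)
      ((hρ2.const_mul _).add (hM2.const_mul _)), intervalIntegral.integral_add (hρ2.const_mul _)
      (hM2.const_mul _), intervalIntegral.integral_const_mul, intervalIntegral.integral_const_mul,
      intervalIntegral.integral_const, intervalIntegral.integral_const_mul]
    change C * ((T - 0) * _) + (C * 2 / lam * S + C * lam * 2 ^ (2 * q) * Q) = _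
    simp only [C₂]
    ring
  rw [← intervalIntegral.integral_sub hxi hνi]
  calc _ ≤ ∫ s in (0 : ℝ)..T, |(∫ z, g z (empirical (x s)) ∂(empirical (x s)).toMeasure) -
        ∫ z, g z (ν s) ∂(ν s).toMeasure| := intervalIntegral.abs_integral_le_integral_abs hT
    _ ≤ ∫ s in (0 : ℝ)..T, D s := intervalIntegral.integral_mono_on hT (hxi.sub hνi).abs
        (hDc.intervalIntegrable _ _) hpt
    _ = C * ((2 * κ ^ 2 * T * T + 2) * (S / lam) + lam * (C₂ + 2 ^ (2 * q) * Q)) := hint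
    _ ≤ C * ((2 * κ ^ 2 * T * T + 2 + C₂ + 2 ^ (2 * q)) * (S / lam + lam * (1 + Q))) := by
        have h1 : 0 ≤ S / lam := by positivity
        have h2 : 0 ≤ lam * Q := by positivity
        have h3 : (0 : ℝ) ≤ 2 ^ (2 * q) := by positivity
        have h4 : 0 ≤ 2 * κ ^ 2 * T * T := by positivity
        refine mul_le_mul_of_nonneg_left ?_ hC
        have h5 : (2 * κ ^ 2 * T * T + 2 + C₂ + 2 ^ (2 * q)) * (S / lam + lam * (1 + Q)) =
          (2 * κ ^ 2 * T * T + 2) * (S / lam) + lam * (C₂ + 2 ^ (2 * q) * Q) +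
          ((C₂ + 2 ^ (2 * q)) * (S / lam) + (2 * κ ^ 2 * T * T + 2) * lam +
            (2 * κ ^ 2 * T * T + 2) * (lam * Q) + C₂ * (lam * Q) + 2 ^ (2 * q) * lam) := by ring
        rw [h5]
        have : 0 ≤ (C₂ + 2 ^ (2 * q)) * (S / lam) + (2 * κ ^ 2 * T * T + 2) * lam +
            (2 * κ ^ 2 * T * T + 2) * (lam * Q) + C₂ * (lam * Q) + 2 ^ (2 * q) * lam := by positivity
        linarith
    _ ≤ _ := by
        have : 0 ≤ S / lam + lam * (1 + Q) := by positivity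
        rw [← mul_assoc, add_mul _ 1]
        linarith

end Comparison

/-! ### Probabilistic estimates for the copies -/

/-- Markov's inequality for a time integral. -/
lemma meas_ge_intervalIntegral_le {Ω : Type*} [MeasurableSpace Ω] {P : Measure Ω} [SFinite P]
    {a : ℝ → Ω → ℝ} (hac : ∀ ω, Continuous fun t => a t ω) (ham : ∀ t, Measurable (a t))
    (ha0 : ∀ t ω, 0 ≤ a t ω) {T K c : ℝ} (hT : 0 ≤ T) (hc : 0 < c)
    (hK : ∀ u ∈ Icc 0 T, ∫⁻ ω, ENNReal.ofReal (a u ω) ∂P ≤ ENNReal.ofReal K) :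
    P {ω | c ≤ ∫ u in (0 : ℝ)..T, a u ω} ≤ ENNReal.ofReal (K * T / c) := by
  have hm : Measurable (Function.uncurry a) := measurable_uncurry_of_continuous_of_measurable hac ham
  have hI : Measurable fun ω => ∫ u in (0 : ℝ)..T, a u ω := by
    simp_rw [intervalIntegral.integral_of_le hT]
    exact hm.stronglyMeasurable.integral_prod_left'.measurable
  have h1 := meas_ge_le_lintegral_div (μ := P) hI.ennreal_ofReal.aemeasurable
    (ε := ENNReal.ofReal c) (by simpa using hc) ENNReal.ofReal_ne_top
  have h2 := lintegral_intervalIntegral_le hac ham ha0 hT hK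
  rw [sub_zero] at h2
  rw [ENNReal.ofReal_div_of_pos hc]
  refine (measure_mono fun ω hω => ?_).trans (h1.trans (ENNReal.div_le_div_right h2 _))
  exact ENNReal.ofReal_le_ofReal hω

/-- With moments bounded along the flow, `lam` is fixed so that the moment term costs at most `ε /
2`; then the Wasserstein term tends to zero. -/
lemma continuous_mean {g : ℝ → P2 → ℝ} {C K : ℝ} (hC : 0 ≤ C) {q : ℕ}
    (hmean : ∀ (μ ν : P2), Integrable (fun x : ℝ => |x| ^ (2 * q)) μ.toMeasure →
      Integrable (fun x : ℝ => |x| ^ (2 * q)) ν.toMeasure → ∀ lam > 0,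
      |∫ x, g x μ ∂μ.toMeasure - ∫ x, g x ν ∂ν.toMeasure| ≤ C * (W2 μ ν ^ 2 / lam +
        lam * (1 + ∫ z, |z| ^ (2 * q) ∂μ.toMeasure + ∫ z, |z| ^ (2 * q) ∂ν.toMeasure)))
    {ν : ℝ → P2} (hν : Continuous ν)
    (hνK : ∀ t, Integrable (fun x : ℝ => |x| ^ (2 * q)) (ν t).toMeasure ∧
      ∫ x, |x| ^ (2 * q) ∂(ν t).toMeasure ≤ K) :
    Continuous fun s => ∫ z, g z (ν s) ∂(ν s).toMeasure := by
  have hK : 0 ≤ K := (integral_nonneg fun x => by positivity).trans (hνK 0).2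
  refine Metric.continuous_iff'.2 fun s ε hε => ?_
  set lam := ε / (2 * (C + 1) * (1 + 2 * K))
  have hlam : 0 < lam := by positivity
  have hW : Tendsto (fun t => C * (W2 (ν t) (ν s) ^ 2 / lam)) (𝓝 s) (𝓝 0) := by
    have hc : Continuous fun t => C * (W2 (ν t) (ν s) ^ 2 / lam) :=
      (((continuous_W2_comp hν continuous_const).pow 2).div_const lam).const_mul C
    have := hc.tendsto s
    simpa [W2_self] using this
  filter_upwards [hW.eventually_lt_const (half_pos hε)] with t ht
  rw [Real.dist_eq]
  refine (hmean _ _ (hνK t).1 (hνK s).1 lam hlam).trans_lt ?_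
  have h1 : C * (lam * (1 + ∫ z, |z| ^ (2 * q) ∂(ν t).toMeasure +
      ∫ z, |z| ^ (2 * q) ∂(ν s).toMeasure)) ≤ (C + 1) * (lam * (1 + 2 * K)) := by
    have e1 := (hνK t).2
    have e2 := (hνK s).2
    calc _ ≤ C * (lam * (1 + 2 * K)) := by gcongr C * (lam * ?_); linarith
      _ ≤ _ := by gcongr; linarith
  have h2 : (C + 1) * (lam * (1 + 2 * K)) = ε / 2 := by
    simp only [lam]
    field_simp
  rw [mul_add]
  linarith

section Coupling

variable {Ω : Type*} [MeasurableSpace Ω] {P : Measure Ω} {n : ℕ}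

lemma lintegral_W2_empirical_le_of_law {Y : Ω → Fin (n + 1) → ℝ} (hY : Measurable Y) {ν : P2}
    (hlaw : P.map Y = Measure.pi fun _ => ν.toMeasure) {ε : ℝ}
    (hε : ∫⁻ y : Fin (n + 1) → ℝ, ENNReal.ofReal (W2 (empirical y) ν ^ 2)
      ∂(Measure.pi fun _ => ν.toMeasure) ≤ ENNReal.ofReal ε) :
    ∫⁻ ω, ENNReal.ofReal (W2 (empirical (Y ω)) ν ^ 2) ∂P ≤ ENNReal.ofReal ε := by
  have hm : Measurable fun y : Fin (n + 1) → ℝ => ENNReal.ofReal (W2 (empirical y) ν ^ 2) :=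
    ((continuous_W2_comp continuous_empirical continuous_const).pow 2).measurable.ennreal_ofReal
  rwa [← hlaw, lintegral_map hm hY] at hε

/-- An empirical mean of identically distributed variables has the expectation of a single one. -/
lemma lintegral_integral_empirical_le_of_law {Y : Ω → Fin (n + 1) → ℝ} (hY : Measurable Y) {ν : P2}
    (hlaw : P.map Y = Measure.pi fun _ => ν.toMeasure) {f : ℝ → ℝ} (hf : Continuous f)
    (hf0 : ∀ x, 0 ≤ f x) (hfi : Integrable f ν.toMeasure) {K : ℝ}
    (hK : ∫ x, f x ∂ν.toMeasure ≤ K) :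
    ∫⁻ ω, ENNReal.ofReal (∫ z, f z ∂(empirical (Y ω)).toMeasure) ∂P ≤ ENNReal.ofReal K := by
  simp_rw [integral_empirical]
  have hm : Continuous fun y : Fin (n + 1) → ℝ => (1 / ((n : ℝ) + 1)) * ∑ i, f (y i) := by
    fun_prop
  have hi : ∀ i, Integrable (fun y : Fin (n + 1) → ℝ => f (y i))
      (Measure.pi fun _ => ν.toMeasure) := fun i => integrable_comp_eval hfi
  rw [← lintegral_map (f := fun y => ENNReal.ofReal ((1 / ((n : ℝ) + 1)) * ∑ i, f (y i)))
    hm.measurable.ennreal_ofReal hY, hlaw, ← ofReal_integral_eq_lintegral_ofReal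
    ((integrable_finsetSum _ fun i _ => hi i).const_mul _)
    (ae_of_all _ fun y => mul_nonneg (by positivity) (Finset.sum_nonneg fun i _ => hf0 _))]
  refine ENNReal.ofReal_le_ofReal ?_
  rw [integral_const_mul, integral_finsetSum _ fun i _ => hi i]
  simp_rw [integral_comp_eval (μ := fun _ : Fin (n + 1) => ν.toMeasure) hf.aestronglyMeasurable]
  simp only [Finset.sum_const, Finset.card_univ, Fintype.card_fin, nsmul_eq_mul]
  push_cast
  rw [← mul_assoc, one_div, inv_mul_cancel₀ (by positivity), one_mul]
  exact hK

variable {Ω' : Type*} [MeasurableSpace Ω'] {P' : Measure Ω'}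
  [IsProbabilityMeasure P] [IsProbabilityMeasure P'] {p : ℕ}
  {θ : Fin p → ℝ} {b : Fin p → ℝ → P2 → ℝ} {H T σ L : ℝ} {μ₀ : Measure ℝ}
  {B' X' : ℝ → Ω' → ℝ} {μ : ℝ → P2} {B X : Fin (n + 1) → ℝ → Ω → ℝ}

/-- The paths of the particles, extended by constants to all times, are continuous. -/
lemma continuous_projIcc_paths {f w : Fin (n + 1) → ℝ → ℝ} {x : Fin (n + 1) → ℝ → ℝ} (hT : 0 ≤ T)
    (hx : ∀ i, SolvesOn T σ (f i) (w i) (x i)) :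
    Continuous fun t i => x i (projIcc 0 T hT t) :=
  continuous_pi fun i =>
    (continuousOn_iff_continuous_domRestrict.1 (hx i).continuousOn).comp continuous_projIcc

/-- Propagation of chaos: the particles are close to independent copies of the McKean-Vlasov
solution, when the empirical measure of the latter is close to its law. -/
lemma IsParticleSystem.exists_close_coupling [IsProbabilityMeasure μ₀]
    (h : IsParticleSystem P θ b H T σ μ₀ n B X) (h' : IsMcKeanVlasov P' θ b H T σ μ₀ B' X' μ)
    (hT : 0 < T) (hb : LipschitzDrift b) (hμ : ContinuousOn μ (Icc 0 T)) (hL : 0 ≤ L)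
    (hdrift : ∀ (x y : ℝ) (μ ν : P2),
      |drift θ b x μ - drift θ b y ν| ≤ L * (|x - y| + W2 μ ν)) :
    ∃ Y : ℝ → Ω → Fin (n + 1) → ℝ, (∀ ω, Continuous fun t => Y t ω) ∧ (∀ t, Measurable (Y t)) ∧
      (∀ᵐ ω ∂P, ∀ t ∈ Icc 0 T, ‖(fun i => X i (projIcc 0 T hT.le t) ω) - Y t ω‖ ≤
        (L + 2 * L * Real.exp (2 * L * T) * (T * L)) *
          ∫ s in (0 : ℝ)..T, W2 (empirical (Y s ω)) (μ (projIcc 0 T hT.le s))) ∧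
      ∀ t ∈ Icc 0 T, P.map (Y t) = Measure.pi fun _ => (μ t).toMeasure := by
  obtain ⟨Y, hYc, hYm, hYeq, hYlaw⟩ := h.exists_coupling h' hT hb hμ
  refine ⟨fun t ω i => Y i t ω, fun ω => continuous_pi fun i => hYc i ω,
    fun t => measurable_pi_lambda _ fun i => hYm i t, ?_, hYlaw⟩
  filter_upwards [hYeq, h.eq] with ω hY hX t ht
  refine norm_sub_le_of_coupled (x := fun t i => X i (projIcc 0 T hT.le t) ω)
    (y := fun t i => Y i t ω) (ν := fun s => μ (projIcc 0 T hT.le s)) hT.le hL hb hdrift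
    (continuous_projIcc_paths hT.le hX)
    (continuous_pi fun i => hYc i ω) (continuous_flow_projIcc hT.le hμ)
    (fun i => X i 0 ω) (fun t i => σ * B i t ω) (fun t ht i => ?_) (fun t ht i => hY i t ht) ht
  rw [projIcc_of_mem hT.le ht]
  refine ((hX i).eq t ht).trans ?_
  congr 2
  refine intervalIntegral.integral_congr fun u hu => ?_
  rw [uIcc_of_le ht.1] at hu
  simp only [projIcc_of_mem hT.le (⟨hu.1, hu.2.trans ht.2⟩ : u ∈ Icc 0 T)]

end Coupling

end FracMeanField

end

/-! ### Convergence in probability -/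

open FracMeanField in
theorem mainTheorem10 {p : ℕ} (θ : Fin p → ℝ) (b : Fin p → ℝ → P2 → ℝ)
    (H T σ : ℝ) (hH : H ∈ Ioo (0 : ℝ) 1) (hT : 0 < T) (hσ : 0 < σ)
    (μ₀ : Measure ℝ) [IsProbabilityMeasure μ₀]
    (hb : LipschitzDrift b)
    (hμ₀ : ∀ k : ℕ, 1 ≤ k → Integrable (fun x : ℝ => |x| ^ k) μ₀)
    (g : ℝ → P2 → ℝ) (hg : LocLipschitz g)
    -- the particle systems: the `n`-th one has `N = n + 1` particles
    {Ω : ℕ → Type*} [∀ n, MeasurableSpace (Ω n)] (P : ∀ n, Measure (Ω n))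
    [∀ n, IsProbabilityMeasure (P n)]
    (B X : ∀ n, Fin (n + 1) → ℝ → Ω n → ℝ)
    (hX : ∀ n, IsParticleSystem (P n) θ b H T σ μ₀ n (B n) (X n))
    -- the McKean-Vlasov limit
    {Ω' : Type*} [MeasurableSpace Ω'] (P' : Measure Ω') [IsProbabilityMeasure P']
    (B' X' : ℝ → Ω' → ℝ) (μ' : ℝ → P2)
    (hX' : IsMcKeanVlasov P' θ b H T σ μ₀ B' X' μ') :
    -- all the integrals below are well defined
    (∀ n, ∀ᵐ ω ∂(P n), ∀ i, IntervalIntegrable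
      (fun s => g (X n i s ω) (empirical fun j => X n j s ω)) volume 0 T) ∧
    (∀ s ∈ Icc 0 T, Integrable (fun ω => g (X' s ω) (μ' s)) P') ∧
    IntervalIntegrable (fun s => ∫ ω, g (X' s ω) (μ' s) ∂P') volume 0 T ∧
    TendstoInProb P
      (fun n ω => (1 / ((n : ℝ) + 1)) * ∑ i : Fin (n + 1),
        ∫ s in (0 : ℝ)..T, g (X n i s ω) (empirical fun j => X n j s ω))
      (∫ s in (0 : ℝ)..T, ∫ ω, g (X' s ω) (μ' s) ∂P') := by
  obtain ⟨L, hL, hdrift⟩ := hb.exists_drift θ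
  obtain ⟨C, hC, q, hgint, hmean⟩ := exists_mean_sub_le hg
  obtain ⟨K, hK⟩ := hX'.exists_moment_le hT hH.1 hb hμ₀ (2 * q)
  obtain ⟨K₄, hK₄⟩ := hX'.exists_moment_le hT hH.1 hb hμ₀ 4
  have hμc := hX'.continuousOn_law hT hH.1 hb hμ₀
  set ν : ℝ → P2 := fun t => μ' (projIcc 0 T hT.le t)
  have hν : Continuous ν := continuous_flow_projIcc hT.le hμc
  have hνμ : ∀ t ∈ Icc 0 T, ν t = μ' t := fun t ht => by simp only [ν, projIcc_of_mem hT.le ht]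
  have hνK : ∀ t, Integrable (fun x : ℝ => |x| ^ (2 * q)) (ν t).toMeasure ∧
      ∫ x, |x| ^ (2 * q) ∂(ν t).toMeasure ≤ K := fun t => hK _ (projIcc 0 T hT.le t).2
  have hK0 : 0 ≤ K := (integral_nonneg fun x => by positivity).trans (hνK 0).2
  -- the limit
  have hgμ : ∀ (μ : P2) (ρ : Measure ℝ), AEStronglyMeasurable (fun x => g x μ) ρ := fun μ ρ =>
    (hg.continuous.comp (continuous_id.prodMk continuous_const)).aestronglyMeasurable
  have hint : ∀ s ∈ Icc 0 T, Integrable (fun ω => g (X' s ω) (μ' s)) P' := fun s hs => by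
    have h1 := hgint (μ' s) (hK s hs).1
    rw [← hX'.law s hs] at h1
    exact h1.comp_measurable (hX'.measurable s hs)
  have hmean_eq : ∀ s ∈ Icc 0 T, ∫ ω, g (X' s ω) (μ' s) ∂P' = ∫ z, g z (ν s) ∂(ν s).toMeasure := by
    intro s hs
    rw [hνμ s hs, ← hX'.law s hs,
      integral_map (hX'.measurable s hs).aemeasurable (hgμ _ _)]
  have hΨ := continuous_mean hC hmean hν hνK
  have hEq : EqOn (fun s => ∫ z, g z (ν s) ∂(ν s).toMeasure)
      (fun s => ∫ ω, g (X' s ω) (μ' s) ∂P') (uIcc 0 T) := fun s hs => by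
    rw [uIcc_of_le hT.le] at hs
    exact (hmean_eq s hs).symm
  -- the particles
  have hpath : ∀ n, ∀ᵐ ω ∂(P n), ∀ i, ContinuousOn
      (fun s => g (X n i s ω) (empirical fun j => X n j s ω)) (uIcc 0 T) := by
    intro n
    filter_upwards [(hX n).eq] with ω hω i
    rw [uIcc_of_le hT.le]
    exact hg.continuous.comp_continuousOn ((hω i).continuousOn.prodMk
      (continuous_empirical.comp_continuousOn (continuousOn_pi.2 fun j => (hω j).continuousOn)))
  refine ⟨fun n => (hpath n).mono fun ω hω i => (hω i).intervalIntegrable, hint,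
    (hΨ.intervalIntegrable 0 T).congr (hEq.mono uIoc_subset_uIcc), ?_⟩
  obtain ⟨C₁, hC₁, hbound⟩ := exists_pathwise_bound hT.le
    (L + 2 * L * Real.exp (2 * L * T) * (T * L)) hC hmean hν hνK
  intro ε hε
  rw [ENNReal.tendsto_nhds_zero]
  intro η hη
  obtain ⟨r, hr, hrη⟩ := ENNReal.lt_iff_exists_nnreal_btwn.1 hη
  replace hr : (0 : ℝ) < r := by exact_mod_cast hr
  -- The thresholds are chosen in this order. `c` makes the Markov bound `K * T / c` at most `r /
  -- 2`; `lam` makes the moment term `C₁ * lam * (1 + c)` equal to `ε / 4`; `δ` makes the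
  -- Wasserstein term at most `ε / 4`, and `δ ≤ 1` is required by the pathwise bound.
  set c : ℝ := 2 * (K * T + 1) / r
  have hc : 0 < c := by positivity
  set lam : ℝ := ε / (4 * C₁ * (1 + c))
  have hlam : 0 < lam := by positivity
  set δ : ℝ := min 1 (ε * lam / (4 * C₁))
  have hδ : 0 < δ := lt_min one_pos (by positivity)
  -- Integrated over `[0, T]` and divided by `δ`, this accuracy is exactly `r / 2`.
  filter_upwards [eventually_lintegral_W2_empirical_le K₄
    (ε := δ * r / (2 * T)) (by positivity)] with n hn
  obtain ⟨Y, hYc, hYm, hXY, hYlaw⟩ := (hX n).exists_close_coupling hX' hT hb hμc hL.le hdrift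
  have hYν : ∀ s ∈ Icc 0 T, (P n).map (Y s) = Measure.pi fun _ => (ν s).toMeasure := fun s hs => by
    rw [hνμ s hs, hYlaw s hs]
  have hPS : P n {ω | δ ≤ ∫ s in (0 : ℝ)..T, W2 (empirical (Y s ω)) (ν s) ^ 2} ≤
      ENNReal.ofReal (r / 2) := by
    have h4 : ∀ x : ℝ, |x| ^ 4 = x ^ 4 := fun x => Even.pow_abs (by decide) x
    simp only [h4] at hK₄
    refine (meas_ge_intervalIntegral_le (K := δ * r / (2 * T))
      (fun ω => (continuous_W2_comp (continuous_empirical_comp (hYc ω)) hν).pow 2)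
      (fun s => ?_) (fun s ω => sq_nonneg _) hT.le hδ fun s hs => ?_).trans_eq ?_
    · exact ((continuous_W2_comp continuous_empirical continuous_const).pow 2).measurable.comp (hYm s)
    · refine lintegral_W2_empirical_le_of_law (hYm s) (hYν s hs) (hn _ ?_ ?_)
      · exact (hK₄ _ (projIcc 0 T hT.le s).2).1
      · exact (hK₄ _ (projIcc 0 T hT.le s).2).2
    · congr 1
      field_simp
  have hPQ : P n {ω | c ≤ ∫ s in (0 : ℝ)..T, ∫ z, |z| ^ (2 * q) ∂(empirical (Y s ω)).toMeasure} ≤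
      ENNReal.ofReal (r / 2) := by
    refine (meas_ge_intervalIntegral_le (K := K) (fun ω => ?_) (fun s => ?_)
      (fun s ω => integral_nonneg fun z => by positivity) hT.le hc fun s hs => ?_).trans ?_
    · have := hYc ω
      simp_rw [integral_empirical]
      fun_prop
    · have := hYm s
      simp_rw [integral_empirical]
      fun_prop
    · exact lintegral_integral_empirical_le_of_law (hYm s) (hYν s hs) (by fun_prop)
        (fun x => by positivity) (hνK s).1 (hνK s).2
    · refine ENNReal.ofReal_le_ofReal ?_
      rw [div_le_iff₀ hc]
      simp only [c]
      field_simp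
      linarith
  -- Off the two exceptional events the error is at most `ε / 2`, which contradicts membership.
  have hsub : ({ω | ε ≤ |((1 / ((n : ℝ) + 1)) * ∑ i : Fin (n + 1),
        ∫ s in (0 : ℝ)..T, g (X n i s ω) (empirical fun j => X n j s ω)) -
        ∫ s in (0 : ℝ)..T, ∫ ω, g (X' s ω) (μ' s) ∂P'|} : Set (Ω n)) ≤ᵐ[P n]
      ({ω | δ ≤ ∫ s in (0 : ℝ)..T, W2 (empirical (Y s ω)) (ν s) ^ 2} ∪
        {ω | c ≤ ∫ s in (0 : ℝ)..T, ∫ z, |z| ^ (2 * q) ∂(empirical (Y s ω)).toMeasure} :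
        Set (Ω n)) := by
    filter_upwards [(hX n).eq, hpath n, hXY] with ω hω hp hxy hmem
    by_contra hnot
    have hS : ∫ s in (0 : ℝ)..T, W2 (empirical (Y s ω)) (ν s) ^ 2 < δ :=
      not_le.1 fun h => hnot (Or.inl h)
    have hQ : ∫ s in (0 : ℝ)..T, ∫ z, |z| ^ (2 * q) ∂(empirical (Y s ω)).toMeasure < c :=
      not_le.1 fun h => hnot (Or.inr h)
    set x : ℝ → Fin (n + 1) → ℝ := fun t i => X n i (projIcc 0 T hT.le t) ω
    have hx : Continuous x := continuous_projIcc_paths hT.le hω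
    have hgx : ∀ i, Continuous fun s => g (x s i) (empirical (x s)) := fun i =>
      hg.continuous.comp (((continuous_apply i).comp hx).prodMk (continuous_empirical_comp hx))
    have hgm : Continuous fun s => ∫ z, g z (empirical (x s)) ∂(empirical (x s)).toMeasure := by
      simp_rw [integral_empirical]
      exact continuous_const.mul (continuous_finsetSum _ fun i _ => hgx i)
    have hsum : ∫ s in (0 : ℝ)..T, ∫ z, g z (empirical (x s)) ∂(empirical (x s)).toMeasure =
        (1 / ((n : ℝ) + 1)) * ∑ i : Fin (n + 1),
          ∫ s in (0 : ℝ)..T, g (X n i s ω) (empirical fun j => X n j s ω) := by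
      simp_rw [integral_empirical]
      rw [intervalIntegral.integral_const_mul, intervalIntegral.integral_finsetSum
        fun i _ => (hgx i).intervalIntegrable _ _]
      congr 1
      refine Finset.sum_congr rfl fun i _ => intervalIntegral.integral_congr fun s hs => ?_
      rw [uIcc_of_le hT.le] at hs
      simp only [x, projIcc_of_mem hT.le hs]
    have hle := hbound n x (fun t => Y t ω) (hYc ω) (hgm.intervalIntegrable _ _)
      (hΨ.intervalIntegrable _ _) hxy (hS.le.trans (min_le_left _ _)) lam hlam
    rw [hsum, intervalIntegral.integral_congr hEq] at hle
    have h1 : C₁ * ((∫ s in (0 : ℝ)..T, W2 (empirical (Y s ω)) (ν s) ^ 2) / lam + lam * (1 +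
        ∫ s in (0 : ℝ)..T, ∫ z, |z| ^ (2 * q) ∂(empirical (Y s ω)).toMeasure)) ≤
        C₁ * (ε * lam / (4 * C₁) / lam + lam * (1 + c)) := by
      have := hS.le.trans (min_le_right _ _)
      gcongr
    have h2 : C₁ * (ε * lam / (4 * C₁) / lam + lam * (1 + c)) = ε / 2 := by
      have : lam * (1 + c) = ε / (4 * C₁) := by
        simp only [lam]
        field_simp
      rw [this]
      field_simp
      norm_num
    have h3 : ε ≤ ε / 2 := le_trans hmem (hle.trans (h1.trans_eq h2))
    linarith
  calc _ ≤ _ := measure_mono_ae hsub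
    _ ≤ _ := measure_union_le _ _
    _ ≤ ENNReal.ofReal (r / 2) + ENNReal.ofReal (r / 2) := add_le_add hPS hPQ
    _ = r := by
        rw [← ENNReal.ofReal_add (by positivity) (by positivity), add_halves, ENNReal.ofReal_coe_nnreal]
    _ ≤ η := hrη.le
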